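/- Let $p=(p_k)_{k\ge1}$ be a probability distribution on $\{1,2,\dots\}$ with $\sum_k k^{1+\varepsilon}p_k<\infty$ for some $\varepsilon>0$. **Notation.** For $x=(x_0,x_1,\dots)$ with $x_k\ge 0$ for $k\ge1$ put $r(x)=x_0^+ +\sum_{k\ge1}kx_k$, $r_0(x)=x_0^+/r(x)$ and $r_k(x)=kx_k/r(x)$ $(k\ge1)$ if $0<r(x)<\infty$, and $r_k(x)=0$ for all $k\ge 0$ otherwise. Let $\ell(u)=u\log u-u+1$ for $u\ge 0$, and $\Gamma(\psi)(t)=\psi(t)-\big(\inf_{0\le s\le t}\psi(s)\big)\wedge 0$. Conventions: $0\log 0=0$, $0\log(u/0)=0$ for $u\ge0$, $u\log(u/0)=\infty$ for $u>0$; the infimum over the empty set is $\infty$. For $T\ge0$ let $\mathcal C_T$ be the set of pairs of continuous functions $\zeta=(\zeta_k)_{k\ge0}:[0,T]\to\mathbb R^\infty$, $\psi:[0,T]\to\mathbb R$ such that $\psi$ is absolutely continuous with $\psi(0)=0$, $\zeta_0=\Gamma(\psi)$, and for each $k\ge1$ the function $\zeta_k$ is nonnegative, non-increasing and absolutely continuous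 with $\zeta_k(0)=p_k$. For $(\zeta,\psi)\in\mathcal C_T$ let $\mathcal S_T(\zeta,\psi)$ be the set of sequences $\varphi=(\varphi_k)_{k\ge0}$ of measurable functions $\varphi_k:[0,T]\times[0,1]\to[0,\infty)$ such that for all $t\in[0,T]$ $$\psi(t)=\sum_{k\ge0}(k-2)\int_{[0,t]\times[0,1]}1_{[0,r_k(\zeta(s)))}(y)\,\varphi_k(s,y)\,ds\,dy,\qquad \zeta_k(t)=p_k-\int_{[0,t]\times[0,1]}1_{[0,r_k(\zeta(s)))}(y)\,\varphi_k(s,y)\,ds\,dy\quad(k\ge1).$$ For $0\le t_1\le t_2$ and $(\zeta,\psi)\in\mathcal C_{t_2}$ put $$I_{t_1,t_2}(\zeta,\psi)=\inf_{\varphi\in\mathcal S_{t_2}(\zeta,\psi)}\ \sum_{k\ge0}\int_{[t_1,t_2]\times[0,1]}\ell(\varphi_k(s,y))\,ds\,dy .$$ Let $\mathcal J^0_{t_1,t_2}(x,x')$ be the set of $(\zeta,\psi)\in\mathcal C_{t_2}$ with $\zeta(t_1)=x$ and $\zeta(t_2)=x'$; let $\mathcal J^2_{t_1,t_2}(x,x')$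 be the set of those $(\zeta,\psi)\in\mathcal J^0_{t_1,t_2}(x,x')$ for which also $\psi(t)\ge\psi(t_1)-x_0$ for all $t\in(t_1,t_2)$ and $\frac{d}{dt}r(\zeta(t))=-2$ for a.e. $t\in(t_1,t_2)$; and let $I^2_{t_1,t_2}(x,x')=\inf_{(\zeta,\psi)\in\mathcal J^2_{t_1,t_2}(x,x')}I_{t_1,t_2}(\zeta,\psi)$. For $x\in\mathbb R_+^\infty$ and $b=(b_k)_{k\ge0}$ with $b_k\le0$ for $k\ge1$ let $$L(x,b)=\sum_{k\ge0}\nu(k|b)\log\frac{\nu(k|b)}{\mu(k|x)}\ \text{ if }\ \sum_{k\ge1}b_k\ge-1,\qquad L(x,b)=\infty\ \text{ otherwise},$$ where $\nu(0|b)=1+\sum_{k\ge1}b_k$, $\nu(k|b)=-b_k$ for $k\ge1$, $\mu(k|x)=r_k(x)$ if $x\ne0$, and $\mu(k|0)=1_{\{k=0\}}$. **Setting.** Let $x^{(i)}=(x^{(i)}_0,p^{(i)})$, $i=1,2$, with $x_0^{(i)}\ge0$ and $0\le p^{(2)}\le p^{(1)}\le p$ coordinatewise; put $z=x^{(1)}-x^{(2)}$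 and $\varsigma=\frac12\big(r(x^{(1)})-r(x^{(2)})\big)$. Suppose that $\varsigma\ge0$ and $\sum_{k\ge1}kz_k+z_0>2\sum_{k\ge1}z_k$. Let $t_1\ge0$ and let $(\zeta^*,\psi^*)\in\mathcal J^0_{0,t_1}\big((0,p),x^{(1)}\big)$ with $I_{0,t_1}(\zeta^*,\psi^*)<\infty$. **Claim.** Let $\beta=0$ if $x_0^{(2)}=0$ and $z_1=0$. If $x_0^{(2)}>0$ or $z_1>0$, then there is a unique $\beta\in(0,1)$ with $$\sum_{k\ge1}kz_k=(1-\beta^2)\sum_{k\ge1}\frac{kz_k}{1-\beta^k}+x_0^{(2)}-\beta^2x_0^{(1)},$$ and $\beta$ denotes this number. Put $\tilde\varsigma=\varsigma/(1-\beta^2)$ and $\tilde z_k=z_k/(1-\beta^k)$ for $k\ge 1$. Define $(\tilde\zeta,\tilde\psi)=(\zeta^*,\psi^*)$ on $[0,t_1]$ and, for $t\in[t_1,t_1+\varsigma]$, $$\tilde\zeta_k(t)=p^{(1)}_k-\tilde z_k\Big[1-\Big(1-\frac{t-t_1}{\tilde\varsigma}\Big)^{k/2}\Big]\quad(k\ge1),$$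 $$\tilde\zeta_0(t)=x^{(1)}_0+\sum_{k\ge1}k\big(p^{(1)}_k-\tilde\zeta_k(t)\big)-2(t-t_1),\qquad \tilde\psi(t)=\psi^*(t_1)+\sum_{k\ge1}k\big(p^{(1)}_k-\tilde\zeta_k(t)\big)-2(t-t_1).$$ Then $(\tilde\zeta,\tilde\psi)\in\mathcal J^2_{t_1,t_1+\varsigma}(x^{(1)},x^{(2)})$ and $$I^2_{t_1,t_1+\varsigma}(x^{(1)},x^{(2)})=\inf_{(\zeta,\psi)\in\mathcal J^2_{t_1,t_1+\varsigma}(x^{(1)},x^{(2)})}\int_{t_1}^{t_1+\varsigma}L(\zeta(s),\zeta'(s))\,ds=\int_{t_1}^{t_1+\varsigma}L(\tilde\zeta(s),\tilde\zeta'(s))\,ds .$$ -/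

import Mathlib

open Set MeasureTheory
open scoped NNReal ENNReal

noncomputable section

namespace ConfigModel

/-- States are sequences `x = (x₀, x₁, x₂, …)`. This is `r(x) = x₀⁺ + ∑_{k ≥ 1} k x_k`
(the `k = 0` term of the series vanishes). -/
def r (x : ℕ → ℝ) : ℝ := max (x 0) 0 + ∑' k : ℕ, (k : ℝ) * x k

open Classical in
/-- `r₀(x) = x₀⁺ / r(x)` and `r_k(x) = k x_k / r(x)` for `k ≥ 1` if `0 < r(x) < ∞`,
and `0` otherwise. -/
def rk (x : ℕ → ℝ) (k : ℕ) : ℝ :=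
  if Summable (fun j : ℕ => (j : ℝ) * x j) ∧ 0 < r x then
    (if k = 0 then max (x 0) 0 else (k : ℝ) * x k) / r x
  else 0

/-- The one-dimensional Skorokhod map `Γ(ψ)(t) = ψ(t) - (inf_{0 ≤ s ≤ t} ψ(s)) ∧ 0`. -/
def skorokhod (ψ : ℝ → ℝ) (t : ℝ) : ℝ := ψ t - min (sInf (ψ '' Icc 0 t)) 0

/-- The set `𝒞_T` of admissible pairs `(ζ, ψ)` on `[0, T]`. The values of the functions outside
`[0, T]` are irrelevant. -/
structure Admissible (p : ℕ → ℝ) (T : ℝ) (ζ : ℝ → ℕ → ℝ) (ψ : ℝ → ℝ) : Prop where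
  cont_ζ : ContinuousOn ζ (Icc 0 T)
  cont_ψ : ContinuousOn ψ (Icc 0 T)
  ψ_zero : ψ 0 = 0
  ψ_ac : AbsolutelyContinuousOnInterval ψ 0 T
  ζ_refl : ∀ t ∈ Icc 0 T, ζ t 0 = skorokhod ψ t
  ζ_init : ∀ k : ℕ, 1 ≤ k → ζ 0 k = p k
  ζ_anti : ∀ k : ℕ, 1 ≤ k → AntitoneOn (fun t => ζ t k) (Icc 0 T)
  ζ_ac : ∀ k : ℕ, 1 ≤ k → AbsolutelyContinuousOnInterval (fun t => ζ t k) 0 T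
  ζ_nonneg : ∀ k : ℕ, 1 ≤ k → ∀ t ∈ Icc 0 T, 0 ≤ ζ t k

/-- `∫_{[0,t] × [0,1]} 1_{[0, r_k(ζ(s)))}(y) φ_k(s, y) ds dy`. -/
def flow (ζ : ℝ → ℕ → ℝ) (φ : ℕ → ℝ × ℝ → ℝ≥0) (k : ℕ) (t : ℝ) : ℝ≥0∞ :=
  ∫⁻ q in Icc (0 : ℝ) t ×ˢ Icc (0 : ℝ) 1,
    {q : ℝ × ℝ | q.2 < rk (ζ q.1) k}.indicator (fun q => (φ k q : ℝ≥0∞)) q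

/-- The set `𝒮_T(ζ, ψ)` of controls `φ = (φ_k)_{k ≥ 0}` that drive the pair `(ζ, ψ)` on
`[0, T]`. -/
structure IsControl (p : ℕ → ℝ) (T : ℝ) (ζ : ℝ → ℕ → ℝ) (ψ : ℝ → ℝ)
    (φ : ℕ → ℝ × ℝ → ℝ≥0) : Prop where
  meas : ∀ k, Measurable (φ k)
  finite : ∀ k, ∀ t ∈ Icc 0 T, flow ζ φ k t ≠ ⊤
  eq_ψ : ∀ t ∈ Icc 0 T, HasSum (fun k : ℕ => ((k : ℝ) - 2) * (flow ζ φ k t).toReal) (ψ t)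
  eq_ζ : ∀ k : ℕ, 1 ≤ k → ∀ t ∈ Icc 0 T, ζ t k = p k - (flow ζ φ k t).toReal

/-- `ℓ(x) = x log x - x + 1`, with `0 log 0 = 0`. -/
def ell (x : ℝ) : ℝ := x * Real.log x - x + 1

/-- `∑_{k ≥ 0} ∫_{[t₁,t₂] × [0,1]} ℓ(φ_k(s, y)) ds dy`; note that `ℓ ≥ 0` on `[0, ∞)`. -/
def controlCost (t₁ t₂ : ℝ) (φ : ℕ → ℝ × ℝ → ℝ≥0) : ℝ≥0∞ :=
  ∑' k : ℕ, ∫⁻ q in Icc t₁ t₂ ×ˢ Icc (0 : ℝ) 1, ENNReal.ofReal (ell (φ k q))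

/-- `I_{t₁,t₂}(ζ, ψ)`, the infimum of the cost over `𝒮_{t₂}(ζ, ψ)` (`∞` if that set is empty). -/
def pathCost (p : ℕ → ℝ) (t₁ t₂ : ℝ) (ζ : ℝ → ℕ → ℝ) (ψ : ℝ → ℝ) : ℝ≥0∞ :=
  ⨅ (φ : ℕ → ℝ × ℝ → ℝ≥0) (_ : IsControl p t₂ ζ ψ φ), controlCost t₁ t₂ φ

/-- `𝒥⁰_{t₁,t₂}(x₁, x₂)`. -/
def J0 (p : ℕ → ℝ) (t₁ t₂ : ℝ) (x₁ x₂ : ℕ → ℝ) : Set ((ℝ → ℕ → ℝ) × (ℝ → ℝ)) :=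
  {w | Admissible p t₂ w.1 w.2 ∧ w.1 t₁ = x₁ ∧ w.1 t₂ = x₂}

/-- `𝒥¹_{t₁,t₂}(x₁, x₂)`. -/
def J1 (p : ℕ → ℝ) (t₁ t₂ : ℝ) (x₁ x₂ : ℕ → ℝ) : Set ((ℝ → ℕ → ℝ) × (ℝ → ℝ)) :=
  {w | w ∈ J0 p t₁ t₂ x₁ x₂ ∧ ∀ t ∈ Ioo t₁ t₂, w.2 t₁ - x₁ 0 ≤ w.2 t}

/-- `𝒥²_{t₁,t₂}(x₁, x₂)`. -/
def J2 (p : ℕ → ℝ) (t₁ t₂ : ℝ) (x₁ x₂ : ℕ → ℝ) : Set ((ℝ → ℕ → ℝ) × (ℝ → ℝ)) :=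
  {w | w ∈ J1 p t₁ t₂ x₁ x₂ ∧
    ∀ᵐ t : ℝ, t ∈ Ioo t₁ t₂ → HasDerivAt (fun s => r (w.1 s)) (-2) t}

/-- `I²_{t₁,t₂}(x₁, x₂)`. -/
def I2 (p : ℕ → ℝ) (t₁ t₂ : ℝ) (x₁ x₂ : ℕ → ℝ) : ℝ≥0∞ :=
  ⨅ w ∈ J2 p t₁ t₂ x₁ x₂, pathCost p t₁ t₂ w.1 w.2

/-- `a log (a / b)` with the conventions `0 log (0 / b) = 0` and `a log (a / 0) = ∞`, `a > 0`. -/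
def logTerm (a b : ℝ) : EReal :=
  if a = 0 then 0 else if b = 0 then ⊤ else ((a * Real.log (a / b) : ℝ) : EReal)

/-- `ν(0|b) = 1 + ∑_{k ≥ 1} b_k`, `ν(k|b) = -b_k` for `k ≥ 1`. -/
def nu (b : ℕ → ℝ) (k : ℕ) : ℝ := if k = 0 then 1 + ∑' j : ℕ, b (j + 1) else -b k

open Classical in
/-- `μ(·|x) = r_·(x)` for `x ≠ 0`, and the unit mass at `0` for `x = 0`. -/
def mu (x : ℕ → ℝ) (k : ℕ) : ℝ := if x = 0 then (if k = 0 then 1 else 0) else rk x k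

/-- The sum of an extended real series as the sum of the positive parts minus the sum of the
negative parts. -/
def esum (f : ℕ → EReal) : EReal :=
  ((∑' k, (f k).toENNReal : ℝ≥0∞) : EReal) - ((∑' k, (-f k).toENNReal : ℝ≥0∞) : EReal)

/-- The integral over `[a, b]` of an extended real function as the integral of the positive part
minus the integral of the negative part. -/
def eint (a b : ℝ) (f : ℝ → EReal) : EReal :=
  ((∫⁻ s in Icc a b, (f s).toENNReal : ℝ≥0∞) : EReal) -
    ((∫⁻ s in Icc a b, (-f s).toENNReal : ℝ≥0∞) : EReal)

open Classical in
/-- The local cost `L(x, b) = ∑_{k ≥ 0} ν(k|b) log (ν(k|b) / μ(k|x))` if `b_k ≤ 0` for `k ≥ 1`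
and `∑_{k ≥ 1} b_k ≥ -1`, and `∞` otherwise. -/
def L (x b : ℕ → ℝ) : EReal :=
  if (∀ k : ℕ, 1 ≤ k → b k ≤ 0) ∧ Summable (fun k : ℕ => b (k + 1)) ∧
      -1 ≤ ∑' k : ℕ, b (k + 1) then
    esum (fun k => logTerm (nu b k) (mu x k))
  else ⊤

/-- `∫_{t₁}^{t₂} L(ζ(s), ζ'(s)) ds`. -/
def LCost (t₁ t₂ : ℝ) (ζ : ℝ → ℕ → ℝ) : EReal :=
  eint t₁ t₂ (fun s => L (ζ s) (fun k => deriv (fun u => ζ u k) s))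

/-- `ς(x₁, x₂) = (r(x₁) - r(x₂)) / 2`. -/
def varsig (x₁ x₂ : ℕ → ℝ) : ℝ := (r x₁ - r x₂) / 2

/-- `β` is the parameter attached to `(x₁, x₂)`: with `z = x₁ - x₂`, it is `0` if
`x₂(0) = 0` and `z₁ = 0`, and a solution in `(0, 1)` of
`∑ k z_k = (1 - β²) ∑ k z_k / (1 - β^k) + x₂(0) - β² x₁(0)` if `x₂(0) > 0` or `z₁ > 0`. -/
def IsBeta (x₁ x₂ : ℕ → ℝ) (β : ℝ) : Prop :=
  (x₂ 0 = 0 ∧ x₁ 1 - x₂ 1 = 0 ∧ β = 0) ∨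
  ((0 < x₂ 0 ∨ 0 < x₁ 1 - x₂ 1) ∧ β ∈ Ioo (0 : ℝ) 1 ∧
    ∑' k : ℕ, ((k : ℝ) + 1) * (x₁ (k + 1) - x₂ (k + 1)) =
      (1 - β ^ 2) *
          ∑' k : ℕ, ((k : ℝ) + 1) * (x₁ (k + 1) - x₂ (k + 1)) / (1 - β ^ (k + 1))
        + x₂ 0 - β ^ 2 * x₁ 0)

/-- `p_k^{(1)} - z̃_k [1 - (1 - (t - t₁) / ς̃)^{k/2}]` for `k ≥ 1`, where `ς̃ = ς / (1 - β²)` and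
`z̃_k = z_k / (1 - β^k)`. -/
def tildeCoord (t₁ : ℝ) (x₁ x₂ : ℕ → ℝ) (β : ℝ) (t : ℝ) (k : ℕ) : ℝ :=
  x₁ k - (x₁ k - x₂ k) / (1 - β ^ k) *
    (1 - (1 - (t - t₁) / (varsig x₁ x₂ / (1 - β ^ 2))) ^ ((k : ℝ) / 2))

/-- `∑_{k ≥ 1} k (p_k^{(1)} - ζ̃_k(t)) - 2 (t - t₁)`. -/
def tildeIncr (t₁ : ℝ) (x₁ x₂ : ℕ → ℝ) (β : ℝ) (t : ℝ) : ℝ :=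
  (∑' k : ℕ, ((k : ℝ) + 1) * (x₁ (k + 1) - tildeCoord t₁ x₁ x₂ β t (k + 1))) - 2 * (t - t₁)

/-- The candidate path `ζ̃`: it follows `ζs` up to time `t₁` and the explicit formulas after. -/
def tildeζ (t₁ : ℝ) (x₁ x₂ : ℕ → ℝ) (β : ℝ) (ζs : ℝ → ℕ → ℝ) (t : ℝ) (k : ℕ) : ℝ :=
  if t ≤ t₁ then ζs t k
  else if k = 0 then x₁ 0 + tildeIncr t₁ x₁ x₂ β t
  else tildeCoord t₁ x₁ x₂ β t k

/-- The companion `ψ̃` of the candidate path. -/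
def tildeψ (t₁ : ℝ) (x₁ x₂ : ℕ → ℝ) (β : ℝ) (ψs : ℝ → ℝ) (t : ℝ) : ℝ :=
  if t ≤ t₁ then ψs t else ψs t₁ + tildeIncr t₁ x₁ x₂ β t

end ConfigModel

end

open ConfigModel

/-!
The explicit path is minimal by calibration: each coordinate of the cost is bounded below by a
tangent line that is an equality along the explicit path, and the bounds add up to the same total.

The integrand of the local cost is convex in `ν`: for every `θ > 0`,
`ν log (ν / μ) - ν + μ ≥ ν log θ - μ θ + μ`, with equality at `θ = ν / μ`. Along the explicit path
`ν(k) / μ(k) = κ w^{k/2} z̃_k / ζ̃_k` for `k ≥ 1`, where `w` decreases linearly from `1` to `β²` and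
`κ = r(ζ̃) / (2 ς̃ w)` depends on time only, since `r` decreases at rate `2` along every path. For
another path `ζ` the slope is taken at its own position, `θ_k = κ w^{k/2} z̃_k / ζ_k`. Then
`μ(k) θ_k` is deterministic for `k ≥ 1`, and `ν(k) log (z̃_k / ζ_k)` is an exact derivative because
`ν(k) = -ζ_k'`. The remaining term `∑ ν(k) log (κ w^{k/2})` involves only `∑ ν(k) = 1` and
`∑ k ν(k)`, which `r' = -2` ties to the zeroth coordinate.

After summation over `k` and integration up to `s < t₁ + ς`, the lower bounds of two paths therefore
differ only by boundary terms at time `s`. Those vanish as `s` tends to `t₁ + ς`, where both paths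
arrive at the same state. The only delicate case is `β = 0`, in which `log w` diverges at the end;
there the zeroth coordinates are at most of order `w`.

On the side of controls, Jensen's inequality for `ℓ` shows that a control costs at least the
integral of `L`, and the control that is constant in `y` below `r_k` and equal to `1` above attains
it.
-/

noncomputable section

namespace ConfigModel

/-! ### The equation for `β` -/

/-- The ratio of the two extreme terms of `1 + x + ⋯ + x ^ m` to the whole sum. It measures
`(1 - x²) / (1 - x ^ (m + 1))`, see `one_sub_sq_div_one_sub_pow`, but stays regular at `x = 1`. -/
def endRatio (m : ℕ) (x : ℝ) : ℝ := (1 + x ^ m) / ∑ i ∈ Finset.range (m + 1), x ^ i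

theorem two_mul_geom_sum (m : ℕ) (x : ℝ) :
    2 * ∑ i ∈ Finset.range (m + 1), x ^ i =
      ∑ i ∈ Finset.range (m + 1), (x ^ i + x ^ (m - i)) := by
  rw [Finset.sum_add_distrib, two_mul, ← Finset.sum_range_reflect (fun i => x ^ i) (m + 1)]
  simp only [Nat.add_sub_cancel]

theorem pow_add_pow_sub_mul_le {a b : ℝ} (ha : 0 ≤ a) (hab : a ≤ b) (hb : b ≤ 1) {m i : ℕ}
    (hi : i ≤ m) :
    (a ^ i + a ^ (m - i)) * (1 + b ^ m) ≤ (b ^ i + b ^ (m - i)) * (1 + a ^ m) := by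
  obtain ⟨j, rfl⟩ := Nat.exists_eq_add_of_le hi
  rw [Nat.add_sub_cancel_left]
  have hb0 : 0 ≤ b := ha.trans hab
  have hab1 : a * b ≤ 1 := mul_le_one₀ (hab.trans hb) hb0 hb
  have hi_term : 0 ≤ (b ^ i - a ^ i) * (1 - (a * b) ^ j) :=
    mul_nonneg (sub_nonneg.2 (by gcongr)) (sub_nonneg.2 (pow_le_one₀ (by positivity) hab1))
  have hj_term : 0 ≤ (b ^ j - a ^ j) * (1 - (a * b) ^ i) :=
    mul_nonneg (sub_nonneg.2 (by gcongr)) (sub_nonneg.2 (pow_le_one₀ (by positivity) hab1))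
  simp only [mul_pow, pow_add] at *
  linarith

theorem add_pow_pred_mul_lt {a b : ℝ} (ha : 0 ≤ a) (hab : a < b) (hb : b ≤ 1) {m : ℕ}
    (hm : 2 ≤ m) :
    (a ^ 1 + a ^ (m - 1)) * (1 + b ^ m) < (b ^ 1 + b ^ (m - 1)) * (1 + a ^ m) := by
  obtain ⟨j, rfl⟩ := Nat.exists_eq_add_of_le (one_le_two.trans hm)
  rw [Nat.add_sub_cancel_left]
  have hb0 : 0 ≤ b := ha.trans hab.le
  have hab1 : a * b < 1 := mul_lt_one_of_nonneg_of_lt_one_left ha (hab.trans_le hb) hb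
  have hpow : (a * b) ^ j < 1 := pow_lt_one₀ (by positivity) hab1 (by lia)
  have h1_term : 0 < (b - a) * (1 - (a * b) ^ j) := mul_pos (sub_pos.2 hab) (sub_pos.2 hpow)
  have hj_term : 0 ≤ (b ^ j - a ^ j) * (1 - a * b) :=
    mul_nonneg (sub_nonneg.2 (by gcongr)) (sub_nonneg.2 hab1.le)
  simp only [mul_pow, pow_add, pow_one] at *
  linarith

theorem endRatio_antitoneOn (m : ℕ) : AntitoneOn (endRatio m) (Icc 0 1) := by
  intro a ha b hb hab
  unfold endRatio
  rw [div_le_div_iff₀ (geom_sum_pos hb.1 m.succ_ne_zero) (geom_sum_pos ha.1 m.succ_ne_zero),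
    ← mul_le_mul_iff_right₀ two_pos, mul_left_comm, mul_left_comm 2, two_mul_geom_sum,
    two_mul_geom_sum, mul_comm, mul_comm (1 + a ^ m), Finset.sum_mul, Finset.sum_mul]
  exact Finset.sum_le_sum fun i hi =>
    pow_add_pow_sub_mul_le ha.1 hab hb.2 (Finset.mem_range_succ_iff.1 hi)

theorem endRatio_strictAntiOn {m : ℕ} (hm : 2 ≤ m) : StrictAntiOn (endRatio m) (Icc 0 1) := by
  intro a ha b hb hab
  unfold endRatio
  rw [div_lt_div_iff₀ (geom_sum_pos hb.1 m.succ_ne_zero) (geom_sum_pos ha.1 m.succ_ne_zero),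
    ← mul_lt_mul_iff_right₀ two_pos, mul_left_comm, mul_left_comm 2, two_mul_geom_sum,
    two_mul_geom_sum, mul_comm, mul_comm (1 + a ^ m), Finset.sum_mul, Finset.sum_mul]
  exact Finset.sum_lt_sum
    (fun i hi => pow_add_pow_sub_mul_le ha.1 hab.le hb.2 (Finset.mem_range_succ_iff.1 hi))
    ⟨1, Finset.mem_range.2 (by lia), add_pow_pred_mul_lt ha.1 hab hb.2 hm⟩

theorem endRatio_zero_right (m : ℕ) : endRatio m 0 = if m = 0 then 2 else 1 := by
  rcases eq_or_ne m 0 with rfl | hm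
  · norm_num [endRatio]
  · simp [endRatio, hm, Finset.sum_range_succ']

theorem endRatio_one_right (m : ℕ) : endRatio m 1 = 2 / ((m : ℝ) + 1) := by
  simp [endRatio, one_add_one_eq_two]

theorem continuousOn_endRatio (m : ℕ) : ContinuousOn (endRatio m) (Icc 0 1) := by
  unfold endRatio
  exact ContinuousOn.div (by fun_prop) (by fun_prop) fun x hx =>
    (geom_sum_pos hx.1 m.succ_ne_zero).ne'

theorem abs_endRatio_sub_one_le (m : ℕ) {x : ℝ} (hx : x ∈ Icc (0 : ℝ) 1) :
    |endRatio m x - 1| ≤ 1 := by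
  have hle := endRatio_antitoneOn m (left_mem_Icc.2 zero_le_one) hx hx.1
  have hge : 0 ≤ endRatio m x :=
    div_nonneg (add_nonneg zero_le_one (pow_nonneg hx.1 m)) (geom_sum_pos hx.1 m.succ_ne_zero).le
  rw [endRatio_zero_right] at hle
  rw [abs_le]
  split_ifs at hle <;> constructor <;> linarith

theorem one_sub_sq_div_one_sub_pow {x : ℝ} (hx : x ∈ Ico (0 : ℝ) 1) (m : ℕ) :
    (1 - x ^ 2) / (1 - x ^ (m + 1)) = 1 + x * (endRatio m x - 1) := by
  have hsum := geom_sum_pos hx.1 m.succ_ne_zero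
  have hx1 : 0 < 1 - x := sub_pos.2 hx.2
  have hgeom := mul_neg_geom_sum x (m + 1)
  rw [endRatio, ← hgeom, div_eq_iff (by positivity)]
  field_simp
  rw [pow_succ] at hgeom
  linear_combination (x - 1) * hgeom

/-- The series `∑ₘ (m + 1) aₘ (endRatio m x - 1)`, through which the equation for `β` becomes
`X₂ + β * betaSeries a β - β² X₁ = 0`, see `beta_equation_iff`; here `aₘ` is the coordinate
`m + 1` of `x₁ - x₂`, and `X₁`, `X₂` are the zeroth coordinates of `x₁`, `x₂`. -/
def betaSeries (a : ℕ → ℝ) (x : ℝ) : ℝ := ∑' m : ℕ, ((m : ℝ) + 1) * a m * (endRatio m x - 1)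

theorem betaSeries_zero (a : ℕ → ℝ) : betaSeries a 0 = a 0 := by
  rw [betaSeries, tsum_eq_single 0 fun m hm => by simp [endRatio_zero_right, hm]]
  norm_num [endRatio_zero_right]

section BetaEquation

variable {a : ℕ → ℝ} {X₁ X₂ : ℝ} (ha : ∀ m, 0 ≤ a m)
  (hs : Summable fun m : ℕ => ((m : ℝ) + 1) * a m)
include ha

theorem norm_betaSeries_term_le (m : ℕ) {x : ℝ} (hx : x ∈ Icc (0 : ℝ) 1) :
    ‖((m : ℝ) + 1) * a m * (endRatio m x - 1)‖ ≤ ((m : ℝ) + 1) * a m := by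
  have hnonneg : 0 ≤ ((m : ℝ) + 1) * a m := mul_nonneg (by positivity) (ha m)
  rw [norm_mul, Real.norm_of_nonneg hnonneg, Real.norm_eq_abs]
  exact mul_le_of_le_one_right hnonneg (abs_endRatio_sub_one_le m hx)

include hs

theorem summable_betaSeries {x : ℝ} (hx : x ∈ Icc (0 : ℝ) 1) :
    Summable fun m : ℕ => ((m : ℝ) + 1) * a m * (endRatio m x - 1) :=
  hs.of_norm_bounded fun m => norm_betaSeries_term_le ha m hx

theorem continuousOn_betaSeries : ContinuousOn (betaSeries a) (Icc 0 1) :=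
  continuousOn_tsum
    (fun m => continuousOn_const.mul ((continuousOn_endRatio m).sub continuousOn_const)) hs
    fun m _ hx => norm_betaSeries_term_le ha m hx

theorem summable_of_summable_succ_mul : Summable a :=
  hs.of_nonneg_of_le ha fun m => le_mul_of_one_le_left (ha m) (by simp)

theorem betaSeries_one :
    betaSeries a 1 = 2 * ∑' m, a m - ∑' m : ℕ, ((m : ℝ) + 1) * a m := by
  rw [← tsum_mul_left, ← ((summable_of_summable_succ_mul ha hs).mul_left 2).tsum_sub hs]
  refine tsum_congr fun m => ?_
  rw [endRatio_one_right]
  field_simp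

theorem betaSeries_antitoneOn : AntitoneOn (betaSeries a) (Icc 0 1) := fun _ hx _ hy hxy =>
  (summable_betaSeries ha hs hy).tsum_le_tsum
    (fun m => mul_le_mul_of_nonneg_left (sub_le_sub_right (endRatio_antitoneOn m hx hy hxy) 1)
      (mul_nonneg (by positivity) (ha m)))
    (summable_betaSeries ha hs hx)

theorem betaSeries_strictAntiOn {m : ℕ} (hm : 2 ≤ m) (ham : 0 < a m) :
    StrictAntiOn (betaSeries a) (Icc 0 1) := fun _ hx _ hy hxy =>
  (summable_betaSeries ha hs hy).tsum_lt_tsum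
    (fun m => mul_le_mul_of_nonneg_left (sub_le_sub_right (endRatio_antitoneOn m hx hy hxy.le) 1)
      (mul_nonneg (by positivity) (ha m)))
    (mul_lt_mul_of_pos_left (sub_lt_sub_right (endRatio_strictAntiOn hm hx hy hxy) 1)
      (by positivity))
    (summable_betaSeries ha hs hx)

theorem beta_equation_iff {x : ℝ} (hx : x ∈ Ico (0 : ℝ) 1) :
    (∑' m : ℕ, ((m : ℝ) + 1) * a m =
      (1 - x ^ 2) * ∑' m : ℕ, ((m : ℝ) + 1) * a m / (1 - x ^ (m + 1)) + X₂ - x ^ 2 * X₁) ↔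
    X₂ + x * betaSeries a x - x ^ 2 * X₁ = 0 := by
  have hseries : (1 - x ^ 2) * ∑' m : ℕ, ((m : ℝ) + 1) * a m / (1 - x ^ (m + 1)) =
      ∑' m : ℕ, ((m : ℝ) + 1) * a m + x * betaSeries a x := by
    rw [betaSeries, ← tsum_mul_left, ← tsum_mul_left,
      ← hs.tsum_add ((summable_betaSeries ha hs (Ico_subset_Icc_self hx)).mul_left x)]
    refine tsum_congr fun m => ?_
    rw [mul_div_assoc', mul_comm (1 - x ^ 2), mul_div_assoc, one_sub_sq_div_one_sub_pow hx]
    ring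
  rw [hseries]
  constructor <;> intro h <;> linarith

theorem exists_pos_of_two_mul_tsum_lt
    (hlt : 2 * ∑' m, a m < ∑' m : ℕ, ((m : ℝ) + 1) * a m) : ∃ m, 2 ≤ m ∧ 0 < a m := by
  by_contra! hzero
  refine hlt.not_ge ?_
  rw [← tsum_mul_left]
  refine hs.tsum_le_tsum (fun m => ?_) ((summable_of_summable_succ_mul ha hs).mul_left 2)
  rcases lt_or_ge m 2 with hm | hm
  · exact mul_le_mul_of_nonneg_right (by exact_mod_cast hm) (ha m)
  · simp [(hzero m hm).antisymm (ha m)]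

variable (hX₂ : 0 ≤ X₂) (hlt : 2 * ∑' m, a m < ∑' m : ℕ, ((m : ℝ) + 1) * a m + (X₁ - X₂))
include hX₂ hlt

theorem exists_beta (hpos : 0 < X₂ ∨ 0 < a 0) :
    ∃ x ∈ Ioo (0 : ℝ) 1, X₂ + x * betaSeries a x - x ^ 2 * X₁ = 0 := by
  have hcont := continuousOn_betaSeries ha hs
  have hone := betaSeries_one ha hs
  rcases hX₂.eq_or_lt with rfl | hX₂
  · have ha0 : 0 < a 0 := hpos.resolve_left (lt_irrefl 0)
    have hF : ContinuousOn (fun x => betaSeries a x - x * X₁) (Icc 0 1) := by fun_prop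
    obtain ⟨x, hx, hx0⟩ := intermediate_value_Ioo' zero_le_one hF
      (show (0 : ℝ) ∈ Ioo _ _ by simp only [betaSeries_zero, hone]; constructor <;> linarith)
    exact ⟨x, hx, by linear_combination x * hx0⟩
  · have hF : ContinuousOn (fun x => X₂ + x * betaSeries a x - x ^ 2 * X₁) (Icc 0 1) := by
      fun_prop
    obtain ⟨x, hx, hx0⟩ := intermediate_value_Ioo' zero_le_one hF
      (show (0 : ℝ) ∈ Ioo _ _ by simp only [hone]; constructor <;> linarith)
    exact ⟨x, hx, hx0⟩

theorem beta_quotient_strictAntiOn (hX₁ : 0 ≤ X₁) :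
    StrictAntiOn (fun x => X₂ / x + betaSeries a x - x * X₁) (Ioo 0 1) := by
  intro x hx y hy hxy
  have hdiv : X₂ / y ≤ X₂ / x := div_le_div_of_nonneg_left hX₂ hx.1 hxy.le
  have hseries := betaSeries_antitoneOn ha hs (Ioo_subset_Icc_self hx) (Ioo_subset_Icc_self hy)
    hxy.le
  have hmul : x * X₁ ≤ y * X₁ := mul_le_mul_of_nonneg_right hxy.le hX₁
  rcases hX₁.eq_or_lt with rfl | hX₁
  · obtain ⟨m, hm, ham⟩ := exists_pos_of_two_mul_tsum_lt ha hs (by linarith)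
    have := betaSeries_strictAntiOn ha hs hm ham (Ioo_subset_Icc_self hx)
      (Ioo_subset_Icc_self hy) hxy
    simp only
    linarith
  · have := mul_lt_mul_of_pos_right hxy hX₁
    simp only
    linarith

theorem beta_unique (hX₁ : 0 ≤ X₁) {x y : ℝ} (hx : x ∈ Ioo (0 : ℝ) 1) (hy : y ∈ Ioo (0 : ℝ) 1)
    (ex : X₂ + x * betaSeries a x - x ^ 2 * X₁ = 0)
    (ey : X₂ + y * betaSeries a y - y ^ 2 * X₁ = 0) : x = y := by
  refine (beta_quotient_strictAntiOn ha hs hX₂ hlt hX₁).injOn hx hy ?_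
  have hx0 := hx.1.ne'
  have hy0 := hy.1.ne'
  field_simp
  linear_combination y * ex - x * ey

end BetaEquation

theorem existsUnique_isBeta {x₁ x₂ : ℕ → ℝ} (hx₁ : 0 ≤ x₁ 0) (hx₂ : 0 ≤ x₂ 0)
    (hle : ∀ k : ℕ, 1 ≤ k → x₂ k ≤ x₁ k)
    (hs : Summable fun k : ℕ => ((k : ℝ) + 1) * (x₁ (k + 1) - x₂ (k + 1)))
    (hlt : 2 * ∑' k : ℕ, (x₁ (k + 1) - x₂ (k + 1)) <
      (∑' k : ℕ, ((k : ℝ) + 1) * (x₁ (k + 1) - x₂ (k + 1))) + (x₁ 0 - x₂ 0)) :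
    ∃! β : ℝ, IsBeta x₁ x₂ β := by
  have hz : ∀ m : ℕ, 0 ≤ x₁ (m + 1) - x₂ (m + 1) := fun m => sub_nonneg.2 (hle _ (by lia))
  by_cases hpos : 0 < x₂ 0 ∨ 0 < x₁ 1 - x₂ 1
  · have isBeta_iff : ∀ y, IsBeta x₁ x₂ y ↔ y ∈ Ioo (0 : ℝ) 1 ∧
        x₂ 0 + y * betaSeries (fun m => x₁ (m + 1) - x₂ (m + 1)) y - y ^ 2 * x₁ 0 = 0 := by
      refine fun y => ⟨?_, fun ⟨hy, h⟩ =>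
        Or.inr ⟨hpos, hy, (beta_equation_iff hz hs (Ioo_subset_Ico_self hy)).2 h⟩⟩
      rintro (⟨h0, h1, -⟩ | ⟨-, hy, h⟩)
      · rcases hpos with h | h <;> linarith
      · exact ⟨hy, (beta_equation_iff hz hs (Ioo_subset_Ico_self hy)).1 h⟩
    obtain ⟨β, hβ, e⟩ := exists_beta hz hs hx₂ hlt hpos
    refine ⟨β, (isBeta_iff β).2 ⟨hβ, e⟩, fun y hy => ?_⟩
    obtain ⟨hy, hy'⟩ := (isBeta_iff y).1 hy
    exact beta_unique hz hs hx₂ hlt hx₁ hy hβ hy' e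
  · push Not at hpos
    refine ⟨0, Or.inl ⟨hpos.1.antisymm hx₂, hpos.2.antisymm (hz 0), rfl⟩, ?_⟩
    rintro y (⟨-, -, h⟩ | ⟨h, -, -⟩)
    · exact h
    · rcases h with h | h <;> linarith

theorem IsBeta.mem_Ico {x₁ x₂ : ℕ → ℝ} {β : ℝ} (h : IsBeta x₁ x₂ β) : β ∈ Ico (0 : ℝ) 1 := by
  rcases h with ⟨-, -, rfl⟩ | ⟨-, hβ, -⟩
  · simp
  · exact Ioo_subset_Ico_self hβ

theorem IsBeta.equation {x₁ x₂ : ℕ → ℝ} {β : ℝ} (h : IsBeta x₁ x₂ β) :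
    ∑' k : ℕ, ((k : ℝ) + 1) * (x₁ (k + 1) - x₂ (k + 1)) =
      (1 - β ^ 2) *
          ∑' k : ℕ, ((k : ℝ) + 1) * (x₁ (k + 1) - x₂ (k + 1)) / (1 - β ^ (k + 1))
        + x₂ 0 - β ^ 2 * x₁ 0 := by
  rcases h with ⟨h0, -, rfl⟩ | ⟨-, -, heq⟩
  · simp [h0]
  · exact heq

/-! ### Relative entropy -/

theorem ell_eq_klFun : ell = InformationTheory.klFun := by
  ext u
  rw [ell, InformationTheory.klFun_apply]
  ring

theorem ell_nonneg {u : ℝ} (hu : 0 ≤ u) : 0 ≤ ell u := by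
  rw [ell_eq_klFun]
  exact InformationTheory.klFun_nonneg hu

theorem continuous_ell : Continuous ell := by
  rw [ell_eq_klFun]
  exact InformationTheory.continuous_klFun

theorem hasDerivAt_ell {u : ℝ} (hu : u ≠ 0) : HasDerivAt ell (Real.log u) u := by
  rw [ell_eq_klFun]
  exact InformationTheory.hasDerivAt_klFun hu

theorem ell_tangent {u θ : ℝ} (hu : 0 ≤ u) (hθ : 0 < θ) :
    u * Real.log θ - θ + 1 ≤ ell u := by
  have hnonneg : 0 ≤ θ * ell (u / θ) := mul_nonneg hθ.le (ell_nonneg (by positivity))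
  rcases eq_or_ne u 0 with rfl | hu0
  · simp [ell, hθ.le]
  · rw [ell, Real.log_div hu0 hθ.ne', mul_add, mul_sub, ← mul_assoc,
      mul_div_cancel₀ _ hθ.ne'] at hnonneg
    rw [ell]
    linarith

theorem abs_ell_sub_le {u v : ℝ} (hv : 0 ≤ v) (hvu : v ≤ u) (huv : u ≤ v + 1) :
    |ell u - ell v| ≤ 1 + u := by
  have hu : 0 ≤ u := hv.trans hvu
  refine abs_sub_le_iff.2 ⟨?_, ?_⟩
  · rcases hu.eq_or_lt with rfl | hu'
    · simp [hvu.antisymm hv]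
    have htangent : ell u - ell v ≤ (u - v) * Real.log u := by
      have := ell_tangent hv hu'
      unfold ell at *
      linarith
    have hlog : (u - v) * Real.log u ≤ u := by
      rcases le_total (Real.log u) 0 with hneg | hpos
      · exact (mul_nonpos_of_nonneg_of_nonpos (sub_nonneg.2 hvu) hneg).trans hu
      · exact (mul_le_of_le_one_left hpos (by linarith)).trans (Real.log_le_self hu)
    linarith
  · rcases le_or_gt v 1 with hv1 | hv1
    · have hle_one : ell v ≤ 1 := by
        have := mul_nonpos_of_nonneg_of_nonpos hv (Real.log_nonpos hv hv1)
        unfold ell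
        linarith
      linarith [ell_nonneg hu]
    · have htangent : ell v - ell u ≤ (v - u) * Real.log v := by
        have := ell_tangent hu (zero_lt_one.trans hv1)
        unfold ell at *
        linarith
      have := mul_nonneg (sub_nonneg.2 hvu) (Real.log_nonneg hv1.le)
      linarith

/-- The perspective `b * ell (a / b)` of `ell`, equal to `a * log (a / b) - a + b` for `b ≠ 0`.
Division by zero makes it vanish for `b = 0`. -/
def ellPersp (b a : ℝ) : ℝ := b * ell (a / b)

theorem ellPersp_zero_left (a : ℝ) : ellPersp 0 a = 0 := zero_mul _

theorem ellPersp_zero_right (b : ℝ) : ellPersp b 0 = b := by simp [ellPersp, ell]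

theorem ellPersp_eq {b : ℝ} (hb : b ≠ 0) (a : ℝ) :
    ellPersp b a = a * Real.log (a / b) - a + b := by
  unfold ellPersp ell
  field_simp

theorem ellPersp_eq_ell_sub {b : ℝ} (hb : b ≠ 0) (a : ℝ) :
    ellPersp b a = ell a - a * Real.log b + b - 1 := by
  rw [ellPersp_eq hb, ell]
  rcases eq_or_ne a 0 with rfl | ha
  · simp
  · rw [Real.log_div ha hb]
    ring

theorem ellPersp_nonneg {a b : ℝ} (ha : 0 ≤ a) (hb : 0 ≤ b) : 0 ≤ ellPersp b a :=
  mul_nonneg hb (ell_nonneg (div_nonneg ha hb))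

theorem continuous_ellPersp (b : ℝ) : Continuous (ellPersp b) :=
  continuous_const.mul (continuous_ell.comp (continuous_id.div_const b))

theorem abs_ellPersp_sub_le {b u v : ℝ} (hb : 0 ≤ b) (hv : 0 ≤ v) (hvu : v ≤ u)
    (huv : u - v ≤ b) : |ellPersp b u - ellPersp b v| ≤ b + u := by
  rcases hb.eq_or_lt with rfl | hb
  · simpa [ellPersp_zero_left] using hv.trans hvu
  · have hquot : u / b ≤ v / b + 1 := by
      rw [div_add_one hb.ne']
      gcongr
      linarith
    calc |ellPersp b u - ellPersp b v| = b * |ell (u / b) - ell (v / b)| := by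
          rw [ellPersp, ellPersp, ← mul_sub, abs_mul, abs_of_pos hb]
      _ ≤ b * (1 + u / b) := by
          gcongr
          exact abs_ell_sub_le (div_nonneg hv hb.le) (by gcongr) hquot
      _ = b + u := by field_simp

/-- `a * log (a / b) - a + b` as an extended nonnegative number, with the conventions
`0 * log (0 / 0) = 0` and `a * log (a / 0) = ∞` for `a > 0`. For probability vectors it has the
same sum as `logTerm`, but all its terms are nonnegative. -/
def klTerm (a b : ℝ) : ℝ≥0∞ :=
  if b = 0 then (if a = 0 then 0 else ⊤) else ENNReal.ofReal (ellPersp b a)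

theorem klTerm_eq_ofReal {a b : ℝ} (h : b = 0 → a = 0) :
    klTerm a b = ENNReal.ofReal (ellPersp b a) := by
  unfold klTerm
  split_ifs with hb ha
  · simp [hb, ellPersp_zero_left]
  · exact absurd (h hb) ha
  · rfl

theorem klTerm_zero_left (b : ℝ) : klTerm 0 b = ENNReal.ofReal b := by
  rw [klTerm_eq_ofReal fun _ => rfl, ellPersp_zero_right]

theorem klTerm_mul_left (b θ : ℝ) :
    klTerm (θ * b) b = ENNReal.ofReal (θ * b * Real.log θ - θ * b + b) := by
  rw [klTerm_eq_ofReal (by simp +contextual)]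
  rcases eq_or_ne b 0 with rfl | hb
  · simp [ellPersp_zero_left]
  · rw [ellPersp_eq hb, mul_div_cancel_right₀ _ hb]

theorem ofReal_tangent_le_klTerm {a b θ : ℝ} (ha : 0 ≤ a) (hb : 0 ≤ b) (hθ : 0 < θ) :
    ENNReal.ofReal (a * Real.log θ - θ * b + b) ≤ klTerm a b := by
  by_cases h : b = 0 → a = 0
  · rw [klTerm_eq_ofReal h]
    refine ENNReal.ofReal_le_ofReal ?_
    rcases eq_or_ne b 0 with rfl | hb0
    · simp [h rfl, ellPersp_zero_left]
    · have := mul_le_mul_of_nonneg_left (ell_tangent (div_nonneg ha hb) hθ) hb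
      rw [ellPersp]
      refine le_trans (le_of_eq ?_) this
      field_simp
  · push Not at h
    simp [klTerm, h.1, h.2]

theorem measurable_klTerm : Measurable fun q : ℝ × ℝ => klTerm q.1 q.2 := by
  have := continuous_ell.measurable
  unfold klTerm ellPersp
  refine Measurable.ite (measurableSet_eq_fun measurable_snd measurable_const) ?_ (by fun_prop)
  exact Measurable.ite (measurableSet_eq_fun measurable_fst measurable_const)
    measurable_const measurable_const

theorem logTerm_eq_coe {a b : ℝ} (h : b = 0 → a = 0) :
    logTerm a b = ((a * Real.log (a / b) : ℝ) : EReal) := by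
  unfold logTerm
  split_ifs with ha hb
  · simp [ha]
  · exact absurd (h hb) ha
  · rfl

theorem logTerm_eq_ellPersp {a b : ℝ} (h : b = 0 → a = 0) :
    logTerm a b = ((ellPersp b a + a - b : ℝ) : EReal) := by
  rw [logTerm_eq_coe h]
  rcases eq_or_ne b 0 with rfl | hb
  · simp [h rfl, ellPersp_zero_left]
  · rw [ellPersp_eq hb]
    congr 1
    ring

theorem neg_logTerm_toENNReal_le {a b : ℝ} (ha : 0 ≤ a) (hb : 0 ≤ b) :
    (-logTerm a b).toENNReal ≤ ENNReal.ofReal b := by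
  by_cases h : b = 0 → a = 0
  · rw [logTerm_eq_ellPersp h, ← EReal.coe_neg, EReal.toENNReal_of_ne_top (EReal.coe_ne_top _),
      EReal.toReal_coe]
    exact ENNReal.ofReal_le_ofReal (by linarith [ellPersp_nonneg ha hb])
  · push Not at h
    simp [logTerm, h.1, h.2]

theorem klTerm_add {a b : ℝ} (ha : 0 ≤ a) (hb : 0 ≤ b) :
    klTerm a b + (-logTerm a b).toENNReal + ENNReal.ofReal a =
      (logTerm a b).toENNReal + ENNReal.ofReal b := by
  by_cases h : b = 0 → a = 0
  · have hpersp := ellPersp_nonneg ha hb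
    rw [klTerm_eq_ofReal h, logTerm_eq_ellPersp h, ← EReal.coe_neg,
      EReal.toENNReal_of_ne_top (EReal.coe_ne_top _),
      EReal.toENNReal_of_ne_top (EReal.coe_ne_top _), EReal.toReal_coe, EReal.toReal_coe]
    rcases le_total 0 (ellPersp b a + a - b) with hsign | hsign
    · rw [ENNReal.ofReal_of_nonpos (neg_nonpos.2 hsign), add_zero, ← ENNReal.ofReal_add hpersp ha,
        ← ENNReal.ofReal_add hsign hb, sub_add_cancel]
    · rw [ENNReal.ofReal_of_nonpos hsign, zero_add,
        ← ENNReal.ofReal_add hpersp (neg_nonneg.2 hsign),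
        ← ENNReal.ofReal_add (add_nonneg hpersp (neg_nonneg.2 hsign)) ha]
      congr 1
      ring
  · push Not at h
    simp [logTerm, klTerm, h.1, h.2]

theorem esum_logTerm {ν μ : ℕ → ℝ} (hν : ∀ k, 0 ≤ ν k) (hμ : ∀ k, 0 ≤ μ k) (hν1 : HasSum ν 1)
    (hμ1 : HasSum μ 1) :
    esum (fun k => logTerm (ν k) (μ k)) = ((∑' k, klTerm (ν k) (μ k) : ℝ≥0∞) : EReal) := by
  have hν_mass : ∑' k, ENNReal.ofReal (ν k) = 1 := by
    rw [← ENNReal.ofReal_tsum_of_nonneg hν hν1.summable, hν1.tsum_eq, ENNReal.ofReal_one]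
  have hμ_mass : ∑' k, ENNReal.ofReal (μ k) = 1 := by
    rw [← ENNReal.ofReal_tsum_of_nonneg hμ hμ1.summable, hμ1.tsum_eq, ENNReal.ofReal_one]
  have hsplit : ∑' k, klTerm (ν k) (μ k) + ∑' k, (-logTerm (ν k) (μ k)).toENNReal =
      ∑' k, (logTerm (ν k) (μ k)).toENNReal := by
    refine (ENNReal.add_left_inj ENNReal.one_ne_top).1 ?_
    nth_rewrite 1 [← hν_mass]
    rw [← hμ_mass, ← ENNReal.tsum_add, ← ENNReal.tsum_add, ← ENNReal.tsum_add]
    exact tsum_congr fun k => klTerm_add (hν k) (hμ k)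
  have hfin : ∑' k, (-logTerm (ν k) (μ k)).toENNReal ≠ ⊤ := by
    refine ne_top_of_le_ne_top ENNReal.one_ne_top ?_
    rw [← hμ_mass]
    exact ENNReal.tsum_le_tsum fun k => neg_logTerm_toENNReal_le (hν k) (hμ k)
  unfold esum
  lift ∑' k, (-logTerm (ν k) (μ k)).toENNReal to ℝ≥0 using hfin with n
  rw [← hsplit, EReal.coe_ennreal_add]
  exact EReal.add_sub_cancel_right (b := (n : ℝ))

/-! ### The local cost -/

theorem r_zero : r 0 = 0 := by simp [r]

theorem rk_eq {x : ℕ → ℝ} (h0 : 0 ≤ x 0) (hs : Summable fun j : ℕ => (j : ℝ) * x j)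
    (hr : 0 < r x) (k : ℕ) : rk x k = (if k = 0 then x 0 else (k : ℝ) * x k) / r x := by
  simp [rk, hs, hr, h0]

theorem rk_nonneg {x : ℕ → ℝ} (hx : ∀ k, 1 ≤ k → 0 ≤ x k) (k : ℕ) : 0 ≤ rk x k := by
  unfold rk
  split_ifs with hr hk
  · exact div_nonneg (le_max_right _ _) hr.2.le
  · exact div_nonneg (mul_nonneg (Nat.cast_nonneg k) (hx k (by lia))) hr.2.le
  · exact le_rfl

theorem hasSum_rk {x : ℕ → ℝ} (hs : Summable fun j : ℕ => (j : ℝ) * x j)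
    (hr : 0 < r x) : HasSum (rk x) 1 := by
  have hsum : HasSum (fun k : ℕ => if k = 0 then max (x 0) 0 else (k : ℝ) * x k) (r x) :=
    ((hasSum_ite_eq (0 : ℕ) (max (x 0) 0)).add hs.hasSum).congr_fun fun k => by
      by_cases hk : k = 0 <;> simp [hk]
  have hnormalized := hsum.div_const (r x)
  rw [div_self hr.ne'] at hnormalized
  exact hnormalized.congr_fun fun k => by simp [rk, hs, hr]

/-- The condition `∑_{k ≥ 1} b_k ≥ -1` under which `L x b` is an entropy, expressed through partial
sums so that it is visibly measurable in `b` and needs no summability clause when the `b_k` are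
nonpositive. -/
def SubVelocity (b : ℕ → ℝ) : Prop := ∀ n, ∑ j ∈ Finset.range n, -b (j + 1) ≤ 1

section SubVelocity

variable {b : ℕ → ℝ} (hb : ∀ k : ℕ, 1 ≤ k → b k ≤ 0)
include hb

theorem SubVelocity.summable (h : SubVelocity b) : Summable fun k : ℕ => b (k + 1) := by
  simpa using (summable_of_sum_range_le (fun k => neg_nonneg.2 (hb _ (by lia))) h).neg

theorem SubVelocity.neg_one_le (h : SubVelocity b) : -1 ≤ ∑' k : ℕ, b (k + 1) := by
  have : ∑' k : ℕ, -b (k + 1) ≤ 1 := (h.summable hb).neg.tsum_le_of_sum_range_le h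
  rw [tsum_neg] at this
  linarith

theorem subVelocity_of_neg_one_le (hs : Summable fun k : ℕ => b (k + 1))
    (h : -1 ≤ ∑' k : ℕ, b (k + 1)) : SubVelocity b := fun n => by
  refine (hs.neg.sum_le_tsum _ fun k _ => neg_nonneg.2 (hb _ (by lia))).trans ?_
  rw [tsum_neg]
  linarith

theorem nu_nonneg (h : SubVelocity b) (k : ℕ) : 0 ≤ nu b k := by
  unfold nu
  split_ifs with hk
  · linarith [h.neg_one_le hb]
  · exact neg_nonneg.2 (hb k (by lia))

end SubVelocity

theorem hasSum_nu {b : ℕ → ℝ} (hs : Summable fun k : ℕ => b (k + 1)) : HasSum (nu b) 1 := by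
  rw [← hasSum_nat_add_iff' 1]
  simpa [nu] using hs.hasSum.neg

theorem L_eq_tsum {x b : ℕ → ℝ} (hx : ∀ k, 1 ≤ k → 0 ≤ x k)
    (hs : Summable fun j : ℕ => (j : ℝ) * x j) (hr : 0 < r x)
    (hb : ∀ k : ℕ, 1 ≤ k → b k ≤ 0) (h : SubVelocity b) :
    L x b = ((∑' k, klTerm (nu b k) (rk x k) : ℝ≥0∞) : EReal) := by
  have hx0 : x ≠ 0 := by
    rintro rfl
    exact hr.ne' r_zero
  have hmu : mu x = rk x := funext fun k => if_neg hx0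
  rw [L, if_pos ⟨hb, h.summable hb, h.neg_one_le hb⟩, hmu]
  exact esum_logTerm (nu_nonneg hb h) (rk_nonneg hx) (hasSum_nu (h.summable hb))
    (hasSum_rk hs hr)

theorem L_eq_top {x b : ℕ → ℝ} (h : ¬ SubVelocity b) : L x b = ⊤ :=
  if_neg fun hL => h (subVelocity_of_neg_one_le hL.1 hL.2.1 hL.2.2)

/-! ### Absolutely continuous functions -/

section AbsolutelyContinuous

open Filter Topology AbsolutelyContinuousOnInterval

theorem absCont_congr {X : Type*} [PseudoMetricSpace X] {f g : ℝ → X} {a b : ℝ}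
    (hf : AbsolutelyContinuousOnInterval f a b) (h : EqOn f g (uIcc a b)) :
    AbsolutelyContinuousOnInterval g a b := by
  refine Tendsto.congr' ?_ hf
  filter_upwards [mem_inf_of_right (mem_principal_self _)] with E hE
  refine Finset.sum_congr rfl fun i hi => ?_
  rw [h (hE.1 i hi).1, h (hE.1 i hi).2]

theorem absCont_comp_lipschitzOn {X Y : Type*} [PseudoMetricSpace X] [PseudoMetricSpace Y]
    {f : ℝ → X} {F : X → Y} {a b : ℝ} {s : Set X} {K : ℝ≥0}
    (hF : LipschitzOnWith K F s) (hf : AbsolutelyContinuousOnInterval f a b)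
    (hs : MapsTo f (uIcc a b) s) : AbsolutelyContinuousOnInterval (F ∘ f) a b := by
  have hlim : Tendsto (fun E : ℕ × (ℕ → ℝ × ℝ) =>
      (K : ℝ) * ∑ i ∈ Finset.range E.1, dist (f (E.2 i).1) (f (E.2 i).2))
      (totalLengthFilter ⊓ 𝓟 (disjWithin a b)) (𝓝 0) := by
    simpa using Tendsto.const_mul (K : ℝ) hf
  refine squeeze_zero' (.of_forall fun E => Finset.sum_nonneg fun _ _ => dist_nonneg) ?_ hlim
  filter_upwards [mem_inf_of_right (mem_principal_self _)] with E hE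
  rw [Finset.mul_sum]
  exact Finset.sum_le_sum fun i hi => hF.dist_le_mul _ (hs (hE.1 i hi).1) _ (hs (hE.1 i hi).2)

theorem absCont_const {X : Type*} [PseudoMetricSpace X] (x : X) (a b : ℝ) :
    AbsolutelyContinuousOnInterval (fun _ => x) a b :=
  (LipschitzWith.const x).lipschitzOnWith.absolutelyContinuousOnInterval

theorem absCont_of_eq_integral {f g : ℝ → ℝ} {a b C : ℝ} (hab : a ≤ b)
    (hg : IntervalIntegrable g volume a b) (h : ∀ t ∈ Icc a b, f t = C + ∫ s in a..t, g s) :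
    AbsolutelyContinuousOnInterval f a b := by
  refine absCont_congr ((absCont_const C a b).add
    (hg.absolutelyContinuousOnInterval_intervalIntegral (c := a) left_mem_uIcc)) fun t ht => ?_
  rw [uIcc_of_le hab] at ht
  exact (h t ht).symm

theorem absCont_mono_right {X : Type*} [PseudoMetricSpace X] {f : ℝ → X} {a b t : ℝ}
    (hf : AbsolutelyContinuousOnInterval f a b) (ht : t ∈ Icc a b) :
    AbsolutelyContinuousOnInterval f a t :=
  hf.mono (uIcc_subset_uIcc_left (Icc_subset_uIcc ht))

theorem absCont_eq_add_integral {f : ℝ → ℝ} {a b t : ℝ}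
    (hf : AbsolutelyContinuousOnInterval f a b) (ht : t ∈ Icc a b) :
    f t = f a + ∫ s in a..t, deriv f s := by
  rw [(absCont_mono_right hf ht).integral_deriv_eq_sub]
  ring

theorem absCont_trans {f : ℝ → ℝ} {a b c : ℝ} (hab : a ≤ b) (hbc : b ≤ c)
    (hf₁ : AbsolutelyContinuousOnInterval f a b) (hf₂ : AbsolutelyContinuousOnInterval f b c) :
    AbsolutelyContinuousOnInterval f a c := by
  have hint₁ := hf₁.intervalIntegrable_deriv
  have hint₂ := hf₂.intervalIntegrable_deriv
  refine absCont_of_eq_integral (C := f a) (hab.trans hbc) (hint₁.trans hint₂) fun t ht => ?_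
  rcases le_total t b with htb | hbt
  · exact absCont_eq_add_integral hf₁ ⟨ht.1, htb⟩
  · have hint : IntervalIntegrable (deriv f) volume b t :=
      (absCont_mono_right hf₂ ⟨hbt, ht.2⟩).intervalIntegrable_deriv
    rw [← intervalIntegral.integral_add_adjacent_intervals hint₁ hint, ← add_assoc,
      ← absCont_eq_add_integral hf₁ (right_mem_Icc.2 hab)]
    exact absCont_eq_add_integral hf₂ ⟨hbt, ht.2⟩

theorem ae_hasDerivAt_of_eq_integral {f g : ℝ → ℝ} {a b C : ℝ}
    (hg : IntervalIntegrable g volume a b) (h : ∀ t ∈ Icc a b, f t = C + ∫ s in a..t, g s) :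
    ∀ᵐ t, t ∈ Ioo a b → HasDerivAt f (g t) t := by
  filter_upwards [hg.ae_hasDerivAt_integral] with t hderiv ht
  refine ((hderiv (Icc_subset_uIcc (Ioo_subset_Icc_self ht)) a left_mem_uIcc).const_add
    C).congr_of_eventuallyEq ?_
  filter_upwards [Ioo_mem_nhds ht.1 ht.2] with s hs
  exact h s (Ioo_subset_Icc_self hs)

theorem deriv_nonneg_of_monotoneOn {f : ℝ → ℝ} {s : Set ℝ} {t : ℝ} (hf : MonotoneOn f s)
    (hs : s ∈ 𝓝 t) : 0 ≤ deriv f t := by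
  rw [← derivWithin_of_mem_nhds hs]
  exact hf.derivWithin_nonneg

theorem deriv_nonpos_of_antitoneOn {f : ℝ → ℝ} {s : Set ℝ} {t : ℝ} (hf : AntitoneOn f s)
    (hs : s ∈ 𝓝 t) : deriv f t ≤ 0 := by
  rw [← derivWithin_of_mem_nhds hs]
  exact hf.derivWithin_nonpos

theorem lintegral_deriv_of_monotoneOn {f : ℝ → ℝ} {a b : ℝ} (hab : a ≤ b)
    (hf : AbsolutelyContinuousOnInterval f a b) (hmono : MonotoneOn f (Icc a b)) :
    ∫⁻ s in Ioc a b, ENNReal.ofReal (deriv f s) = ENNReal.ofReal (f b - f a) := by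
  rw [← hf.integral_deriv_eq_sub, intervalIntegral.integral_of_le hab,
    ofReal_integral_eq_lintegral_ofReal ((intervalIntegrable_iff_integrableOn_Ioc_of_le hab).1
      hf.intervalIntegrable_deriv)]
  rw [← Measure.restrict_congr_set Ioo_ae_eq_Ioc]
  filter_upwards [ae_restrict_mem measurableSet_Ioo] with s hs
  exact deriv_nonneg_of_monotoneOn hmono (Icc_mem_nhds hs.1 hs.2)

theorem absCont_of_lintegral_eq {G : ℝ → ℝ} {g : ℝ → ℝ≥0∞} {a b : ℝ} (hab : a ≤ b)
    (hg : Measurable g) (hG : MonotoneOn G (Icc a b))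
    (h : ∀ t ∈ Icc a b, ∫⁻ s in Ioc a t, g s = ENNReal.ofReal (G t - G a)) :
    AbsolutelyContinuousOnInterval G a b := by
  have hfin : ∀ t ∈ Icc a b, ∫⁻ s in Ioc a t, g s ≠ ⊤ := fun t ht => by
    rw [h t ht]
    exact ENNReal.ofReal_ne_top
  refine absCont_of_eq_integral (g := fun s => (g s).toReal) (C := G a) hab ?_ fun t ht => ?_
  · rw [intervalIntegrable_iff_integrableOn_Ioc_of_le hab]
    exact integrable_toReal_of_lintegral_ne_top hg.aemeasurable (hfin b (right_mem_Icc.2 hab))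
  · rw [intervalIntegral.integral_of_le ht.1,
      integral_toReal hg.aemeasurable (ae_lt_top hg (hfin t ht)), h t ht,
      ENNReal.toReal_ofReal (sub_nonneg.2 (hG (left_mem_Icc.2 hab) ht ht.1)), add_sub_cancel]

theorem absCont_of_hasSum_monotoneOn {g : ℕ → ℝ → ℝ} {G : ℝ → ℝ} {a b : ℝ} (hab : a ≤ b)
    (hg : ∀ j, AbsolutelyContinuousOnInterval (g j) a b) (hmono : ∀ j, MonotoneOn (g j) (Icc a b))
    (hG : ∀ t ∈ Icc a b, HasSum (fun j => g j t) (G t)) :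
    AbsolutelyContinuousOnInterval G a b := by
  have hmeas : ∀ j, Measurable fun s => ENNReal.ofReal (deriv (g j) s) := fun j =>
    (measurable_deriv (g j)).ennreal_ofReal
  have ha := left_mem_Icc.2 hab
  have hG_mono : MonotoneOn G (Icc a b) := fun s hs t ht hst =>
    hasSum_le (fun j => hmono j hs ht hst) (hG s hs) (hG t ht)
  refine absCont_of_lintegral_eq hab (.tsum (L := .unconditional ℕ) hmeas) hG_mono fun t ht => ?_
  have hincr := (hG t ht).sub (hG a ha)
  rw [lintegral_tsum fun j => (hmeas j).aemeasurable, ← hincr.tsum_eq,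
    ENNReal.ofReal_tsum_of_nonneg (fun j => sub_nonneg.2 (hmono j ha ht ht.1)) hincr.summable]
  exact tsum_congr fun j => lintegral_deriv_of_monotoneOn ht.1 (absCont_mono_right (hg j) ht)
    ((hmono j).mono (Icc_subset_Icc_right ht.2))

end AbsolutelyContinuous

/-! ### The Skorokhod map -/

theorem bddBelow_image_Icc {ψ : ℝ → ℝ} {a b : ℝ} (hψ : ContinuousOn ψ (Icc a b)) :
    BddBelow (ψ '' Icc a b) := (isCompact_Icc.image_of_continuousOn hψ).bddBelow

theorem skorokhod_nonneg {ψ : ℝ → ℝ} {t : ℝ} (ht : 0 ≤ t) (hψ : ContinuousOn ψ (Icc 0 t)) :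
    0 ≤ skorokhod ψ t :=
  sub_nonneg.2 ((min_le_left _ _).trans
    (csInf_le (bddBelow_image_Icc hψ) (mem_image_of_mem ψ (right_mem_Icc.2 ht))))

theorem skorokhod_eq_of_le {ψ : ℝ → ℝ} {t₁ t : ℝ} (ht₁ : 0 ≤ t₁) (ht : t₁ ≤ t)
    (hψ : ContinuousOn ψ (Icc 0 t)) (hge : ∀ s ∈ Icc t₁ t, ψ t₁ - skorokhod ψ t₁ ≤ ψ s) :
    skorokhod ψ t = ψ t - ψ t₁ + skorokhod ψ t₁ := by
  have hbdd := bddBelow_image_Icc hψ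
  have hsub : ψ '' Icc 0 t₁ ⊆ ψ '' Icc 0 t := image_mono (Icc_subset_Icc_right ht)
  have hmin_eq : min (sInf (ψ '' Icc 0 t)) 0 = min (sInf (ψ '' Icc 0 t₁)) 0 := by
    refine le_antisymm
      (min_le_min_right 0 (csInf_le_csInf hbdd ((nonempty_Icc.2 ht₁).image ψ) hsub))
      (le_min (le_csInf ((nonempty_Icc.2 (ht₁.trans ht)).image ψ) ?_) (min_le_right _ _))
    rintro _ ⟨s, hs, rfl⟩
    rcases le_total s t₁ with hst | hst
    · exact (min_le_left _ _).trans
        (csInf_le (hbdd.mono hsub) (mem_image_of_mem ψ ⟨hs.1, hst⟩))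
    · have := hge s ⟨hst, hs.2⟩
      rwa [skorokhod, sub_sub_cancel] at this
  rw [skorokhod, skorokhod, hmin_eq]
  ring

/-! ### Paths between two states -/

theorem summable_mul_of_le {x y : ℕ → ℝ} (hy : Summable fun k : ℕ => (k : ℝ) * y k)
    (hx : ∀ k, 1 ≤ k → 0 ≤ x k) (hxy : ∀ k, 1 ≤ k → x k ≤ y k) :
    Summable fun k : ℕ => (k : ℝ) * x k := by
  refine hy.of_nonneg_of_le (fun k => ?_) fun k => ?_
  all_goals rcases Nat.eq_zero_or_pos k with rfl | hk
  · simp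
  · exact mul_nonneg k.cast_nonneg (hx k hk)
  · simp
  · exact mul_le_mul_of_nonneg_left (hxy k hk) k.cast_nonneg

namespace Admissible

variable {p : ℕ → ℝ} {T t : ℝ} {ζ : ℝ → ℕ → ℝ} {ψ : ℝ → ℝ}

theorem le_init (h : Admissible p T ζ ψ) {k : ℕ} (hk : 1 ≤ k) (ht : t ∈ Icc 0 T) :
    ζ t k ≤ p k := by
  rw [← h.ζ_init k hk]
  exact h.ζ_anti k hk ⟨le_rfl, ht.1.trans ht.2⟩ ht ht.1

theorem summable (h : Admissible p T ζ ψ) (hp : Summable fun k : ℕ => (k : ℝ) * p k)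
    (ht : t ∈ Icc 0 T) : Summable fun k : ℕ => (k : ℝ) * ζ t k :=
  summable_mul_of_le hp (fun k hk => h.ζ_nonneg k hk t ht) fun _ hk => h.le_init hk ht

theorem zero_nonneg (h : Admissible p T ζ ψ) (ht : t ∈ Icc 0 T) : 0 ≤ ζ t 0 := by
  rw [h.ζ_refl t ht]
  exact skorokhod_nonneg ht.1 (h.cont_ψ.mono (Icc_subset_Icc_right ht.2))

theorem r_eq (h : Admissible p T ζ ψ) (ht : t ∈ Icc 0 T) :
    r (ζ t) = ζ t 0 + ∑' k : ℕ, (k : ℝ) * ζ t k := by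
  rw [r, max_eq_left (h.zero_nonneg ht)]

theorem absCont_tsum (h : Admissible p T ζ ψ) (hT : 0 ≤ T)
    (hp : Summable fun k : ℕ => (k : ℝ) * p k) :
    AbsolutelyContinuousOnInterval (fun t => ∑' k : ℕ, (k : ℝ) * ζ t k) 0 T := by
  have hneg : AbsolutelyContinuousOnInterval (fun t => -∑' k : ℕ, (k : ℝ) * ζ t k) 0 T := by
    refine absCont_of_hasSum_monotoneOn (g := fun (k : ℕ) t => -((k : ℝ) * ζ t k)) hT
      (fun k => ?_) (fun k => ?_) fun t ht => (h.summable hp ht).hasSum.neg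
    all_goals rcases Nat.eq_zero_or_pos k with rfl | hk
    · simpa using absCont_const 0 0 T
    · exact ((h.ζ_ac k hk).const_mul k).neg
    · simpa using monotoneOn_const
    · exact fun s hs t ht hst =>
        neg_le_neg (mul_le_mul_of_nonneg_left (h.ζ_anti k hk hs ht hst) k.cast_nonneg)
  refine absCont_congr hneg.neg fun t _ => ?_
  rw [Pi.neg_apply, neg_neg]

end Admissible

section Bridge

variable {p x₁ x₂ : ℕ → ℝ} {t₁ t₂ t : ℝ} {w : (ℝ → ℕ → ℝ) × (ℝ → ℝ)}

theorem zero_eq_of_mem_J1 (ht₁ : 0 ≤ t₁) (ht₁₂ : t₁ < t₂) (hw : w ∈ J1 p t₁ t₂ x₁ x₂)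
    (ht : t ∈ Icc t₁ t₂) : w.1 t 0 = w.2 t - w.2 t₁ + x₁ 0 := by
  obtain ⟨⟨hadm, hleft, -⟩, hlow⟩ := hw
  have hstart : skorokhod w.2 t₁ = x₁ 0 := by rw [← hadm.ζ_refl t₁ ⟨ht₁, ht₁₂.le⟩, hleft]
  have hlow_closed : ∀ s ∈ Icc t₁ t₂, w.2 t₁ - x₁ 0 ≤ w.2 s := fun s hs => by
    rw [← closure_Ioo ht₁₂.ne] at hs
    refine le_on_closure hlow continuousOn_const ?_ hs
    rw [closure_Ioo ht₁₂.ne]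
    exact hadm.cont_ψ.mono (Icc_subset_Icc_left ht₁)
  rw [hadm.ζ_refl t ⟨ht₁.trans ht.1, ht.2⟩, ← hstart]
  refine skorokhod_eq_of_le ht₁ ht.1 (hadm.cont_ψ.mono (Icc_subset_Icc_right ht.2)) fun s hs => ?_
  rw [hstart]
  exact hlow_closed s ⟨hs.1, hs.2.trans ht.2⟩

theorem absCont_r_of_mem_J1 (hp : Summable fun k : ℕ => (k : ℝ) * p k) (ht₁ : 0 ≤ t₁)
    (ht₁₂ : t₁ < t₂) (hw : w ∈ J1 p t₁ t₂ x₁ x₂) :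
    AbsolutelyContinuousOnInterval (fun t => r (w.1 t)) t₁ t₂ := by
  have hadm := hw.1.1
  have hsub : uIcc t₁ t₂ ⊆ uIcc 0 t₂ := by
    rw [uIcc_of_le ht₁₂.le, uIcc_of_le (ht₁.trans ht₁₂.le)]
    exact Icc_subset_Icc_left ht₁
  refine absCont_congr (((hadm.ψ_ac.mono hsub).add (absCont_const (x₁ 0 - w.2 t₁) _ _)).add
    ((hadm.absCont_tsum (ht₁.trans ht₁₂.le) hp).mono hsub)) fun t ht => ?_
  rw [uIcc_of_le ht₁₂.le] at ht
  rw [hadm.r_eq ⟨ht₁.trans ht.1, ht.2⟩, zero_eq_of_mem_J1 ht₁ ht₁₂ hw ht]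
  simp only [Pi.add_apply]
  ring

theorem r_eq_of_mem_J2 (hp : Summable fun k : ℕ => (k : ℝ) * p k) (ht₁ : 0 ≤ t₁) (ht₁₂ : t₁ < t₂)
    (hw : w ∈ J2 p t₁ t₂ x₁ x₂) (ht : t ∈ Icc t₁ t₂) : r (w.1 t) = r x₁ - 2 * (t - t₁) := by
  have hlin : AbsolutelyContinuousOnInterval (fun t : ℝ => 2 * t) t₁ t₂ :=
    ContDiffOn.absolutelyContinuousOnInterval (by fun_prop)
  obtain ⟨C, hC⟩ := ((absCont_r_of_mem_J1 hp ht₁ ht₁₂ hw.1).add hlin).const_of_ae_hasDerivAt_zero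
    (by
      have hne : ∀ x : ℝ, ∀ᵐ t : ℝ, t ≠ x := fun x => by simp [ae_iff, measure_singleton]
      filter_upwards [hw.2, hne t₁, hne t₂] with t hderiv ht₁' ht₂' ht
      rw [uIcc_of_le ht₁₂.le] at ht
      simpa using! (hderiv ⟨ht.1.lt_of_ne' ht₁', ht.2.lt_of_ne ht₂'⟩).add
        ((hasDerivAt_id t).const_mul 2))
  rw [uIcc_of_le ht₁₂.le] at hC
  have htC := hC t ht
  have ht₁C := hC t₁ (left_mem_Icc.2 ht₁₂.le)
  simp only [Pi.add_apply] at htC ht₁C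
  rw [hw.1.1.2.1] at ht₁C
  linarith

end Bridge

/-- The paths from `x₁` at time `a` to `x₂` at time `b` over which the local cost is minimized:
like the paths in `J2`, but without reference to the behaviour before time `a` and with the
equation for `r` integrated. -/
structure DescendingPath (x₁ x₂ : ℕ → ℝ) (a b : ℝ) (ζ : ℝ → ℕ → ℝ) : Prop where
  left : ζ a = x₁
  right : ζ b = x₂
  zero_nonneg : ∀ t ∈ Icc a b, 0 ≤ ζ t 0
  anti : ∀ k, 1 ≤ k → AntitoneOn (fun t => ζ t k) (Icc a b)
  ac : ∀ k, 1 ≤ k → AbsolutelyContinuousOnInterval (fun t => ζ t k) a b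
  nonneg : ∀ k, 1 ≤ k → ∀ t ∈ Icc a b, 0 ≤ ζ t k
  r_eq : ∀ t ∈ Icc a b, r (ζ t) = r x₁ - 2 * (t - a)

theorem descendingPath_of_mem_J2 {p x₁ x₂ : ℕ → ℝ} {t₁ t₂ : ℝ} {w : (ℝ → ℕ → ℝ) × (ℝ → ℝ)}
    (hp : Summable fun k : ℕ => (k : ℝ) * p k) (ht₁ : 0 ≤ t₁) (ht₁₂ : t₁ < t₂)
    (hw : w ∈ J2 p t₁ t₂ x₁ x₂) : DescendingPath x₁ x₂ t₁ t₂ w.1 := by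
  have hadm := hw.1.1.1
  have hsub : Icc t₁ t₂ ⊆ Icc 0 t₂ := Icc_subset_Icc_left ht₁
  refine ⟨hw.1.1.2.1, hw.1.1.2.2, fun t ht => hadm.zero_nonneg (hsub ht),
    fun k hk => (hadm.ζ_anti k hk).mono hsub, fun k hk => (hadm.ζ_ac k hk).mono ?_,
    fun k hk t ht => hadm.ζ_nonneg k hk t (hsub ht),
    fun t ht => r_eq_of_mem_J2 hp ht₁ ht₁₂ hw ht⟩
  rwa [uIcc_of_le ht₁₂.le, uIcc_of_le (ht₁.trans ht₁₂.le)]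

namespace DescendingPath

variable {x₁ x₂ : ℕ → ℝ} {a b t : ℝ} {ζ : ℝ → ℕ → ℝ} {k : ℕ}

theorem le_left (h : DescendingPath x₁ x₂ a b ζ) (hk : 1 ≤ k) (ht : t ∈ Icc a b) :
    ζ t k ≤ x₁ k := by
  rw [← h.left]
  exact h.anti k hk ⟨le_rfl, ht.1.trans ht.2⟩ ht ht.1

theorem right_le (h : DescendingPath x₁ x₂ a b ζ) (hk : 1 ≤ k) (ht : t ∈ Icc a b) :
    x₂ k ≤ ζ t k := by
  rw [← h.right]
  exact h.anti k hk ht ⟨ht.1.trans ht.2, le_rfl⟩ ht.2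

theorem summable (h : DescendingPath x₁ x₂ a b ζ) (hx₁ : Summable fun k : ℕ => (k : ℝ) * x₁ k)
    (ht : t ∈ Icc a b) : Summable fun k : ℕ => (k : ℝ) * ζ t k :=
  summable_mul_of_le hx₁ (fun k hk => h.nonneg k hk t ht) fun _ hk => h.le_left hk ht

theorem hasSum_decrease (h : DescendingPath x₁ x₂ a b ζ)
    (hx₁ : Summable fun k : ℕ => (k : ℝ) * x₁ k) (ht : t ∈ Icc a b) :
    HasSum (fun k : ℕ => (k : ℝ) * (x₁ k - ζ t k)) (ζ t 0 - x₁ 0 + 2 * (t - a)) := by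
  have hr := h.r_eq t ht
  have hx₁_zero : 0 ≤ x₁ 0 := h.left ▸ h.zero_nonneg a ⟨le_rfl, ht.1.trans ht.2⟩
  rw [r, r, max_eq_left (h.zero_nonneg t ht), max_eq_left hx₁_zero] at hr
  have hsub := hx₁.hasSum.sub (h.summable hx₁ ht).hasSum
  simp only [← mul_sub] at hsub
  rwa [show ∑' k : ℕ, (k : ℝ) * x₁ k - ∑' k : ℕ, (k : ℝ) * ζ t k = ζ t 0 - x₁ 0 + 2 * (t - a) by
    linarith] at hsub

theorem deriv_nonpos (h : DescendingPath x₁ x₂ a b ζ) (hk : 1 ≤ k) (ht : t ∈ Ioo a b) :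
    deriv (fun u => ζ u k) t ≤ 0 :=
  deriv_nonpos_of_antitoneOn (h.anti k hk) (Icc_mem_nhds ht.1 ht.2)

end DescendingPath

/-! ### The explicit path -/

/-- The endpoints `x₁`, `x₂` of the bridge and the parameter `β` that belongs to them. -/
structure Endpoints (x₁ x₂ : ℕ → ℝ) (β : ℝ) : Prop where
  summable₁ : Summable fun k : ℕ => (k : ℝ) * x₁ k
  zero₁ : 0 ≤ x₁ 0
  zero₂ : 0 ≤ x₂ 0
  nonneg₂ : ∀ k : ℕ, 1 ≤ k → 0 ≤ x₂ k
  le₂₁ : ∀ k : ℕ, 1 ≤ k → x₂ k ≤ x₁ k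
  lt : 2 * ∑' k : ℕ, (x₁ (k + 1) - x₂ (k + 1)) <
    (∑' k : ℕ, ((k : ℝ) + 1) * (x₁ (k + 1) - x₂ (k + 1))) + (x₁ 0 - x₂ 0)
  isBeta : IsBeta x₁ x₂ β

/-- The parameter `z̃_k = z_k / (1 - β^k)`. -/
def zTilde (x₁ x₂ : ℕ → ℝ) (β : ℝ) (k : ℕ) : ℝ := (x₁ k - x₂ k) / (1 - β ^ k)

/-- The parameter `ς̃ = ς / (1 - β²)`. -/
def sigmaTilde (x₁ x₂ : ℕ → ℝ) (β : ℝ) : ℝ := varsig x₁ x₂ / (1 - β ^ 2)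

/-- The factor `w(t) = 1 - (t - t₁) / ς̃`, which decreases from `1` to `β²`. -/
def timeLeft (t₁ : ℝ) (x₁ x₂ : ℕ → ℝ) (β t : ℝ) : ℝ := 1 - (t - t₁) / sigmaTilde x₁ x₂ β

/-- The path `ζ̃` between the times `t₁` and `t₁ + ς`, with the zeroth coordinate in closed form:
`ζ̃₀ = 2 ς̃ w - ∑ k z̃_k w^{k/2}`. -/
def optPath (t₁ : ℝ) (x₁ x₂ : ℕ → ℝ) (β t : ℝ) (k : ℕ) : ℝ :=
  if k = 0 then 2 * sigmaTilde x₁ x₂ β * timeLeft t₁ x₁ x₂ β t -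
    ∑' j : ℕ, (j : ℝ) * zTilde x₁ x₂ β j * timeLeft t₁ x₁ x₂ β t ^ ((j : ℝ) / 2)
  else x₁ k - zTilde x₁ x₂ β k * (1 - timeLeft t₁ x₁ x₂ β t ^ ((k : ℝ) / 2))

/-- The quotient `ζ̃₀ / √w` as a function of `u = √w`. It is concave in `u`, so that it is
nonnegative on `[β, 1]` as soon as it is at both ends. -/
def zeroQuotient (x₁ x₂ : ℕ → ℝ) (β u : ℝ) : ℝ :=
  2 * sigmaTilde x₁ x₂ β * u - ∑' j : ℕ, ((j : ℝ) + 1) * zTilde x₁ x₂ β (j + 1) * u ^ j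

theorem rpow_half_sq {u : ℝ} (hu : 0 ≤ u) (k : ℕ) : (u ^ 2) ^ ((k : ℝ) / 2) = u ^ k := by
  rw [← Real.rpow_natCast_mul hu, Nat.cast_ofNat, mul_div_cancel₀ _ two_ne_zero, Real.rpow_natCast]

theorem convexOn_tsum {E ι : Type*} [AddCommGroup E] [Module ℝ E] {s : Set E} {f : ι → E → ℝ}
    (hs : Convex ℝ s) (hf : ∀ i, ConvexOn ℝ s (f i)) (hsum : ∀ x ∈ s, Summable fun i => f i x) :
    ConvexOn ℝ s fun x => ∑' i, f i x := by
  refine ⟨hs, fun x hx y hy a b ha hb hab => ?_⟩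
  have hx' := (hsum x hx).mul_left a
  have hy' := (hsum y hy).mul_left b
  simp only [smul_eq_mul]
  rw [← tsum_mul_left, ← tsum_mul_left, ← hx'.tsum_add hy']
  exact (hsum _ (hs hx hy ha hb hab)).tsum_le_tsum (fun i => (hf i).2 hx hy ha hb hab)
    (hx'.add hy')

theorem zTilde_zero (x₁ x₂ : ℕ → ℝ) (β : ℝ) : zTilde x₁ x₂ β 0 = 0 := by simp [zTilde]

theorem timeLeft_left (t₁ : ℝ) (x₁ x₂ : ℕ → ℝ) (β : ℝ) : timeLeft t₁ x₁ x₂ β t₁ = 1 := by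
  simp [timeLeft]

theorem optPath_of_pos (t₁ : ℝ) (x₁ x₂ : ℕ → ℝ) (β t : ℝ) {k : ℕ} (hk : 1 ≤ k) :
    optPath t₁ x₁ x₂ β t k =
      x₁ k - zTilde x₁ x₂ β k * (1 - timeLeft t₁ x₁ x₂ β t ^ ((k : ℝ) / 2)) :=
  if_neg (by lia)

namespace Endpoints

variable {x₁ x₂ : ℕ → ℝ} {β : ℝ} (h : Endpoints x₁ x₂ β)
include h

theorem summable₂ : Summable fun k : ℕ => (k : ℝ) * x₂ k :=
  summable_mul_of_le h.summable₁ h.nonneg₂ h.le₂₁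

theorem hasSum_decrement : HasSum (fun k : ℕ => (k : ℝ) * (x₁ k - x₂ k))
    (2 * varsig x₁ x₂ - x₁ 0 + x₂ 0) := by
  have hsub := h.summable₁.hasSum.sub h.summable₂.hasSum
  simp only [← mul_sub] at hsub
  have heq : ∑' k : ℕ, (k : ℝ) * x₁ k - ∑' k : ℕ, (k : ℝ) * x₂ k =
      2 * varsig x₁ x₂ - x₁ 0 + x₂ 0 := by
    simp only [varsig, r, max_eq_left h.zero₁, max_eq_left h.zero₂]
    ring
  rwa [heq] at hsub

theorem hasSum_decrement_succ :
    HasSum (fun k : ℕ => ((k : ℝ) + 1) * (x₁ (k + 1) - x₂ (k + 1)))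
      (2 * varsig x₁ x₂ - x₁ 0 + x₂ 0) := by
  simpa using! (hasSum_nat_add_iff' 1).2 h.hasSum_decrement

theorem varsig_pos : 0 < varsig x₁ x₂ := by
  have hlt := h.lt
  rw [h.hasSum_decrement_succ.tsum_eq] at hlt
  have : 0 ≤ ∑' k : ℕ, (x₁ (k + 1) - x₂ (k + 1)) :=
    tsum_nonneg fun k => sub_nonneg.2 (h.le₂₁ _ k.succ_pos)
  linarith

theorem le_add_varsig (t₁ : ℝ) : t₁ ≤ t₁ + varsig x₁ x₂ := le_add_of_nonneg_right h.varsig_pos.le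

theorem beta_nonneg : 0 ≤ β := h.isBeta.mem_Ico.1

theorem beta_lt_one : β < 1 := h.isBeta.mem_Ico.2

theorem one_sub_pow_pos {k : ℕ} (hk : 1 ≤ k) : 0 < 1 - β ^ k :=
  sub_pos.2 (pow_lt_one₀ h.beta_nonneg h.beta_lt_one (by lia))

theorem sigmaTilde_pos : 0 < sigmaTilde x₁ x₂ β :=
  div_pos h.varsig_pos (h.one_sub_pow_pos one_le_two)

theorem sigmaTilde_mul : sigmaTilde x₁ x₂ β * (1 - β ^ 2) = varsig x₁ x₂ :=
  div_mul_cancel₀ _ (h.one_sub_pow_pos one_le_two).ne'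

theorem zTilde_nonneg (k : ℕ) : 0 ≤ zTilde x₁ x₂ β k := by
  rcases Nat.eq_zero_or_pos k with rfl | hk
  · rw [zTilde_zero]
  · exact div_nonneg (sub_nonneg.2 (h.le₂₁ k hk)) (h.one_sub_pow_pos hk).le

theorem zTilde_mul {k : ℕ} (hk : 1 ≤ k) : zTilde x₁ x₂ β k * (1 - β ^ k) = x₁ k - x₂ k :=
  div_mul_cancel₀ _ (h.one_sub_pow_pos hk).ne'

theorem summable_zTilde : Summable fun k : ℕ => (k : ℝ) * zTilde x₁ x₂ β k := by
  refine (h.hasSum_decrement.summable.div_const (1 - β)).of_nonneg_of_le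
    (fun k => mul_nonneg k.cast_nonneg (h.zTilde_nonneg k)) fun k => ?_
  rcases Nat.eq_zero_or_pos k with rfl | hk
  · simp
  · have hβ : 0 < 1 - β := sub_pos.2 h.beta_lt_one
    have hz := sub_nonneg.2 (h.le₂₁ k hk)
    have hpow := pow_le_of_le_one h.beta_nonneg h.beta_lt_one.le hk.ne'
    rw [zTilde, mul_div_assoc]
    gcongr

theorem hasSum_zTilde : HasSum (fun k : ℕ => (k : ℝ) * zTilde x₁ x₂ β k)
    (2 * sigmaTilde x₁ x₂ β - x₁ 0) := by
  have hshift : ∑' k : ℕ, ((k : ℝ) + 1) * (x₁ (k + 1) - x₂ (k + 1)) / (1 - β ^ (k + 1)) =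
      ∑' k : ℕ, (k : ℝ) * zTilde x₁ x₂ β k := by
    rw [h.summable_zTilde.tsum_eq_zero_add]
    simp [zTilde, mul_div_assoc]
  have hβ := h.isBeta.equation
  rw [h.hasSum_decrement_succ.tsum_eq, hshift] at hβ
  rw [h.summable_zTilde.hasSum_iff]
  refine mul_left_cancel₀ (h.one_sub_pow_pos one_le_two).ne' ?_
  linear_combination (-2) * h.sigmaTilde_mul - hβ

theorem beta_pos_of_zTilde_one_ne_zero (hz : zTilde x₁ x₂ β 1 ≠ 0) : 0 < β := by
  rcases h.isBeta with ⟨-, hz₁, -⟩ | ⟨-, hβ, -⟩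
  · exact absurd (by simp [zTilde, hz₁]) hz
  · exact hβ.1

variable {t₁ t : ℝ}

theorem timeLeft_right (t₁ : ℝ) : timeLeft t₁ x₁ x₂ β (t₁ + varsig x₁ x₂) = β ^ 2 := by
  rw [timeLeft, add_sub_cancel_left, ← h.sigmaTilde_mul,
    mul_div_cancel_left₀ _ h.sigmaTilde_pos.ne', sub_sub_cancel]

theorem timeLeft_strictAnti (t₁ : ℝ) : StrictAnti (timeLeft t₁ x₁ x₂ β) := fun s t hst => by
  have := h.sigmaTilde_pos
  unfold timeLeft
  gcongr

theorem sigmaTilde_mul_one_sub_timeLeft :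
    sigmaTilde x₁ x₂ β * (1 - timeLeft t₁ x₁ x₂ β t) = t - t₁ := by
  rw [timeLeft, sub_sub_cancel, mul_div_cancel₀ _ h.sigmaTilde_pos.ne']

theorem timeLeft_mem (ht : t ∈ Icc t₁ (t₁ + varsig x₁ x₂)) :
    timeLeft t₁ x₁ x₂ β t ∈ Icc (β ^ 2) 1 := by
  rw [← h.timeLeft_right t₁, ← timeLeft_left t₁ x₁ x₂ β]
  exact ⟨(h.timeLeft_strictAnti t₁).antitone ht.2, (h.timeLeft_strictAnti t₁).antitone ht.1⟩

theorem timeLeft_nonneg (ht : t ∈ Icc t₁ (t₁ + varsig x₁ x₂)) : 0 ≤ timeLeft t₁ x₁ x₂ β t :=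
  (sq_nonneg β).trans (h.timeLeft_mem ht).1

theorem sq_lt_timeLeft (ht : t < t₁ + varsig x₁ x₂) : β ^ 2 < timeLeft t₁ x₁ x₂ β t := by
  rw [← h.timeLeft_right t₁]
  exact h.timeLeft_strictAnti t₁ ht

theorem timeLeft_pos (ht : t < t₁ + varsig x₁ x₂) : 0 < timeLeft t₁ x₁ x₂ β t :=
  (sq_nonneg β).trans_lt (h.sq_lt_timeLeft ht)

theorem rpow_timeLeft_mem (ht : t ∈ Icc t₁ (t₁ + varsig x₁ x₂)) (k : ℕ) :
    timeLeft t₁ x₁ x₂ β t ^ ((k : ℝ) / 2) ∈ Icc (0 : ℝ) 1 :=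
  ⟨Real.rpow_nonneg (h.timeLeft_nonneg ht) _,
    Real.rpow_le_one (h.timeLeft_nonneg ht) (h.timeLeft_mem ht).2 (by positivity)⟩

theorem hasSum_zTilde_rpow (ht : t ∈ Icc t₁ (t₁ + varsig x₁ x₂)) :
    HasSum (fun k : ℕ => (k : ℝ) * zTilde x₁ x₂ β k * timeLeft t₁ x₁ x₂ β t ^ ((k : ℝ) / 2))
      (2 * sigmaTilde x₁ x₂ β * timeLeft t₁ x₁ x₂ β t - optPath t₁ x₁ x₂ β t 0) := by
  have hcoef : ∀ k : ℕ, 0 ≤ (k : ℝ) * zTilde x₁ x₂ β k := fun k =>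
    mul_nonneg k.cast_nonneg (h.zTilde_nonneg k)
  have hsum := (h.summable_zTilde.of_nonneg_of_le
    (fun k => mul_nonneg (hcoef k) (h.rpow_timeLeft_mem ht k).1)
    fun k => mul_le_of_le_one_right (hcoef k) (h.rpow_timeLeft_mem ht k).2).hasSum
  rwa [optPath, if_pos rfl, sub_sub_cancel]

theorem optPath_left : optPath t₁ x₁ x₂ β t₁ = x₁ := by
  ext k
  rcases Nat.eq_zero_or_pos k with rfl | hk
  · simp [optPath, timeLeft_left, h.hasSum_zTilde.tsum_eq]
  · simp [optPath_of_pos _ _ _ _ _ hk, timeLeft_left]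

theorem optPath_right : optPath t₁ x₁ x₂ β (t₁ + varsig x₁ x₂) = x₂ := by
  ext k
  rcases Nat.eq_zero_or_pos k with rfl | hk
  · have hsum : HasSum (fun k : ℕ => (k : ℝ) * zTilde x₁ x₂ β k * (β ^ 2) ^ ((k : ℝ) / 2))
        (2 * sigmaTilde x₁ x₂ β - x₁ 0 - (2 * varsig x₁ x₂ - x₁ 0 + x₂ 0)) := by
      refine (h.hasSum_zTilde.sub h.hasSum_decrement).congr_fun fun k => ?_
      rw [rpow_half_sq h.beta_nonneg]
      rcases Nat.eq_zero_or_pos k with rfl | hk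
      · simp
      · rw [← h.zTilde_mul hk]
        ring
    rw [optPath, if_pos rfl, h.timeLeft_right, hsum.tsum_eq]
    linear_combination (-2) * h.sigmaTilde_mul
  · rw [optPath_of_pos _ _ _ _ _ hk, h.timeLeft_right, rpow_half_sq h.beta_nonneg, h.zTilde_mul hk]
    ring

theorem summable_zeroQuotient {u : ℝ} (hu : u ∈ Icc (0 : ℝ) 1) :
    Summable fun j : ℕ => ((j : ℝ) + 1) * zTilde x₁ x₂ β (j + 1) * u ^ j := by
  have hcoef : ∀ j : ℕ, 0 ≤ ((j : ℝ) + 1) * zTilde x₁ x₂ β (j + 1) := fun j =>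
    mul_nonneg (by positivity) (h.zTilde_nonneg _)
  refine ((summable_nat_add_iff 1).2 h.summable_zTilde).of_nonneg_of_le
    (fun j => mul_nonneg (hcoef j) (pow_nonneg hu.1 j)) fun j => ?_
  rw [Nat.cast_succ]
  exact mul_le_of_le_one_right (hcoef j) (pow_le_one₀ hu.1 hu.2)

theorem concaveOn_zeroQuotient : ConcaveOn ℝ (Icc 0 1) (zeroQuotient x₁ x₂ β) := by
  refine ((LinearMap.mulLeft ℝ (2 * sigmaTilde x₁ x₂ β)).concaveOn (convex_Icc 0 1)).sub
    (convexOn_tsum (convex_Icc 0 1) (fun j => ?_) fun u hu => h.summable_zeroQuotient hu)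
  exact ((convexOn_pow j).subset Icc_subset_Ici_self (convex_Icc 0 1)).smul
    (mul_nonneg (by positivity) (h.zTilde_nonneg _))

theorem optPath_zero_eq_mul (ht : t ∈ Icc t₁ (t₁ + varsig x₁ x₂)) {u : ℝ} (hu : u ∈ Icc (0 : ℝ) 1)
    (hut : u ^ 2 = timeLeft t₁ x₁ x₂ β t) :
    optPath t₁ x₁ x₂ β t 0 = u * zeroQuotient x₁ x₂ β u := by
  have hsum := (hasSum_nat_add_iff' 1).2 (h.hasSum_zTilde_rpow ht)
  simp only [← hut, rpow_half_sq hu.1, Finset.range_one, Finset.sum_singleton, Nat.cast_zero,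
    zero_mul, sub_zero] at hsum
  have hfactor := ((h.summable_zeroQuotient hu).hasSum.mul_left u).unique
    (hsum.congr_fun fun j => by
      push_cast
      ring)
  rw [zeroQuotient]
  linear_combination hfactor

theorem zeroQuotient_one_nonneg : 0 ≤ zeroQuotient x₁ x₂ β 1 := by
  have := h.optPath_zero_eq_mul (left_mem_Icc.2 (h.le_add_varsig 0)) (right_mem_Icc.2 zero_le_one)
    (by rw [timeLeft_left, one_pow])
  rw [h.optPath_left, one_mul] at this
  exact this ▸ h.zero₁

theorem zeroQuotient_beta_nonneg : 0 ≤ zeroQuotient x₁ x₂ β β := by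
  rcases h.beta_nonneg.eq_or_lt with hβ | hβ
  · have hz : zTilde x₁ x₂ β 1 = 0 := by
      by_contra hne
      exact (h.beta_pos_of_zTilde_one_ne_zero hne).ne hβ
    rw [zeroQuotient, tsum_eq_single 0 fun j hj => by rw [← hβ, zero_pow hj, mul_zero], zero_add,
      hz, ← hβ]
    simp
  · have := h.optPath_zero_eq_mul (right_mem_Icc.2 (h.le_add_varsig 0))
      ⟨hβ.le, h.beta_lt_one.le⟩ (h.timeLeft_right 0).symm
    rw [h.optPath_right] at this
    exact nonneg_of_mul_nonneg_right (this ▸ h.zero₂) hβ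

theorem optPath_zero_nonneg (ht : t ∈ Icc t₁ (t₁ + varsig x₁ x₂)) :
    0 ≤ optPath t₁ x₁ x₂ β t 0 := by
  have hw := h.timeLeft_mem ht
  have hβu : β ≤ √(timeLeft t₁ x₁ x₂ β t) := Real.le_sqrt_of_sq_le hw.1
  have hu1 : √(timeLeft t₁ x₁ x₂ β t) ≤ 1 := Real.sqrt_le_one.2 hw.2
  have hmin := h.concaveOn_zeroQuotient.min_le_of_mem_Icc ⟨h.beta_nonneg, h.beta_lt_one.le⟩
    (right_mem_Icc.2 zero_le_one) ⟨hβu, hu1⟩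
  rw [h.optPath_zero_eq_mul ht ⟨Real.sqrt_nonneg _, hu1⟩ (Real.sq_sqrt (h.timeLeft_nonneg ht))]
  exact mul_nonneg (Real.sqrt_nonneg _)
    ((le_min h.zeroQuotient_beta_nonneg h.zeroQuotient_one_nonneg).trans hmin)

theorem optPath_antitoneOn {k : ℕ} (hk : 1 ≤ k) :
    AntitoneOn (fun t => optPath t₁ x₁ x₂ β t k) (Icc t₁ (t₁ + varsig x₁ x₂)) := by
  intro s _ t ht hst
  simp only [optPath_of_pos _ _ _ _ _ hk]
  have := h.timeLeft_nonneg ht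
  have := (h.timeLeft_strictAnti t₁).antitone hst
  have := h.zTilde_nonneg k
  gcongr

theorem optPath_absCont {k : ℕ} (hk : 1 ≤ k) :
    AbsolutelyContinuousOnInterval (fun t => optPath t₁ x₁ x₂ β t k) t₁
      (t₁ + varsig x₁ x₂) := by
  refine ContDiffOn.absolutelyContinuousOnInterval ?_
  simp only [optPath_of_pos _ _ _ _ _ hk, uIcc_of_le (h.le_add_varsig t₁)]
  have hw : ContDiff ℝ 1 (timeLeft t₁ x₁ x₂ β) := by
    unfold timeLeft
    fun_prop
  rcases eq_or_ne (zTilde x₁ x₂ β k) 0 with hz | hz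
  · simp only [hz, zero_mul]
    fun_prop
  · refine contDiffOn_const.sub (contDiffOn_const.mul (contDiffOn_const.sub ?_))
    rcases hk.eq_or_lt with rfl | hk₂
    · exact hw.contDiffOn.rpow_const_of_ne fun t ht =>
        ((pow_pos (h.beta_pos_of_zTilde_one_ne_zero hz) 2).trans_le (h.timeLeft_mem ht).1).ne'
    · have : (2 : ℝ) ≤ k := mod_cast hk₂
      exact (hw.rpow_const_of_le (by rw [Nat.cast_one]; linarith)).contDiffOn

theorem hasSum_optPath_decrease (ht : t ∈ Icc t₁ (t₁ + varsig x₁ x₂)) :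
    HasSum (fun k : ℕ => (k : ℝ) * (x₁ k - optPath t₁ x₁ x₂ β t k))
      (optPath t₁ x₁ x₂ β t 0 - x₁ 0 + 2 * (t - t₁)) := by
  rw [show optPath t₁ x₁ x₂ β t 0 - x₁ 0 + 2 * (t - t₁) = 2 * sigmaTilde x₁ x₂ β - x₁ 0 -
    (2 * sigmaTilde x₁ x₂ β * timeLeft t₁ x₁ x₂ β t - optPath t₁ x₁ x₂ β t 0) by
    linear_combination (-2) * h.sigmaTilde_mul_one_sub_timeLeft (t₁ := t₁) (t := t)]
  refine (h.hasSum_zTilde.sub (h.hasSum_zTilde_rpow ht)).congr_fun fun k => ?_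
  rcases Nat.eq_zero_or_pos k with rfl | hk
  · simp
  · rw [optPath_of_pos _ _ _ _ _ hk]
    ring

theorem optPath_zero_absCont :
    AbsolutelyContinuousOnInterval (fun t => optPath t₁ x₁ x₂ β t 0) t₁
      (t₁ + varsig x₁ x₂) := by
  have hlin : AbsolutelyContinuousOnInterval (fun t : ℝ => x₁ 0 - 2 * (t - t₁)) t₁
      (t₁ + varsig x₁ x₂) := ContDiffOn.absolutelyContinuousOnInterval (by fun_prop)
  have hdecr := absCont_of_hasSum_monotoneOn
    (g := fun (k : ℕ) t => (k : ℝ) * (x₁ k - optPath t₁ x₁ x₂ β t k)) (h.le_add_varsig t₁)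
    (fun k => ?_) (fun k => ?_) fun t ht => h.hasSum_optPath_decrease ht
  · refine absCont_congr (hdecr.add hlin) fun t _ => ?_
    simp only [Pi.add_apply]
    ring
  all_goals rcases Nat.eq_zero_or_pos k with rfl | hk
  · simpa only [Nat.cast_zero, zero_mul] using absCont_const 0 _ _
  · exact ((absCont_const (x₁ k) _ _).sub (h.optPath_absCont hk)).const_mul k
  · simpa only [Nat.cast_zero, zero_mul] using monotoneOn_const
  · intro s hs t ht hst
    have := h.optPath_antitoneOn hk hs ht hst
    dsimp only at this ⊢
    gcongr

theorem optPath_nonneg {k : ℕ} (hk : 1 ≤ k) (ht : t ∈ Icc t₁ (t₁ + varsig x₁ x₂)) :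
    0 ≤ optPath t₁ x₁ x₂ β t k := by
  have hanti := h.optPath_antitoneOn hk ht ⟨ht.1.trans ht.2, le_rfl⟩ ht.2
  simp only [h.optPath_right] at hanti
  exact (h.nonneg₂ k hk).trans hanti

theorem r_optPath (ht : t ∈ Icc t₁ (t₁ + varsig x₁ x₂)) :
    r (optPath t₁ x₁ x₂ β t) = r x₁ - 2 * (t - t₁) := by
  have hsum := h.summable₁.hasSum.sub (h.hasSum_optPath_decrease ht)
  simp only [← mul_sub, sub_sub_cancel] at hsum
  rw [r, r, max_eq_left h.zero₁, max_eq_left (h.optPath_zero_nonneg ht), hsum.tsum_eq]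
  ring

theorem descendingPath_optPath :
    DescendingPath x₁ x₂ t₁ (t₁ + varsig x₁ x₂) (optPath t₁ x₁ x₂ β) :=
  ⟨h.optPath_left, h.optPath_right, fun _ ht => h.optPath_zero_nonneg ht,
    fun _ hk => h.optPath_antitoneOn hk, fun _ hk => h.optPath_absCont hk,
    fun _ hk _ ht => h.optPath_nonneg hk ht, fun _ ht => h.r_optPath ht⟩

end Endpoints

/-! ### The candidate pair is admissible -/

theorem continuousOn_glue {X : Type*} [TopologicalSpace X] {f : ℝ → X} {a b c : ℝ} (hab : a ≤ b)
    (hbc : b ≤ c) (hf₁ : ContinuousOn f (Icc a b)) (hf₂ : ContinuousOn f (Icc b c)) :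
    ContinuousOn f (Icc a c) := by
  rw [← Icc_union_Icc_eq_Icc hab hbc]
  exact hf₁.union_of_isClosed hf₂ isClosed_Icc isClosed_Icc

theorem antitoneOn_glue {f : ℝ → ℝ} {a b c : ℝ} (hab : a ≤ b) (hbc : b ≤ c)
    (hf₁ : AntitoneOn f (Icc a b)) (hf₂ : AntitoneOn f (Icc b c)) : AntitoneOn f (Icc a c) := by
  rw [← Icc_union_Icc_eq_Icc hab hbc]
  exact hf₁.union_right hf₂ (isGreatest_Icc hab) (isLeast_Icc hbc)

section BeforeBridge

variable {t₁ t : ℝ}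

theorem tildeζ_of_le (x₁ x₂ : ℕ → ℝ) (β : ℝ) (ζs : ℝ → ℕ → ℝ) (ht : t ≤ t₁) :
    tildeζ t₁ x₁ x₂ β ζs t = ζs t := funext fun _ => if_pos ht

theorem tildeψ_of_le (x₁ x₂ : ℕ → ℝ) (β : ℝ) (ψs : ℝ → ℝ) (ht : t ≤ t₁) :
    tildeψ t₁ x₁ x₂ β ψs t = ψs t := if_pos ht

theorem skorokhod_tildeψ_of_le (x₁ x₂ : ℕ → ℝ) (β : ℝ) (ψs : ℝ → ℝ) (ht : t ≤ t₁) :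
    skorokhod (tildeψ t₁ x₁ x₂ β ψs) t = skorokhod ψs t := by
  rw [skorokhod, skorokhod, tildeψ_of_le _ _ _ _ ht,
    image_congr fun s hs => tildeψ_of_le _ _ _ _ (hs.2.trans ht)]

end BeforeBridge

namespace Endpoints

variable {p x₁ x₂ : ℕ → ℝ} {β : ℝ} (h : Endpoints x₁ x₂ β) {t₁ t : ℝ} {ζs : ℝ → ℕ → ℝ}
  {ψs : ℝ → ℝ}
include h

theorem tildeIncr_eq (ht : t ∈ Icc t₁ (t₁ + varsig x₁ x₂)) :
    tildeIncr t₁ x₁ x₂ β t = optPath t₁ x₁ x₂ β t 0 - x₁ 0 := by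
  have hsum := (hasSum_nat_add_iff' 1).2 (h.hasSum_optPath_decrease ht)
  simp only [Finset.range_one, Finset.sum_singleton, Nat.cast_zero, zero_mul, sub_zero,
    optPath_of_pos _ _ _ _ _ (Nat.le_add_left 1 _), Nat.cast_add, Nat.cast_one] at hsum
  simp only [tildeIncr, tildeCoord, Nat.cast_add, Nat.cast_one]
  exact sub_eq_of_eq_add hsum.tsum_eq

theorem tildeζ_eq (hζ : ζs t₁ = x₁) (ht : t ∈ Icc t₁ (t₁ + varsig x₁ x₂)) :
    tildeζ t₁ x₁ x₂ β ζs t = optPath t₁ x₁ x₂ β t := by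
  rcases ht.1.eq_or_lt with rfl | hlt
  · rw [h.optPath_left, tildeζ_of_le _ _ _ _ le_rfl, hζ]
  · ext k
    rcases Nat.eq_zero_or_pos k with rfl | hk
    · simp [tildeζ, hlt.not_ge, h.tildeIncr_eq ht]
    · rw [optPath_of_pos _ _ _ _ _ hk, tildeζ, if_neg hlt.not_ge, if_neg hk.ne']
      rfl

theorem tildeψ_eq (ψs : ℝ → ℝ) (ht : t ∈ Icc t₁ (t₁ + varsig x₁ x₂)) :
    tildeψ t₁ x₁ x₂ β ψs t = ψs t₁ + (optPath t₁ x₁ x₂ β t 0 - x₁ 0) := by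
  rcases ht.1.eq_or_lt with rfl | hlt
  · rw [h.optPath_left, tildeψ_of_le _ _ _ _ le_rfl, sub_self, add_zero]
  · rw [tildeψ, if_neg hlt.not_ge, h.tildeIncr_eq ht]

theorem tildeψ_absCont (ht₁ : 0 ≤ t₁) (hψ : AbsolutelyContinuousOnInterval ψs 0 t₁) :
    AbsolutelyContinuousOnInterval (tildeψ t₁ x₁ x₂ β ψs) 0 (t₁ + varsig x₁ x₂) := by
  refine absCont_trans ht₁ (h.le_add_varsig t₁) (absCont_congr hψ fun t ht => ?_)
    (absCont_congr (h.optPath_zero_absCont.add (absCont_const (ψs t₁ - x₁ 0) _ _)) fun t ht => ?_)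
  · rw [uIcc_of_le ht₁] at ht
    exact (tildeψ_of_le _ _ _ _ ht.2).symm
  · rw [uIcc_of_le (h.le_add_varsig t₁)] at ht
    rw [h.tildeψ_eq _ ht, Pi.add_apply]
    ring

theorem tildeψ_continuousOn (ht₁ : 0 ≤ t₁) (hψ : AbsolutelyContinuousOnInterval ψs 0 t₁) :
    ContinuousOn (tildeψ t₁ x₁ x₂ β ψs) (Icc 0 (t₁ + varsig x₁ x₂)) := by
  rw [← uIcc_of_le (ht₁.trans (h.le_add_varsig t₁))]
  exact (h.tildeψ_absCont ht₁ hψ).continuousOn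

theorem tildeζ_zero_eq_skorokhod (hadm : Admissible p t₁ ζs ψs) (hx₁ : ζs t₁ = x₁) (ht₁ : 0 ≤ t₁)
    (ht : t ∈ Icc 0 (t₁ + varsig x₁ x₂)) :
    tildeζ t₁ x₁ x₂ β ζs t 0 = skorokhod (tildeψ t₁ x₁ x₂ β ψs) t := by
  rcases le_total t t₁ with htt₁ | htt₁
  · rw [tildeζ_of_le _ _ _ _ htt₁, skorokhod_tildeψ_of_le _ _ _ _ htt₁]
    exact hadm.ζ_refl t ⟨ht.1, htt₁⟩
  · have hstart : skorokhod (tildeψ t₁ x₁ x₂ β ψs) t₁ = x₁ 0 := by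
      rw [skorokhod_tildeψ_of_le _ _ _ _ le_rfl, ← hadm.ζ_refl t₁ ⟨ht₁, le_rfl⟩, hx₁]
    rw [h.tildeζ_eq hx₁ ⟨htt₁, ht.2⟩, skorokhod_eq_of_le ht₁ htt₁
      ((h.tildeψ_continuousOn ht₁ hadm.ψ_ac).mono (Icc_subset_Icc_right ht.2)) fun s hs => ?_,
      hstart, tildeψ_of_le _ _ _ _ le_rfl, h.tildeψ_eq _ ⟨htt₁, ht.2⟩]
    · ring
    · have hs' : s ∈ Icc t₁ (t₁ + varsig x₁ x₂) := ⟨hs.1, hs.2.trans ht.2⟩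
      rw [hstart, tildeψ_of_le _ _ _ _ le_rfl, h.tildeψ_eq _ hs']
      linarith [h.optPath_zero_nonneg hs']

theorem tildeζ_continuousOn (hζ : ContinuousOn ζs (Icc 0 t₁)) (hx₁ : ζs t₁ = x₁) (ht₁ : 0 ≤ t₁) :
    ContinuousOn (tildeζ t₁ x₁ x₂ β ζs) (Icc 0 (t₁ + varsig x₁ x₂)) := by
  refine continuousOn_glue ht₁ (h.le_add_varsig t₁)
    (hζ.congr fun t ht => tildeζ_of_le _ _ _ _ ht.2)
    (ContinuousOn.congr (continuousOn_pi.2 fun k => ?_) fun t ht => h.tildeζ_eq hx₁ ht)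
  rw [← uIcc_of_le (h.le_add_varsig t₁)]
  rcases Nat.eq_zero_or_pos k with rfl | hk
  · exact h.optPath_zero_absCont.continuousOn
  · exact (h.optPath_absCont hk).continuousOn

theorem tildeζ_absCont {k : ℕ} (hζ : AbsolutelyContinuousOnInterval (fun t => ζs t k) 0 t₁)
    (hx₁ : ζs t₁ = x₁) (ht₁ : 0 ≤ t₁) (hk : 1 ≤ k) :
    AbsolutelyContinuousOnInterval (fun t => tildeζ t₁ x₁ x₂ β ζs t k) 0
      (t₁ + varsig x₁ x₂) := by
  refine absCont_trans ht₁ (h.le_add_varsig t₁) (absCont_congr hζ fun t ht => ?_)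
    (absCont_congr (h.optPath_absCont hk) fun t ht => ?_)
  · rw [uIcc_of_le ht₁] at ht
    rw [tildeζ_of_le _ _ _ _ ht.2]
  · rw [uIcc_of_le (h.le_add_varsig t₁)] at ht
    rw [h.tildeζ_eq hx₁ ht]

theorem admissible_tilde (ht₁ : 0 ≤ t₁) (hadm : Admissible p t₁ ζs ψs) (hx₁ : ζs t₁ = x₁) :
    Admissible p (t₁ + varsig x₁ x₂) (tildeζ t₁ x₁ x₂ β ζs) (tildeψ t₁ x₁ x₂ β ψs) where
  cont_ζ := h.tildeζ_continuousOn hadm.cont_ζ hx₁ ht₁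
  cont_ψ := h.tildeψ_continuousOn ht₁ hadm.ψ_ac
  ψ_zero := by rw [tildeψ_of_le _ _ _ _ ht₁, hadm.ψ_zero]
  ψ_ac := h.tildeψ_absCont ht₁ hadm.ψ_ac
  ζ_refl t ht := h.tildeζ_zero_eq_skorokhod hadm hx₁ ht₁ ht
  ζ_init k hk := by rw [tildeζ_of_le _ _ _ _ ht₁, hadm.ζ_init k hk]
  ζ_anti k hk := antitoneOn_glue ht₁ (h.le_add_varsig t₁)
    ((hadm.ζ_anti k hk).congr fun t ht => by simp only [tildeζ_of_le _ _ _ _ ht.2])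
    ((h.optPath_antitoneOn hk).congr fun t ht => by simp only [h.tildeζ_eq hx₁ ht])
  ζ_ac k hk := h.tildeζ_absCont (hadm.ζ_ac k hk) hx₁ ht₁ hk
  ζ_nonneg k hk t ht := by
    rcases le_total t t₁ with htt₁ | htt₁
    · rw [tildeζ_of_le _ _ _ _ htt₁]
      exact hadm.ζ_nonneg k hk t ⟨ht.1, htt₁⟩
    · rw [h.tildeζ_eq hx₁ ⟨htt₁, ht.2⟩]
      exact h.optPath_nonneg hk ⟨htt₁, ht.2⟩

theorem tilde_mem_J2 (ht₁ : 0 ≤ t₁) (hs : (ζs, ψs) ∈ J0 p 0 t₁ p x₁) :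
    (tildeζ t₁ x₁ x₂ β ζs, tildeψ t₁ x₁ x₂ β ψs) ∈ J2 p t₁ (t₁ + varsig x₁ x₂) x₁ x₂ := by
  obtain ⟨hadm, -, hx₁⟩ := hs
  have hleft := left_mem_Icc.2 (h.le_add_varsig t₁)
  refine ⟨⟨⟨h.admissible_tilde ht₁ hadm hx₁, ?_, ?_⟩, fun t ht => ?_⟩, .of_forall fun t ht => ?_⟩
  · exact (h.tildeζ_eq hx₁ hleft).trans h.optPath_left
  · exact (h.tildeζ_eq hx₁ (right_mem_Icc.2 (h.le_add_varsig t₁))).trans h.optPath_right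
  · have ht' := Ioo_subset_Icc_self ht
    dsimp only
    rw [h.tildeψ_eq _ hleft, h.tildeψ_eq _ ht', h.optPath_left]
    linarith [h.optPath_zero_nonneg ht']
  · have hlin : HasDerivAt (fun s => r x₁ - 2 * (s - t₁)) (-2) t := by
      simpa using! (((hasDerivAt_id t).sub_const t₁).const_mul 2).const_sub (r x₁)
    refine hlin.congr_of_eventuallyEq ?_
    filter_upwards [Ioo_mem_nhds ht.1 ht.2] with s hs'
    rw [h.tildeζ_eq hx₁ (Ioo_subset_Icc_self hs'), h.r_optPath (Ioo_subset_Icc_self hs')]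

end Endpoints

/-! ### The cost of a path as an integral of nonnegative functions -/

/-- The velocity `ζ'(t)`, with the junk value `0` in the coordinates that are not differentiable
at `t`. -/
def velocity (ζ : ℝ → ℕ → ℝ) (t : ℝ) (k : ℕ) : ℝ := deriv (fun u => ζ u k) t

namespace DescendingPath

variable {x₁ x₂ : ℕ → ℝ} {a b t : ℝ} {ζ : ℝ → ℕ → ℝ}

theorem r_pos (h : DescendingPath x₁ x₂ a b ζ) (ht : t ∈ Ico a b) : 0 < r (ζ t) := by
  have hb : b ∈ Icc a b := right_mem_Icc.2 (ht.1.trans ht.2.le)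
  have hrb : 0 ≤ r (ζ b) := by
    refine add_nonneg (le_max_right _ _) (tsum_nonneg fun k => ?_)
    rcases Nat.eq_zero_or_pos k with rfl | hk
    · simp
    · exact mul_nonneg k.cast_nonneg (h.nonneg k hk b hb)
  linarith [ht.2, h.r_eq t (Ico_subset_Icc_self ht), h.r_eq b hb]

theorem L_eq (h : DescendingPath x₁ x₂ a b ζ) (hx₁ : Summable fun k : ℕ => (k : ℝ) * x₁ k)
    (ht : t ∈ Ioo a b) (hv : SubVelocity (velocity ζ t)) :
    L (ζ t) (velocity ζ t) = ((∑' k, klTerm (nu (velocity ζ t) k) (rk (ζ t) k) : ℝ≥0∞) : EReal) :=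
  L_eq_tsum (fun k hk => h.nonneg k hk t (Ioo_subset_Icc_self ht))
    (h.summable hx₁ (Ioo_subset_Icc_self ht)) (h.r_pos (Ioo_subset_Ico_self ht))
    (fun _ hk => h.deriv_nonpos hk ht) hv

theorem L_nonneg (h : DescendingPath x₁ x₂ a b ζ) (hx₁ : Summable fun k : ℕ => (k : ℝ) * x₁ k)
    (ht : t ∈ Ioo a b) : 0 ≤ L (ζ t) (velocity ζ t) := by
  by_cases hv : SubVelocity (velocity ζ t)
  · rw [h.L_eq hx₁ ht hv]
    exact EReal.coe_ennreal_nonneg _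
  · rw [L_eq_top hv]
    exact le_top

theorem LCost_eq (h : DescendingPath x₁ x₂ a b ζ) (hx₁ : Summable fun k : ℕ => (k : ℝ) * x₁ k) :
    LCost a b ζ = ((∫⁻ t in Ioo a b, (L (ζ t) (velocity ζ t)).toENNReal : ℝ≥0∞) : EReal) := by
  have hneg : ∫⁻ t in Ioo a b, (-L (ζ t) (velocity ζ t)).toENNReal = 0 := by
    rw [setLIntegral_congr_fun measurableSet_Ioo fun t ht =>
      EReal.toENNReal_of_nonpos (by simpa using h.L_nonneg hx₁ ht), lintegral_zero]
  unfold velocity at hneg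
  rw [LCost, eint, ← Measure.restrict_congr_set (Ioo_ae_eq_Icc (a := a) (b := b)), hneg,
    EReal.coe_ennreal_zero, sub_zero]
  rfl

end DescendingPath

/-! ### Rates of a control -/

theorem klTerm_lintegral_le_lintegral_ell {α : Type*} [MeasurableSpace α] {μ : Measure α}
    [IsFiniteMeasure μ] {f : α → ℝ≥0} (hf : Measurable f) (hfin : ∫⁻ y, f y ∂μ ≠ ⊤) :
    klTerm (∫⁻ y, f y ∂μ).toReal (μ.real univ) ≤ ∫⁻ y, ENNReal.ofReal (ell (f y)) ∂μ := by
  rcases eq_zero_or_neZero μ with rfl | hμ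
  · simp [klTerm_zero_left]
  rcases eq_or_ne (∫⁻ y, ENNReal.ofReal (ell (f y)) ∂μ) ⊤ with htop | htop
  · exact htop ▸ le_top
  have hell_nonneg : 0 ≤ᵐ[μ] fun y => ell (f y) := .of_forall fun y => ell_nonneg (f y).2
  have hell : Integrable (fun y => ell (f y)) μ :=
    (lintegral_ofReal_ne_top_iff_integrable
      (continuous_ell.measurable.comp hf.coe_nnreal_real).aestronglyMeasurable hell_nonneg).1 htop
  have hint : Integrable (fun y => (f y : ℝ)) μ := by
    simpa using integrable_toReal_of_lintegral_ne_top hf.coe_nnreal_ennreal.aemeasurable hfin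
  have hmass : ∫ y, (f y : ℝ) ∂μ = (∫⁻ y, f y ∂μ).toReal := by
    simpa using integral_toReal (μ := μ) hf.coe_nnreal_ennreal.aemeasurable (by simp)
  have hpos : 0 < μ.real univ := measureReal_univ_pos
  have hjensen : ell (⨍ y, (f y : ℝ) ∂μ) ≤ ⨍ y, ell (f y) ∂μ := by
    rw [ell_eq_klFun] at hell ⊢
    exact InformationTheory.convexOn_klFun.map_average_le
      InformationTheory.continuous_klFun.continuousOn isClosed_Ici (.of_forall fun y => (f y).2)
      hint hell
  rw [average_eq, average_eq, smul_eq_mul, smul_eq_mul, hmass, inv_mul_eq_div] at hjensen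
  rw [klTerm_eq_ofReal fun h => absurd h hpos.ne', ← ofReal_integral_eq_lintegral_ofReal hell
    hell_nonneg]
  exact ENNReal.ofReal_le_ofReal ((le_inv_mul_iff₀ hpos).1 hjensen)

/-- The rate `∫₀¹ 1_{[0, r_k(ζ(s)))}(y) φ_k(s, y) dy` at which the control `φ` makes the path `ζ`
jump in direction `k`. -/
def rate (ζ : ℝ → ℕ → ℝ) (φ : ℕ → ℝ × ℝ → ℝ≥0) (k : ℕ) (s : ℝ) : ℝ≥0∞ :=
  ∫⁻ y in Icc (0 : ℝ) 1, {y | y < rk (ζ s) k}.indicator (fun y => (φ k (s, y) : ℝ≥0∞)) y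

theorem rk_le_one {x : ℕ → ℝ} (hx : ∀ k, 1 ≤ k → 0 ≤ x k) (k : ℕ) : rk x k ≤ 1 := by
  by_cases h : Summable (fun j : ℕ => (j : ℝ) * x j) ∧ 0 < r x
  · exact le_hasSum (hasSum_rk h.1 h.2) k fun j _ => rk_nonneg hx j
  · rw [rk, if_neg h]
    exact zero_le_one

theorem Iio_inter_Icc_of_le {α : Type*} [Preorder α] {a b m : α} (hm : m ≤ b) :
    Iio m ∩ Icc a b = Ico a m :=
  Set.ext fun _ => ⟨fun hy => ⟨hy.2.1, hy.1⟩, fun hy => ⟨hy.2, hy.1, hy.2.le.trans hm⟩⟩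

theorem rate_eq_setLIntegral_Ico {ζ : ℝ → ℕ → ℝ} {s : ℝ} (hζ : ∀ k, 1 ≤ k → 0 ≤ ζ s k)
    (φ : ℕ → ℝ × ℝ → ℝ≥0) (k : ℕ) :
    rate ζ φ k s = ∫⁻ y in Ico 0 (rk (ζ s) k), (φ k (s, y) : ℝ≥0∞) := by
  change ∫⁻ y in Icc (0 : ℝ) 1, (Iio (rk (ζ s) k)).indicator _ y = _
  rw [setLIntegral_indicator measurableSet_Iio, Iio_inter_Icc_of_le (rk_le_one hζ k)]

theorem klTerm_rate_le {ζ : ℝ → ℕ → ℝ} {φ : ℕ → ℝ × ℝ → ℝ≥0} {k : ℕ} {s : ℝ}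
    (hφ : Measurable (φ k)) (hζ : ∀ k, 1 ≤ k → 0 ≤ ζ s k) (hfin : rate ζ φ k s ≠ ⊤) :
    klTerm (rate ζ φ k s).toReal (rk (ζ s) k) ≤
      ∫⁻ y in Icc (0 : ℝ) 1, ENNReal.ofReal (ell (φ k (s, y))) := by
  rw [rate_eq_setLIntegral_Ico hζ] at hfin ⊢
  have hjensen := klTerm_lintegral_le_lintegral_ell (hφ.comp measurable_prodMk_left) hfin
  rw [measureReal_restrict_apply_univ, Real.volume_real_Ico_of_le (rk_nonneg hζ k),
    sub_zero] at hjensen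
  exact hjensen.trans (lintegral_mono_set
    (Ico_subset_Icc_self.trans (Icc_subset_Icc_right (rk_le_one hζ k))))

theorem setLIntegral_prod_Icc {f : ℝ × ℝ → ℝ≥0∞} (hf : Measurable f) (a b : ℝ) :
    ∫⁻ q in Icc a b ×ˢ Icc (0 : ℝ) 1, f q = ∫⁻ s in Icc a b, ∫⁻ y in Icc (0 : ℝ) 1, f (s, y) := by
  rw [Measure.volume_eq_prod, ← Measure.prod_restrict, lintegral_prod _ hf.aemeasurable]

theorem controlCost_eq {φ : ℕ → ℝ × ℝ → ℝ≥0} (hφ : ∀ k, Measurable (φ k)) (a b : ℝ) :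
    controlCost a b φ = ∫⁻ s in Icc a b, ∑' k, ∫⁻ y in Icc (0 : ℝ) 1,
      ENNReal.ofReal (ell (φ k (s, y))) := by
  have hmeas : ∀ k, Measurable fun q => ENNReal.ofReal (ell (φ k q)) := fun k =>
    (continuous_ell.measurable.comp (hφ k).coe_nnreal_real).ennreal_ofReal
  rw [lintegral_tsum fun k => (hmeas k).lintegral_prod_right'.aemeasurable]
  exact tsum_congr fun k => setLIntegral_prod_Icc (hmeas k) a b

section MeasurableRates

variable {ζ : ℝ → ℕ → ℝ} {φ : ℕ → ℝ × ℝ → ℝ≥0} {k : ℕ}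

theorem measurable_flow_integrand (hζ : Measurable fun s => rk (ζ s) k) (hφ : Measurable (φ k)) :
    Measurable ({q : ℝ × ℝ | q.2 < rk (ζ q.1) k}.indicator fun q => (φ k q : ℝ≥0∞)) :=
  hφ.coe_nnreal_ennreal.indicator (measurableSet_lt measurable_snd (hζ.comp measurable_fst))

theorem measurable_rate (hζ : Measurable fun s => rk (ζ s) k) (hφ : Measurable (φ k)) :
    Measurable (rate ζ φ k) :=
  (measurable_flow_integrand hζ hφ).lintegral_prod_right'

end MeasurableRates

section ClampedPath

variable {p : ℕ → ℝ} {T t : ℝ} {ζ : ℝ → ℕ → ℝ} {ψ : ℝ → ℝ} {φ : ℕ → ℝ × ℝ → ℝ≥0} {k : ℕ}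

theorem Admissible.measurable_rk_projIcc (h : Admissible p T ζ ψ) (hT : 0 ≤ T)
    (hp : Summable fun k : ℕ => (k : ℝ) * p k) (k : ℕ) :
    Measurable fun t => rk (ζ (projIcc 0 T hT t)) k := by
  have hmem : ∀ t, (projIcc 0 T hT t : ℝ) ∈ Icc 0 T := fun t => (projIcc 0 T hT t).2
  have hproj : Continuous fun t => (projIcc 0 T hT t : ℝ) :=
    continuous_subtype_val.comp continuous_projIcc
  have hcoord : ∀ k, Continuous fun t => ζ (projIcc 0 T hT t) k := fun k =>
    (continuousOn_pi.1 h.cont_ζ k).comp_continuous hproj hmem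
  have hr : Continuous fun t => r (ζ (projIcc 0 T hT t)) := by
    have htsum := (h.absCont_tsum hT hp).continuousOn
    rw [uIcc_of_le hT] at htsum
    exact ((hcoord 0).add (htsum.comp_continuous hproj hmem)).congr fun t => (h.r_eq (hmem t)).symm
  simp only [rk, h.summable hp (hmem _), true_and]
  refine Measurable.ite (measurableSet_lt measurable_const hr.measurable) ?_ measurable_const
  refine Measurable.div ?_ hr.measurable
  split_ifs
  · exact ((hcoord 0).max continuous_const).measurable
  · exact ((hcoord k).const_mul (k : ℝ)).measurable

theorem rate_projIcc (hT : 0 ≤ T) (ζ : ℝ → ℕ → ℝ) (φ : ℕ → ℝ × ℝ → ℝ≥0) (k : ℕ)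
    (ht : t ∈ Icc 0 T) : rate (fun s => ζ (projIcc 0 T hT s)) φ k t = rate ζ φ k t := by
  simp only [rate, projIcc_of_mem hT ht]

theorem Admissible.aemeasurable_rate (h : Admissible p T ζ ψ) (hT : 0 ≤ T)
    (hp : Summable fun k : ℕ => (k : ℝ) * p k) (hφ : Measurable (φ k)) :
    AEMeasurable (rate ζ φ k) (volume.restrict (Icc 0 T)) :=
  ⟨_, measurable_rate (h.measurable_rk_projIcc hT hp k) hφ,
    (ae_restrict_iff' measurableSet_Icc).2
      (.of_forall fun _ ht => (rate_projIcc hT ζ φ k ht).symm)⟩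

theorem Admissible.flow_eq_lintegral_rate (h : Admissible p T ζ ψ)
    (hp : Summable fun k : ℕ => (k : ℝ) * p k) (hφ : Measurable (φ k)) (ht : t ∈ Icc 0 T) :
    flow ζ φ k t = ∫⁻ s in Icc 0 t, rate ζ φ k s := by
  have hT : 0 ≤ T := ht.1.trans ht.2
  calc flow ζ φ k t = flow (fun s => ζ (projIcc 0 T hT s)) φ k t :=
        setLIntegral_congr_fun (measurableSet_Icc.prod measurableSet_Icc) fun q hq => by
          simp only [indicator, mem_ofPred_eq, projIcc_of_mem hT ⟨hq.1.1, hq.1.2.trans ht.2⟩]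
    _ = ∫⁻ s in Icc 0 t, rate (fun s => ζ (projIcc 0 T hT s)) φ k s :=
        setLIntegral_prod_Icc (measurable_flow_integrand (h.measurable_rk_projIcc hT hp k) hφ) 0 t
    _ = ∫⁻ s in Icc 0 t, rate ζ φ k s :=
        setLIntegral_congr_fun measurableSet_Icc fun s hs =>
          rate_projIcc hT ζ φ k ⟨hs.1, hs.2.trans ht.2⟩

end ClampedPath

/-! ### The cost of a control dominates the cost of its path -/

theorem ae_hasDerivAt_of_eq_toReal_lintegral {f : ℝ → ℝ≥0∞} {F : ℝ → ℝ} {a b C : ℝ}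
    (hab : a ≤ b) (hf : AEMeasurable f (volume.restrict (Ioc a b)))
    (hfin : ∫⁻ s in Ioc a b, f s ≠ ⊤)
    (hF : ∀ t ∈ Icc a b, F t = C + (∫⁻ s in Ioc a t, f s).toReal) :
    ∀ᵐ t, t ∈ Ioo a b → HasDerivAt F (f t).toReal t := by
  refine ae_hasDerivAt_of_eq_integral (C := C) ?_ fun t ht => ?_
  · rw [intervalIntegrable_iff_integrableOn_Ioc_of_le hab]
    exact integrable_toReal_of_lintegral_ne_top hf hfin
  · have hsub : Ioc a t ⊆ Ioc a b := Ioc_subset_Ioc_right ht.2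
    have hft := hf.mono_measure (Measure.restrict_mono_set volume hsub)
    rw [hF t ht, intervalIntegral.integral_of_le ht.1, integral_toReal hft
      (ae_lt_top' hft (ne_top_of_le_ne_top hfin (lintegral_mono_set hsub)))]

section NuOfHasSum

variable {b f : ℕ → ℝ} (hf : HasSum f 1) (hb : ∀ k, 1 ≤ k → b k = -f k)
include hf hb

theorem hasSum_succ_of_eq_neg : HasSum (fun k => b (k + 1)) (f 0 - 1) := by
  have hsucc := ((hasSum_nat_add_iff' 1).2 hf).neg
  rw [Finset.sum_range_one, neg_sub] at hsucc
  exact hsucc.congr_fun fun k => hb (k + 1) (by lia)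

theorem nu_eq_of_eq_neg (k : ℕ) : nu b k = f k := by
  rcases Nat.eq_zero_or_pos k with rfl | hk
  · rw [nu, if_pos rfl, (hasSum_succ_of_eq_neg hf hb).tsum_eq, add_sub_cancel]
  · rw [nu, if_neg hk.ne', hb k hk, neg_neg]

theorem subVelocity_of_eq_neg (hf0 : ∀ k, 0 ≤ f k) : SubVelocity b := by
  have hsum := hasSum_succ_of_eq_neg hf hb
  refine subVelocity_of_neg_one_le (fun k hk => ?_) hsum.summable ?_
  · rw [hb k hk]
    exact neg_nonpos.2 (hf0 k)
  · rw [hsum.tsum_eq]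
    linarith [hf0 0]

end NuOfHasSum

section RatesOfControl

variable {p : ℕ → ℝ} {T s t : ℝ} {ζ : ℝ → ℕ → ℝ} {ψ : ℝ → ℝ} {φ : ℕ → ℝ × ℝ → ℝ≥0}

theorem Admissible.flow_add_lintegral_rate (h : Admissible p T ζ ψ)
    (hp : Summable fun k : ℕ => (k : ℝ) * p k) {k : ℕ} (hφ : Measurable (φ k)) (hs : 0 ≤ s)
    (hst : s ≤ t) (ht : t ≤ T) :
    flow ζ φ k s + ∫⁻ u in Ioc s t, rate ζ φ k u = flow ζ φ k t := by
  have hdisj : Disjoint (Icc 0 s) (Ioc s t) :=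
    Set.disjoint_left.2 fun u hu hu' => hu'.1.not_ge hu.2
  rw [h.flow_eq_lintegral_rate hp hφ ⟨hs, hst.trans ht⟩,
    h.flow_eq_lintegral_rate hp hφ ⟨hs.trans hst, ht⟩, ← lintegral_union measurableSet_Ioc hdisj,
    Icc_union_Ioc_eq_Icc hs hst]

theorem IsControl.lintegral_rate_eq (hφ : IsControl p T ζ ψ φ) (h : Admissible p T ζ ψ)
    (hp : Summable fun k : ℕ => (k : ℝ) * p k) (k : ℕ) (hs : 0 ≤ s) (hst : s ≤ t) (ht : t ≤ T) :
    ∫⁻ u in Ioc s t, rate ζ φ k u =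
      ENNReal.ofReal ((flow ζ φ k t).toReal - (flow ζ φ k s).toReal) := by
  have hadd := h.flow_add_lintegral_rate hp (hφ.meas k) hs hst ht
  have hfin := ENNReal.add_ne_top.1 (hadd ▸ hφ.finite k t ⟨hs.trans hst, ht⟩)
  rw [← hadd, ENNReal.toReal_add hfin.1 hfin.2, add_sub_cancel_left, ENNReal.ofReal_toReal hfin.2]

theorem IsControl.flow_mono (hφ : IsControl p T ζ ψ φ) (h : Admissible p T ζ ψ)
    (hp : Summable fun k : ℕ => (k : ℝ) * p k) (k : ℕ) (hs : 0 ≤ s) (hst : s ≤ t) (ht : t ≤ T) :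
    (flow ζ φ k s).toReal ≤ (flow ζ φ k t).toReal :=
  ENNReal.toReal_mono (hφ.finite k t ⟨hs.trans hst, ht⟩)
    (h.flow_add_lintegral_rate hp (hφ.meas k) hs hst ht ▸ le_self_add)

theorem IsControl.aemeasurable_rate (hφ : IsControl p T ζ ψ φ) (h : Admissible p T ζ ψ)
    (hp : Summable fun k : ℕ => (k : ℝ) * p k) (k : ℕ) (hs : 0 ≤ s) (hst : s ≤ T) :
    AEMeasurable (rate ζ φ k) (volume.restrict (Ioc s T)) :=
  (h.aemeasurable_rate (hs.trans hst) hp (hφ.meas k)).mono_measure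
    (Measure.restrict_mono_set volume fun _ hu => ⟨hs.trans hu.1.le, hu.2⟩)

end RatesOfControl

section PathCost

variable {p x₁ x₂ : ℕ → ℝ} {t₁ t₂ t : ℝ} {w : (ℝ → ℕ → ℝ) × (ℝ → ℝ)} {φ : ℕ → ℝ × ℝ → ℝ≥0}

theorem hasSum_flow_sub (hp : Summable fun k : ℕ => (k : ℝ) * p k) (ht₁ : 0 ≤ t₁)
    (ht₁₂ : t₁ < t₂) (hw : w ∈ J2 p t₁ t₂ x₁ x₂) (hφ : IsControl p t₂ w.1 w.2 φ)
    (ht : t ∈ Icc t₁ t₂) :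
    HasSum (fun k => (flow w.1 φ k t).toReal - (flow w.1 φ k t₁).toReal) (t - t₁) := by
  obtain ⟨hadm, hleft, -⟩ := hw.1.1
  have hT : t ∈ Icc 0 t₂ := ⟨ht₁.trans ht.1, ht.2⟩
  have hT₁ : t₁ ∈ Icc 0 t₂ := ⟨ht₁, ht₁₂.le⟩
  have hdecr := (descendingPath_of_mem_J2 hp ht₁ ht₁₂ hw).hasSum_decrease
    (hleft ▸ hadm.summable hp hT₁) ht
  have hψ := (hφ.eq_ψ t hT).sub (hφ.eq_ψ t₁ hT₁)
  have hhalf := (hdecr.sub hψ).div_const 2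
  rw [zero_eq_of_mem_J1 ht₁ ht₁₂ hw.1 ht, show (w.2 t - w.2 t₁ + x₁ 0 - x₁ 0 + 2 * (t - t₁) -
    (w.2 t - w.2 t₁)) / 2 = t - t₁ by ring] at hhalf
  refine hhalf.congr_fun fun k => ?_
  rcases Nat.eq_zero_or_pos k with rfl | hk
  · rw [Nat.cast_zero]
    ring
  · rw [← hleft, hφ.eq_ζ k hk t hT, hφ.eq_ζ k hk t₁ hT₁]
    ring

theorem lintegral_tsum_rate (hp : Summable fun k : ℕ => (k : ℝ) * p k) (ht₁ : 0 ≤ t₁)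
    (ht₁₂ : t₁ < t₂) (hw : w ∈ J2 p t₁ t₂ x₁ x₂) (hφ : IsControl p t₂ w.1 w.2 φ)
    (ht : t ∈ Icc t₁ t₂) :
    ∫⁻ s in Ioc t₁ t, ∑' k, rate w.1 φ k s = ENNReal.ofReal (t - t₁) := by
  have hadm := hw.1.1.1
  have hsum := hasSum_flow_sub hp ht₁ ht₁₂ hw hφ ht
  have hmeas : ∀ k, AEMeasurable (rate w.1 φ k) (volume.restrict (Ioc t₁ t)) := fun k =>
    (hφ.aemeasurable_rate hadm hp k ht₁ ht₁₂.le).mono_measure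
      (Measure.restrict_mono_set volume (Ioc_subset_Ioc_right ht.2))
  rw [lintegral_tsum hmeas, ← hsum.tsum_eq, ENNReal.ofReal_tsum_of_nonneg
    (fun k => sub_nonneg.2 (hφ.flow_mono hadm hp k ht₁ ht.1 ht.2)) hsum.summable]
  exact tsum_congr fun k => hφ.lintegral_rate_eq hadm hp k ht₁ ht.1 ht.2

theorem ae_tsum_rate_eq_one (hp : Summable fun k : ℕ => (k : ℝ) * p k) (ht₁ : 0 ≤ t₁)
    (ht₁₂ : t₁ < t₂) (hw : w ∈ J2 p t₁ t₂ x₁ x₂) (hφ : IsControl p t₂ w.1 w.2 φ) :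
    ∀ᵐ s, s ∈ Ioo t₁ t₂ → ∑' k, rate w.1 φ k s = 1 := by
  have hint : ∀ t ∈ Icc t₁ t₂, ∫⁻ s in Ioc t₁ t, ∑' k, rate w.1 φ k s = ENNReal.ofReal (t - t₁) :=
    fun t ht => lintegral_tsum_rate hp ht₁ ht₁₂ hw hφ ht
  have hderiv := ae_hasDerivAt_of_eq_toReal_lintegral (F := fun t => t - t₁) (C := 0) ht₁₂.le
    (AEMeasurable.tsum fun k => hφ.aemeasurable_rate hw.1.1.1 hp k ht₁ ht₁₂.le)
    (hint t₂ ⟨ht₁₂.le, le_rfl⟩ ▸ ENNReal.ofReal_ne_top) fun t ht => by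
      rw [hint t ht, ENNReal.toReal_ofReal (sub_nonneg.2 ht.1), zero_add]
  filter_upwards [hderiv] with s hs hmem
  have hone : (∑' k, rate w.1 φ k s).toReal = 1 :=
    (hs hmem).unique ((hasDerivAt_id s).sub_const t₁)
  rwa [ENNReal.toReal_eq_one_iff] at hone

theorem IsControl.ae_velocity_eq (hp : Summable fun k : ℕ => (k : ℝ) * p k) (ht₁ : 0 ≤ t₁)
    (ht₁₂ : t₁ ≤ t₂) (h : Admissible p t₂ w.1 w.2) (hφ : IsControl p t₂ w.1 w.2 φ) :
    ∀ᵐ s, s ∈ Ioo t₁ t₂ → ∀ k, 1 ≤ k → velocity w.1 s k = -(rate w.1 φ k s).toReal := by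
  suffices ∀ k, ∀ᵐ s, 1 ≤ k → s ∈ Ioo t₁ t₂ →
      HasDerivAt (fun u => -w.1 u k) (rate w.1 φ k s).toReal s by
    filter_upwards [ae_all_iff.2 this] with s hs hmem k hk
    rw [← (hs k hk hmem).deriv, deriv.fun_neg, neg_neg]
    rfl
  intro k
  by_cases hk : 1 ≤ k
  · have hint : ∀ t ∈ Icc t₁ t₂, ∫⁻ s in Ioc t₁ t, rate w.1 φ k s =
        ENNReal.ofReal (w.1 t₁ k - w.1 t k) := fun t ht => by
      rw [hφ.lintegral_rate_eq h hp k ht₁ ht.1 ht.2, hφ.eq_ζ k hk t ⟨ht₁.trans ht.1, ht.2⟩,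
        hφ.eq_ζ k hk t₁ ⟨ht₁, ht₁₂⟩, sub_sub_sub_cancel_left]
    filter_upwards [ae_hasDerivAt_of_eq_toReal_lintegral (F := fun u => -w.1 u k)
      (C := -w.1 t₁ k) ht₁₂ (hφ.aemeasurable_rate h hp k ht₁ ht₁₂)
      (hint t₂ ⟨ht₁₂, le_rfl⟩ ▸ ENNReal.ofReal_ne_top) fun t ht => by
        rw [hint t ht, ENNReal.toReal_ofReal (sub_nonneg.2 (h.ζ_anti k hk ⟨ht₁, ht₁₂⟩
          ⟨ht₁.trans ht.1, ht.2⟩ ht.1))]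
        ring] with s hs _ using hs
  · exact .of_forall fun s hk' => absurd hk' hk

theorem LCost_le_pathCost (hp : Summable fun k : ℕ => (k : ℝ) * p k) (ht₁ : 0 ≤ t₁)
    (ht₁₂ : t₁ < t₂) (hw : w ∈ J2 p t₁ t₂ x₁ x₂) :
    LCost t₁ t₂ w.1 ≤ (pathCost p t₁ t₂ w.1 w.2 : EReal) := by
  obtain ⟨hadm, hleft, -⟩ := hw.1.1
  have hpath := descendingPath_of_mem_J2 hp ht₁ ht₁₂ hw
  have hx₁ : Summable fun k : ℕ => (k : ℝ) * x₁ k := hleft ▸ hadm.summable hp ⟨ht₁, ht₁₂.le⟩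
  rw [hpath.LCost_eq hx₁, EReal.coe_ennreal_le_coe_ennreal_iff, pathCost]
  refine le_iInf₂ fun φ hφ => ?_
  rw [controlCost_eq hφ.meas, ← Measure.restrict_congr_set (Ioo_ae_eq_Icc (a := t₁) (b := t₂))]
  refine lintegral_mono_ae ((ae_restrict_iff' measurableSet_Ioo).2 ?_)
  filter_upwards [ae_tsum_rate_eq_one hp ht₁ ht₁₂ hw hφ, hφ.ae_velocity_eq hp ht₁ ht₁₂.le hadm]
    with s hone hvel hs
  have hfin : ∀ k, rate w.1 φ k s ≠ ⊤ := ENNReal.ne_top_of_tsum_ne_top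
    (hone hs ▸ ENNReal.one_ne_top)
  have hrates : HasSum (fun k => (rate w.1 φ k s).toReal) 1 := by
    have hsum := ENNReal.hasSum_toReal (hone hs ▸ ENNReal.one_ne_top)
    rwa [← ENNReal.tsum_toReal_eq hfin, hone hs, ENNReal.toReal_one] at hsum
  rw [hpath.L_eq hx₁ hs (subVelocity_of_eq_neg hrates (hvel hs) fun k => ENNReal.toReal_nonneg),
    EReal.toENNReal_coe]
  refine ENNReal.tsum_le_tsum fun k => ?_
  rw [nu_eq_of_eq_neg hrates (hvel hs)]
  exact klTerm_rate_le (hφ.meas k)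
    (fun k hk => hadm.ζ_nonneg k hk s ⟨ht₁.trans hs.1.le, hs.2.le⟩) (hfin k)

end PathCost

/-! ### The velocity and the cost of the explicit path -/

/-- The rates `ν(k | ζ̃'(t))` of the explicit path. -/
def optRate (t₁ : ℝ) (x₁ x₂ : ℕ → ℝ) (β t : ℝ) (k : ℕ) : ℝ :=
  (if k = 0 then optPath t₁ x₁ x₂ β t 0
    else (k : ℝ) * zTilde x₁ x₂ β k * timeLeft t₁ x₁ x₂ β t ^ ((k : ℝ) / 2)) /
  (2 * sigmaTilde x₁ x₂ β * timeLeft t₁ x₁ x₂ β t)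

theorem measurable_timeLeft (t₁ : ℝ) (x₁ x₂ : ℕ → ℝ) (β : ℝ) :
    Measurable (timeLeft t₁ x₁ x₂ β) := by
  unfold timeLeft
  fun_prop

theorem hasDerivAt_timeLeft (t₁ : ℝ) (x₁ x₂ : ℕ → ℝ) (β t : ℝ) :
    HasDerivAt (timeLeft t₁ x₁ x₂ β) (-(1 / sigmaTilde x₁ x₂ β)) t := by
  simpa using! (((hasDerivAt_id t).sub_const t₁).div_const (sigmaTilde x₁ x₂ β)).const_sub 1

theorem measurable_optPath (t₁ : ℝ) (x₁ x₂ : ℕ → ℝ) (β : ℝ) (k : ℕ) :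
    Measurable fun t => optPath t₁ x₁ x₂ β t k := by
  have hw := measurable_timeLeft t₁ x₁ x₂ β
  simp only [optPath]
  split_ifs
  · exact Measurable.sub (by fun_prop) (Measurable.tsum fun j => by fun_prop)
  · fun_prop

theorem measurable_optRate (t₁ : ℝ) (x₁ x₂ : ℕ → ℝ) (β : ℝ) (k : ℕ) :
    Measurable fun t => optRate t₁ x₁ x₂ β t k := by
  have hw := measurable_timeLeft t₁ x₁ x₂ β
  unfold optRate
  refine Measurable.div ?_ (by fun_prop)
  split_ifs
  · exact measurable_optPath t₁ x₁ x₂ β 0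
  · fun_prop

theorem DescendingPath.rk_eq {x₁ x₂ : ℕ → ℝ} {a b t : ℝ} {ζ : ℝ → ℕ → ℝ}
    (h : DescendingPath x₁ x₂ a b ζ) (hx₁ : Summable fun k : ℕ => (k : ℝ) * x₁ k)
    (ht : t ∈ Ico a b) (k : ℕ) :
    rk (ζ t) k = (if k = 0 then ζ t 0 else (k : ℝ) * ζ t k) / (r x₁ - 2 * (t - a)) := by
  have ht' := Ico_subset_Icc_self ht
  rw [← h.r_eq t ht']
  exact ConfigModel.rk_eq (h.zero_nonneg t ht') (h.summable hx₁ ht') (h.r_pos ht) k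

namespace Endpoints

variable {x₁ x₂ : ℕ → ℝ} {β : ℝ} (h : Endpoints x₁ x₂ β) {t₁ t : ℝ} {k : ℕ}
include h

theorem hasDerivAt_optPath (hk : 1 ≤ k) (ht : t < t₁ + varsig x₁ x₂) :
    HasDerivAt (fun u => optPath t₁ x₁ x₂ β u k) (-optRate t₁ x₁ x₂ β t k) t := by
  have hw := h.timeLeft_pos ht
  have hσ := h.sigmaTilde_pos
  simp only [optPath_of_pos _ _ _ _ _ hk]
  have hderiv := ((((hasDerivAt_timeLeft t₁ x₁ x₂ β t).rpow_const (p := (k : ℝ) / 2)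
    (.inl hw.ne')).const_sub 1).const_mul (zTilde x₁ x₂ β k)).const_sub (x₁ k)
  convert! hderiv using 1
  rw [optRate, if_neg (by lia), Real.rpow_sub_one hw.ne']
  field_simp

theorem velocity_optPath (hk : 1 ≤ k) (ht : t < t₁ + varsig x₁ x₂) :
    velocity (optPath t₁ x₁ x₂ β) t k = -optRate t₁ x₁ x₂ β t k :=
  (h.hasDerivAt_optPath hk ht).deriv

theorem optRate_nonneg (ht : t ∈ Ico t₁ (t₁ + varsig x₁ x₂)) (k : ℕ) :
    0 ≤ optRate t₁ x₁ x₂ β t k := by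
  have hw := h.timeLeft_pos ht.2
  have hσ := h.sigmaTilde_pos
  have hz := h.zTilde_nonneg k
  have hzero := h.optPath_zero_nonneg (Ico_subset_Icc_self ht)
  unfold optRate
  split_ifs <;> positivity

theorem hasSum_optRate (ht : t ∈ Ico t₁ (t₁ + varsig x₁ x₂)) :
    HasSum (optRate t₁ x₁ x₂ β t) 1 := by
  have hw := h.timeLeft_pos ht.2
  have hσ := h.sigmaTilde_pos
  have hsum := ((hasSum_ite_eq (0 : ℕ) (optPath t₁ x₁ x₂ β t 0)).add (h.hasSum_zTilde_rpow
    (Ico_subset_Icc_self ht))).div_const (2 * sigmaTilde x₁ x₂ β * timeLeft t₁ x₁ x₂ β t)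
  rw [add_sub_cancel, div_self (by positivity)] at hsum
  refine hsum.congr_fun fun k => ?_
  unfold optRate
  by_cases hk : k = 0 <;> simp [hk]

theorem subVelocity_optPath (ht : t ∈ Ico t₁ (t₁ + varsig x₁ x₂)) :
    SubVelocity (velocity (optPath t₁ x₁ x₂ β) t) :=
  subVelocity_of_eq_neg (h.hasSum_optRate ht) (fun _ hk => h.velocity_optPath hk ht.2)
    (h.optRate_nonneg ht)

theorem nu_velocity_optPath (ht : t ∈ Ico t₁ (t₁ + varsig x₁ x₂)) (k : ℕ) :
    nu (velocity (optPath t₁ x₁ x₂ β) t) k = optRate t₁ x₁ x₂ β t k :=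
  nu_eq_of_eq_neg (h.hasSum_optRate ht) (fun _ hk => h.velocity_optPath hk ht.2) k

theorem LCost_optPath :
    LCost t₁ (t₁ + varsig x₁ x₂) (optPath t₁ x₁ x₂ β) =
      ((∫⁻ t in Ioo t₁ (t₁ + varsig x₁ x₂), ∑' k,
        klTerm (optRate t₁ x₁ x₂ β t k) (rk (optPath t₁ x₁ x₂ β t) k) : ℝ≥0∞) : EReal) := by
  rw [h.descendingPath_optPath.LCost_eq h.summable₁]
  refine congrArg _ (setLIntegral_congr_fun measurableSet_Ioo fun t ht => ?_)
  have ht' := Ioo_subset_Ico_self ht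
  simp only [h.descendingPath_optPath.L_eq h.summable₁ ht (h.subVelocity_optPath ht'),
    EReal.toENNReal_coe, h.nu_velocity_optPath ht']

theorem LCost_tilde {p : ℕ → ℝ} (hp : Summable fun k : ℕ => (k : ℝ) * p k)
    {ζs : ℝ → ℕ → ℝ} {ψs : ℝ → ℝ} (ht₁ : 0 ≤ t₁) (hs : (ζs, ψs) ∈ J0 p 0 t₁ p x₁) :
    LCost t₁ (t₁ + varsig x₁ x₂) (tildeζ t₁ x₁ x₂ β ζs) =
      LCost t₁ (t₁ + varsig x₁ x₂) (optPath t₁ x₁ x₂ β) := by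
  have htilde := descendingPath_of_mem_J2 hp ht₁ (lt_add_of_pos_right t₁ h.varsig_pos)
    (h.tilde_mem_J2 ht₁ hs)
  rw [htilde.LCost_eq h.summable₁, h.descendingPath_optPath.LCost_eq h.summable₁]
  refine congrArg _ (setLIntegral_congr_fun measurableSet_Ioo fun t ht => ?_)
  have hvel : velocity (tildeζ t₁ x₁ x₂ β ζs) t = velocity (optPath t₁ x₁ x₂ β) t := by
    ext k
    refine Filter.EventuallyEq.deriv_eq ?_
    filter_upwards [Ioo_mem_nhds ht.1 ht.2] with s hmem
    rw [h.tildeζ_eq hs.2.2 (Ioo_subset_Icc_self hmem)]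
  simp only [hvel, h.tildeζ_eq hs.2.2 (Ioo_subset_Icc_self ht)]

theorem optPath_pos (hk : 1 ≤ k) (hz : 0 < zTilde x₁ x₂ β k)
    (ht : t < t₁ + varsig x₁ x₂) : 0 < optPath t₁ x₁ x₂ β t k := by
  have hpow : β ^ k < timeLeft t₁ x₁ x₂ β t ^ ((k : ℝ) / 2) := by
    rw [← rpow_half_sq h.beta_nonneg]
    exact Real.rpow_lt_rpow (sq_nonneg β) (h.sq_lt_timeLeft ht) (by positivity)
  have hpath : optPath t₁ x₁ x₂ β t k =
      x₂ k + zTilde x₁ x₂ β k * (timeLeft t₁ x₁ x₂ β t ^ ((k : ℝ) / 2) - β ^ k) := by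
    rw [optPath_of_pos _ _ _ _ _ hk]
    linear_combination -h.zTilde_mul hk
  rw [hpath]
  exact add_pos_of_nonneg_of_pos (h.nonneg₂ k hk) (mul_pos hz (sub_pos.2 hpow))

theorem optRate_eq_zero (ht : t ∈ Ico t₁ (t₁ + varsig x₁ x₂))
    (hr : rk (optPath t₁ x₁ x₂ β t) k = 0) : optRate t₁ x₁ x₂ β t k = 0 := by
  have hpos := h.descendingPath_optPath.r_pos ht
  rw [h.r_optPath (Ico_subset_Icc_self ht)] at hpos
  rw [h.descendingPath_optPath.rk_eq h.summable₁ ht, div_eq_zero_iff, or_iff_left hpos.ne'] at hr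
  rw [optRate, div_eq_zero_iff]
  left
  rcases Nat.eq_zero_or_pos k with rfl | hk
  · exact hr
  · rw [if_neg hk.ne', mul_eq_zero, or_iff_right (mod_cast hk.ne')] at hr
    have hz : zTilde x₁ x₂ β k = 0 := by
      by_contra hne
      exact (h.optPath_pos hk ((h.zTilde_nonneg k).lt_of_ne' hne) ht.2).ne' hr
    rw [if_neg hk.ne', hz, mul_zero, zero_mul]

end Endpoints

/-! ### The optimal control of the explicit path -/

/-- The cheapest function of `y ∈ [0, 1]` whose integral over `[0, m)` is `a`. -/
def stepControl (m a y : ℝ) : ℝ≥0 := if y < m then (a / m).toNNReal else 1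

theorem measurable_stepControl :
    Measurable fun q : ℝ × ℝ × ℝ => stepControl q.1 q.2.1 q.2.2 := by
  unfold stepControl
  refine Measurable.ite (measurableSet_lt ?_ ?_) ?_ measurable_const <;> fun_prop

theorem setLIntegral_stepControl {m a : ℝ} (hm : 0 ≤ m) (ha : 0 ≤ a) (hma : m = 0 → a = 0) :
    ∫⁻ y in Ico 0 m, (stepControl m a y : ℝ≥0∞) = ENNReal.ofReal a := by
  have hconst : ∫⁻ y in Ico 0 m, (stepControl m a y : ℝ≥0∞) =
      ENNReal.ofReal (a / m) * ENNReal.ofReal m := by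
    rw [setLIntegral_congr_fun (g := fun _ => ENNReal.ofReal (a / m)) measurableSet_Ico
      fun y hy => by simp only [stepControl, if_pos hy.2, ENNReal.ofReal]]
    simp
  rw [hconst, ← ENNReal.ofReal_mul (div_nonneg ha hm), div_mul_cancel_of_imp hma]

theorem setLIntegral_ell_stepControl {m a : ℝ} (hm : m ∈ Icc 0 1) (ha : 0 ≤ a)
    (hma : m = 0 → a = 0) :
    ∫⁻ y in Icc (0 : ℝ) 1, ENNReal.ofReal (ell (stepControl m a y)) = klTerm a m := by
  have hquot : 0 ≤ a / m := div_nonneg ha hm.1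
  have hstep : ∀ y : ℝ, ENNReal.ofReal (ell (stepControl m a y)) =
      (Iio m).indicator (fun _ => ENNReal.ofReal (ell (a / m))) y := fun y => by
    by_cases hy : y < m <;> simp [stepControl, hy, hquot, ell]
  simp_rw [hstep]
  rw [klTerm_eq_ofReal hma, ellPersp, ENNReal.ofReal_mul hm.1, mul_comm,
    setLIntegral_indicator measurableSet_Iio, Iio_inter_Icc_of_le hm.2]
  simp

/-- The proportions `r_k(ζ̃(t))` of the explicit path. -/
def optMass (t₁ : ℝ) (x₁ x₂ : ℕ → ℝ) (β t : ℝ) (k : ℕ) : ℝ :=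
  (if k = 0 then optPath t₁ x₁ x₂ β t 0 else (k : ℝ) * optPath t₁ x₁ x₂ β t k) /
    (r x₁ - 2 * (t - t₁))

/-- The control that follows `φ` up to time `t₁` and drives the explicit path afterwards. -/
def optControl (t₁ : ℝ) (x₁ x₂ : ℕ → ℝ) (β : ℝ) (φ : ℕ → ℝ × ℝ → ℝ≥0) (k : ℕ) (q : ℝ × ℝ) :
    ℝ≥0 :=
  if q.1 ≤ t₁ then φ k q
  else stepControl (optMass t₁ x₁ x₂ β q.1 k) (optRate t₁ x₁ x₂ β q.1 k) q.2

section

variable {t₁ t : ℝ} {k : ℕ} {φ : ℕ → ℝ × ℝ → ℝ≥0}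

theorem measurable_optMass (t₁ : ℝ) (x₁ x₂ : ℕ → ℝ) (β : ℝ) (k : ℕ) :
    Measurable fun t => optMass t₁ x₁ x₂ β t k := by
  unfold optMass
  refine Measurable.div ?_ (by fun_prop)
  split_ifs
  · exact measurable_optPath t₁ x₁ x₂ β 0
  · exact (measurable_optPath t₁ x₁ x₂ β k).const_mul _

theorem measurable_optControl (t₁ : ℝ) (x₁ x₂ : ℕ → ℝ) (β : ℝ) (hφ : Measurable (φ k)) :
    Measurable (optControl t₁ x₁ x₂ β φ k) := by
  have hm := measurable_optMass t₁ x₁ x₂ β k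
  have ha := measurable_optRate t₁ x₁ x₂ β k
  exact Measurable.ite (measurableSet_le measurable_fst measurable_const) hφ
    (measurable_stepControl.comp
      ((hm.comp measurable_fst).prodMk ((ha.comp measurable_fst).prodMk measurable_snd)))

theorem flow_optControl_of_le (x₁ x₂ : ℕ → ℝ) (β : ℝ) (ζs : ℝ → ℕ → ℝ)
    (φ : ℕ → ℝ × ℝ → ℝ≥0) (k : ℕ) (ht : t ≤ t₁) :
    flow (tildeζ t₁ x₁ x₂ β ζs) (optControl t₁ x₁ x₂ β φ) k t = flow ζs φ k t := by
  refine setLIntegral_congr_fun (measurableSet_Icc.prod measurableSet_Icc) fun q hq => ?_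
  have hq₁ : q.1 ≤ t₁ := hq.1.2.trans ht
  simp only [indicator, mem_ofPred_eq, tildeζ_of_le _ _ _ _ hq₁, optControl, if_pos hq₁]

end

namespace Endpoints

variable {p x₁ x₂ : ℕ → ℝ} {β : ℝ} (h : Endpoints x₁ x₂ β) {t₁ t : ℝ} {k : ℕ}
  {ζs : ℝ → ℕ → ℝ} {ψs : ℝ → ℝ} {φ : ℕ → ℝ × ℝ → ℝ≥0}
include h

theorem rk_optPath (ht : t ∈ Ico t₁ (t₁ + varsig x₁ x₂)) (k : ℕ) :
    rk (optPath t₁ x₁ x₂ β t) k = optMass t₁ x₁ x₂ β t k :=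
  h.descendingPath_optPath.rk_eq h.summable₁ ht k

theorem optMass_mem (ht : t ∈ Ico t₁ (t₁ + varsig x₁ x₂)) (k : ℕ) :
    optMass t₁ x₁ x₂ β t k ∈ Icc 0 1 := by
  have hnonneg : ∀ j, 1 ≤ j → 0 ≤ optPath t₁ x₁ x₂ β t j :=
    fun j hj => h.optPath_nonneg hj (Ico_subset_Icc_self ht)
  rw [← h.rk_optPath ht]
  exact ⟨rk_nonneg hnonneg k, rk_le_one hnonneg k⟩

theorem rate_optControl (hx₁ : ζs t₁ = x₁) (ht : t ∈ Ioo t₁ (t₁ + varsig x₁ x₂)) (k : ℕ) :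
    rate (tildeζ t₁ x₁ x₂ β ζs) (optControl t₁ x₁ x₂ β φ) k t =
      ENNReal.ofReal (optRate t₁ x₁ x₂ β t k) := by
  have ht' := Ioo_subset_Ico_self ht
  have htilde := h.tildeζ_eq hx₁ (Ioo_subset_Icc_self ht)
  rw [rate_eq_setLIntegral_Ico fun j hj => by
    rw [htilde]; exact h.optPath_nonneg hj (Ioo_subset_Icc_self ht), htilde, h.rk_optPath ht']
  simp only [optControl, if_neg ht.1.not_ge]
  exact setLIntegral_stepControl (h.optMass_mem ht' k).1 (h.optRate_nonneg ht' k)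
    fun h0 => h.optRate_eq_zero ht' ((h.rk_optPath ht' k).trans h0)

theorem setLIntegral_ell_optControl (ht : t ∈ Ioo t₁ (t₁ + varsig x₁ x₂)) (k : ℕ) :
    ∫⁻ y in Icc (0 : ℝ) 1, ENNReal.ofReal (ell (optControl t₁ x₁ x₂ β φ k (t, y))) =
      klTerm (optRate t₁ x₁ x₂ β t k) (rk (optPath t₁ x₁ x₂ β t) k) := by
  have ht' := Ioo_subset_Ico_self ht
  simp only [optControl, if_neg ht.1.not_ge]
  rw [h.rk_optPath ht']
  exact setLIntegral_ell_stepControl (h.optMass_mem ht' k) (h.optRate_nonneg ht' k)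
    fun h0 => h.optRate_eq_zero ht' ((h.rk_optPath ht' k).trans h0)

theorem lintegral_optRate (hk : 1 ≤ k) (ht : t ∈ Icc t₁ (t₁ + varsig x₁ x₂)) :
    ∫⁻ s in Ioo t₁ t, ENNReal.ofReal (optRate t₁ x₁ x₂ β s k) =
      ENNReal.ofReal (x₁ k - optPath t₁ x₁ x₂ β t k) := by
  have hderiv := lintegral_deriv_of_monotoneOn ht.1
    (absCont_mono_right (h.optPath_absCont hk) ht).neg
    ((h.optPath_antitoneOn hk).mono (Icc_subset_Icc_right ht.2)).neg
  rw [← Measure.restrict_congr_set Ioo_ae_eq_Ioc, Pi.neg_apply, Pi.neg_apply, neg_sub_neg,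
    h.optPath_left] at hderiv
  rw [← hderiv]
  refine setLIntegral_congr_fun measurableSet_Ioo fun s hs => ?_
  rw [deriv.neg, (h.hasDerivAt_optPath hk (hs.2.trans_le ht.2)).deriv, neg_neg]

theorem tsum_lintegral_optRate (ht : t ∈ Icc t₁ (t₁ + varsig x₁ x₂)) :
    ∑' k, ∫⁻ s in Ioo t₁ t, ENNReal.ofReal (optRate t₁ x₁ x₂ β s k) =
      ENNReal.ofReal (t - t₁) := by
  have hmass : ∀ s ∈ Ioo t₁ t, ∑' k, ENNReal.ofReal (optRate t₁ x₁ x₂ β s k) = 1 := by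
    intro s hs
    have hs' : s ∈ Ico t₁ (t₁ + varsig x₁ x₂) := ⟨hs.1.le, hs.2.trans_le ht.2⟩
    have hsum := h.hasSum_optRate hs'
    rw [← ENNReal.ofReal_tsum_of_nonneg (h.optRate_nonneg hs') hsum.summable, hsum.tsum_eq,
      ENNReal.ofReal_one]
  rw [← lintegral_tsum fun k => (measurable_optRate t₁ x₁ x₂ β k).ennreal_ofReal.aemeasurable,
    setLIntegral_congr_fun measurableSet_Ioo hmass, setLIntegral_one, Real.volume_Ioo]

theorem lintegral_optRate_ne_top (ht : t ∈ Icc t₁ (t₁ + varsig x₁ x₂)) (k : ℕ) :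
    ∫⁻ s in Ioo t₁ t, ENNReal.ofReal (optRate t₁ x₁ x₂ β s k) ≠ ⊤ :=
  ENNReal.ne_top_of_tsum_ne_top (h.tsum_lintegral_optRate ht ▸ ENNReal.ofReal_ne_top) k

theorem hasSum_lintegral_optRate (ht : t ∈ Icc t₁ (t₁ + varsig x₁ x₂)) :
    HasSum (fun k => (∫⁻ s in Ioo t₁ t, ENNReal.ofReal (optRate t₁ x₁ x₂ β s k)).toReal)
      (t - t₁) := by
  have hsum := ENNReal.hasSum_toReal (h.tsum_lintegral_optRate ht ▸ ENNReal.ofReal_ne_top)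
  rwa [← ENNReal.tsum_toReal_eq (h.lintegral_optRate_ne_top ht), h.tsum_lintegral_optRate ht,
    ENNReal.toReal_ofReal (sub_nonneg.2 ht.1)] at hsum

theorem toReal_lintegral_optRate (hk : 1 ≤ k) (ht : t ∈ Icc t₁ (t₁ + varsig x₁ x₂)) :
    (∫⁻ s in Ioo t₁ t, ENNReal.ofReal (optRate t₁ x₁ x₂ β s k)).toReal =
      x₁ k - optPath t₁ x₁ x₂ β t k := by
  rw [h.lintegral_optRate hk ht, ENNReal.toReal_ofReal]
  exact sub_nonneg.2 (h.descendingPath_optPath.le_left hk ht)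

section Control

variable (hp : Summable fun k : ℕ => (k : ℝ) * p k) (ht₁ : 0 ≤ t₁)
  (hadm : Admissible p t₁ ζs ψs) (hx₁ : ζs t₁ = x₁)
include hp ht₁ hadm hx₁

theorem flow_optControl (hφ : Measurable (φ k)) (ht : t ∈ Icc t₁ (t₁ + varsig x₁ x₂)) :
    flow (tildeζ t₁ x₁ x₂ β ζs) (optControl t₁ x₁ x₂ β φ) k t =
      flow ζs φ k t₁ + ∫⁻ s in Ioo t₁ t, ENNReal.ofReal (optRate t₁ x₁ x₂ β s k) := by
  rw [← (h.admissible_tilde ht₁ hadm hx₁).flow_add_lintegral_rate hp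
    (measurable_optControl _ _ _ _ hφ) ht₁ ht.1 ht.2, flow_optControl_of_le _ _ _ _ _ _ le_rfl,
    ← Measure.restrict_congr_set (Ioo_ae_eq_Ioc (a := t₁) (b := t))]
  exact congrArg _ (setLIntegral_congr_fun measurableSet_Ioo fun s hs =>
    h.rate_optControl hx₁ ⟨hs.1, hs.2.trans_le ht.2⟩ k)

theorem toReal_flow_optControl (hφ : IsControl p t₁ ζs ψs φ)
    (ht : t ∈ Icc t₁ (t₁ + varsig x₁ x₂)) (k : ℕ) :
    (flow (tildeζ t₁ x₁ x₂ β ζs) (optControl t₁ x₁ x₂ β φ) k t).toReal =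
      (flow ζs φ k t₁).toReal +
        (∫⁻ s in Ioo t₁ t, ENNReal.ofReal (optRate t₁ x₁ x₂ β s k)).toReal := by
  rw [h.flow_optControl hp ht₁ hadm hx₁ (hφ.meas k) ht,
    ENNReal.toReal_add (hφ.finite k t₁ ⟨ht₁, le_rfl⟩) (h.lintegral_optRate_ne_top ht k)]

theorem hasSum_flow_optControl (hφ : IsControl p t₁ ζs ψs φ)
    (ht : t ∈ Icc t₁ (t₁ + varsig x₁ x₂)) :
    HasSum (fun k : ℕ => ((k : ℝ) - 2) *
      (flow (tildeζ t₁ x₁ x₂ β ζs) (optControl t₁ x₁ x₂ β φ) k t).toReal)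
      (tildeψ t₁ x₁ x₂ β ψs t) := by
  have hsum := ((hφ.eq_ψ t₁ ⟨ht₁, le_rfl⟩).add (h.hasSum_optPath_decrease ht)).sub
    ((h.hasSum_lintegral_optRate ht).mul_left 2)
  have hψ : tildeψ t₁ x₁ x₂ β ψs t =
      ψs t₁ + (optPath t₁ x₁ x₂ β t 0 - x₁ 0 + 2 * (t - t₁)) - 2 * (t - t₁) := by
    rw [h.tildeψ_eq _ ht]
    ring
  rw [hψ]
  refine hsum.congr_fun fun k => ?_
  rw [h.toReal_flow_optControl hp ht₁ hadm hx₁ hφ ht]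
  rcases Nat.eq_zero_or_pos k with rfl | hk
  · rw [Nat.cast_zero]
    ring
  · rw [← h.toReal_lintegral_optRate hk ht]
    ring

theorem isControl_optControl (hφ : IsControl p t₁ ζs ψs φ) :
    IsControl p (t₁ + varsig x₁ x₂) (tildeζ t₁ x₁ x₂ β ζs) (tildeψ t₁ x₁ x₂ β ψs)
      (optControl t₁ x₁ x₂ β φ) := by
  have ht₁' : t₁ ∈ Icc 0 t₁ := ⟨ht₁, le_rfl⟩
  refine ⟨fun k => measurable_optControl _ _ _ _ (hφ.meas k), fun k t ht => ?_, fun t ht => ?_,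
    fun k hk t ht => ?_⟩ <;> rcases le_total t t₁ with htt₁ | htt₁
  · rw [flow_optControl_of_le _ _ _ _ _ _ htt₁]
    exact hφ.finite k t ⟨ht.1, htt₁⟩
  · rw [h.flow_optControl hp ht₁ hadm hx₁ (hφ.meas k) ⟨htt₁, ht.2⟩]
    exact ENNReal.add_ne_top.2 ⟨hφ.finite k t₁ ht₁', h.lintegral_optRate_ne_top ⟨htt₁, ht.2⟩ k⟩
  · simp only [flow_optControl_of_le _ _ _ _ _ _ htt₁, tildeψ_of_le _ _ _ _ htt₁]
    exact hφ.eq_ψ t ⟨ht.1, htt₁⟩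
  · exact h.hasSum_flow_optControl hp ht₁ hadm hx₁ hφ ⟨htt₁, ht.2⟩
  · rw [flow_optControl_of_le _ _ _ _ _ _ htt₁, tildeζ_of_le _ _ _ _ htt₁]
    exact hφ.eq_ζ k hk t ⟨ht.1, htt₁⟩
  · have hstart := hφ.eq_ζ k hk t₁ ht₁'
    rw [hx₁] at hstart
    rw [h.toReal_flow_optControl hp ht₁ hadm hx₁ hφ ⟨htt₁, ht.2⟩,
      h.toReal_lintegral_optRate hk ⟨htt₁, ht.2⟩, h.tildeζ_eq hx₁ ⟨htt₁, ht.2⟩]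
    linarith

theorem pathCost_tilde_le (hcontrol : ∃ φ, IsControl p t₁ ζs ψs φ) :
    (pathCost p t₁ (t₁ + varsig x₁ x₂) (tildeζ t₁ x₁ x₂ β ζs) (tildeψ t₁ x₁ x₂ β ψs) : EReal) ≤
      LCost t₁ (t₁ + varsig x₁ x₂) (optPath t₁ x₁ x₂ β) := by
  obtain ⟨φ, hφ⟩ := hcontrol
  rw [h.LCost_optPath, EReal.coe_ennreal_le_coe_ennreal_iff]
  refine (iInf₂_le _ (h.isControl_optControl hp ht₁ hadm hx₁ hφ)).trans_eq ?_
  rw [controlCost_eq fun k => measurable_optControl _ _ _ _ (hφ.meas k),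
    ← Measure.restrict_congr_set (Ioo_ae_eq_Icc (a := t₁) (b := t₁ + varsig x₁ x₂))]
  exact setLIntegral_congr_fun measurableSet_Ioo fun s hs =>
    tsum_congr fun k => h.setLIntegral_ell_optControl hs k

end Control

end Endpoints

/-! ### Integrals along a path -/

theorem ofReal_integral_le_lintegral {α : Type*} [MeasurableSpace α] {μ : Measure α} {g : α → ℝ}
    (hg : Integrable g μ) : ENNReal.ofReal (∫ x, g x ∂μ) ≤ ∫⁻ x, ENNReal.ofReal (g x) ∂μ := by
  refine ENNReal.ofReal_le_of_le_toReal ?_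
  rw [integral_eq_lintegral_pos_part_sub_lintegral_neg_part hg]
  exact sub_le_self _ ENNReal.toReal_nonneg

theorem ofReal_integral_le_setLIntegral {g : ℝ → ℝ} {c : ℝ → ℝ≥0∞} {a b : ℝ} (hab : a ≤ b)
    (hg : IntervalIntegrable g volume a b)
    (h : ∀ᵐ t, t ∈ Ioo a b → ENNReal.ofReal (g t) ≤ c t) :
    ENNReal.ofReal (∫ t in a..b, g t) ≤ ∫⁻ t in Ioo a b, c t := by
  rw [intervalIntegrable_iff_integrableOn_Ioo_of_le hab] at hg
  rw [intervalIntegral.integral_of_le hab, integral_Ioc_eq_integral_Ioo]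
  refine (ofReal_integral_le_lintegral hg).trans (lintegral_mono_ae ?_)
  rwa [ae_restrict_iff' measurableSet_Ioo]

theorem setLIntegral_eq_ofReal_integral {g : ℝ → ℝ} {c : ℝ → ℝ≥0∞} {a b : ℝ} (hab : a ≤ b)
    (hg : IntervalIntegrable g volume a b) (hg_nonneg : ∀ t ∈ Ioo a b, 0 ≤ g t)
    (h : ∀ t ∈ Ioo a b, c t = ENNReal.ofReal (g t)) :
    ∫⁻ t in Ioo a b, c t = ENNReal.ofReal (∫ t in a..b, g t) := by
  rw [intervalIntegrable_iff_integrableOn_Ioo_of_le hab] at hg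
  rw [intervalIntegral.integral_of_le hab, integral_Ioc_eq_integral_Ioo,
    ofReal_integral_eq_lintegral_ofReal hg ((ae_restrict_mem measurableSet_Ioo).mono hg_nonneg)]
  exact setLIntegral_congr_fun measurableSet_Ioo h

theorem hasSum_integral_mul_of_hasSum_one {ι : Type*} [Countable ι] {f : ι → ℝ → ℝ} {g : ℝ → ℝ}
    {a b : ℝ} (hf : ∀ i, AEStronglyMeasurable (f i) (volume.restrict (uIoc a b)))
    (hprob : ∀ᵐ t, t ∈ uIoc a b → (∀ i, 0 ≤ f i t) ∧ HasSum (fun i => f i t) 1)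
    (hg : IntervalIntegrable g volume a b) :
    HasSum (fun i => ∫ t in a..b, f i t * g t) (∫ t in a..b, g t) := by
  refine intervalIntegral.hasSum_integral_of_dominated_convergence (fun i t => f i t * ‖g t‖)
    (fun i => (hf i).mul (intervalIntegrable_iff.1 hg).aestronglyMeasurable)
    (fun i => ?_) ?_ ?_ ?_
  · filter_upwards [hprob] with t ht hmem
    rw [norm_mul, Real.norm_of_nonneg ((ht hmem).1 i)]
  · filter_upwards [hprob] with t ht hmem
    exact (ht hmem).2.summable.mul_right _
  · refine hg.norm.congr_ae ?_
    rw [Filter.EventuallyEq, ae_restrict_iff' measurableSet_uIoc]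
    filter_upwards [hprob] with t ht hmem
    rw [tsum_mul_right, (ht hmem).2.tsum_eq, one_mul]
  · filter_upwards [hprob] with t ht hmem
    simpa using (ht hmem).2.mul_right (g t)

theorem integral_deriv_mul_log {f : ℝ → ℝ} {a b ε : ℝ} (hab : a ≤ b)
    (hf : AbsolutelyContinuousOnInterval f a b) (hpos : ∀ t ∈ Icc a b, 0 < f t + ε) :
    ∫ t in a..b, deriv f t * Real.log (f t + ε) = ell (f b + ε) - ell (f a + ε) := by
  have hcont := hf.continuousOn
  rw [uIcc_of_le hab] at hcont
  obtain ⟨t₀, ht₀, hmin⟩ := isCompact_Icc.exists_isMinOn (nonempty_Icc.2 hab) hcont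
  obtain ⟨t₁, -, hmax⟩ := isCompact_Icc.exists_isMaxOn (nonempty_Icc.2 hab) hcont
  have hsmooth : ContDiffOn ℝ 1 (fun u => ell (u + ε)) (Icc (f t₀) (f t₁)) := fun u hu => by
    have hne : u + ε ≠ 0 := by linarith [hpos t₀ ht₀, hu.1]
    have hadd : ContDiffWithinAt ℝ 1 (fun u : ℝ => u + ε) (Icc (f t₀) (f t₁)) u := by fun_prop
    exact ((hadd.mul (hadd.log hne)).sub hadd).add contDiffWithinAt_const
  obtain ⟨K, hK⟩ := hsmooth.exists_lipschitzOnWith one_ne_zero (convex_Icc _ _) isCompact_Icc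
  have hac := absCont_comp_lipschitzOn hK hf fun t ht => by
    rw [uIcc_of_le hab] at ht
    exact ⟨hmin ht, hmax ht⟩
  refine .trans (intervalIntegral.integral_congr_ae ?_) hac.integral_deriv_eq_sub
  filter_upwards [hf.ae_differentiableAt] with t hdiff hmem
  have ht := uIoc_subset_uIcc hmem
  have hderiv := (hdiff ht).hasDerivAt
  rw [uIcc_of_le hab] at ht
  rw [mul_comm]
  exact ((hasDerivAt_ell (hpos t ht).ne').comp t (hderiv.add_const ε)).deriv.symm

theorem measurable_nu_velocity (ζ : ℝ → ℕ → ℝ) (k : ℕ) :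
    Measurable fun t => nu (velocity ζ t) k := by
  unfold nu velocity
  split_ifs
  · exact measurable_const.add (Measurable.tsum fun j => measurable_deriv _)
  · exact (measurable_deriv _).neg

theorem measurableSet_subVelocity (ζ : ℝ → ℕ → ℝ) :
    MeasurableSet {t | SubVelocity (velocity ζ t)} := by
  simp only [SubVelocity, ofPred_forall]
  refine MeasurableSet.iInter fun n => measurableSet_le ?_ measurable_const
  exact Finset.measurable_fun_sum _ fun j _ => (measurable_deriv _).neg

namespace DescendingPath

variable {x₁ x₂ : ℕ → ℝ} {a b s : ℝ} {ζ : ℝ → ℕ → ℝ}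

theorem continuousOn (h : DescendingPath x₁ x₂ a b ζ)
    (hx₁ : Summable fun k : ℕ => (k : ℝ) * x₁ k) (hab : a ≤ b) (k : ℕ) :
    ContinuousOn (fun t => ζ t k) (Icc a b) := by
  rw [← uIcc_of_le hab]
  rcases Nat.eq_zero_or_pos k with rfl | hk
  · have hdecrease : AbsolutelyContinuousOnInterval (fun t => ζ t 0 - x₁ 0 + 2 * (t - a)) a b := by
      refine absCont_of_hasSum_monotoneOn (g := fun k t => (k : ℝ) * (x₁ k - ζ t k)) hab
        (fun k => ?_) (fun k => ?_) fun t ht => h.hasSum_decrease hx₁ ht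
      · rcases Nat.eq_zero_or_pos k with rfl | hk
        · simpa using absCont_const (0 : ℝ) a b
        · exact ((absCont_const (x₁ k) a b).sub (h.ac k hk)).const_mul (k : ℝ)
      · rcases Nat.eq_zero_or_pos k with rfl | hk
        · simpa using! monotoneOn_const
        · intro t ht u hu htu
          exact mul_le_mul_of_nonneg_left (sub_le_sub_left (h.anti k hk ht hu htu) _)
            k.cast_nonneg
    have hlinear : ContinuousOn (fun t => x₁ 0 - 2 * (t - a)) (uIcc a b) := by fun_prop
    refine (hdecrease.continuousOn.add hlinear).congr fun t _ => ?_
    rw [Pi.add_apply]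
    ring
  · exact (h.ac k hk).continuousOn

theorem continuousOn_rk (h : DescendingPath x₁ x₂ a b ζ)
    (hx₁ : Summable fun k : ℕ => (k : ℝ) * x₁ k) (hs : s ∈ Ico a b) (k : ℕ) :
    ContinuousOn (fun t => rk (ζ t) k) (Icc a s) := by
  have hsub : Icc a s ⊆ Icc a b := Icc_subset_Icc_right hs.2.le
  have hsub' : Icc a s ⊆ Ico a b := Icc_subset_Ico_right hs.2
  have hcont := fun k => (h.continuousOn hx₁ (hs.1.trans hs.2.le) k).mono hsub
  refine ContinuousOn.congr (ContinuousOn.div ?_ (by fun_prop) fun t ht => ?_)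
    fun t ht => h.rk_eq hx₁ (hsub' ht) k
  · split_ifs
    · exact hcont 0
    · exact continuousOn_const.mul (hcont k)
  · rw [← h.r_eq t (hsub ht)]
    exact (h.r_pos (hsub' ht)).ne'

theorem hasSum_integral_rk (h : DescendingPath x₁ x₂ a b ζ)
    (hx₁ : Summable fun k : ℕ => (k : ℝ) * x₁ k) (hs : s ∈ Ico a b) :
    HasSum (fun k => ∫ t in a..s, rk (ζ t) k) (s - a) := by
  have hsum := hasSum_integral_mul_of_hasSum_one (f := fun k t => rk (ζ t) k) (g := fun _ => 1)
    (a := a) (b := s) (fun k => ?_) (.of_forall fun t hmem => ?_) intervalIntegrable_const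
  · simpa using hsum
  · rw [uIoc_of_le hs.1]
    exact ((h.continuousOn_rk hx₁ hs k).mono Ioc_subset_Icc_self).aestronglyMeasurable
      measurableSet_Ioc
  · rw [uIoc_of_le hs.1] at hmem
    have ht : t ∈ Ico a b := ⟨hmem.1.le, hmem.2.trans_lt hs.2⟩
    exact ⟨rk_nonneg fun k hk => h.nonneg k hk t (Ico_subset_Icc_self ht),
      hasSum_rk (h.summable hx₁ (Ico_subset_Icc_self ht)) (h.r_pos ht)⟩

theorem ae_hasSum_nu (h : DescendingPath x₁ x₂ a b ζ) (hs : s ∈ Icc a b)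
    (hv : ∀ᵐ t, t ∈ Ioo a b → SubVelocity (velocity ζ t)) :
    ∀ᵐ t, t ∈ uIoc a s →
      (∀ k, 0 ≤ nu (velocity ζ t) k) ∧ HasSum (nu (velocity ζ t)) 1 := by
  filter_upwards [hv, Measure.ae_ne volume s] with t ht hne hmem
  rw [uIoc_of_le hs.1] at hmem
  have hmem' : t ∈ Ioo a b := ⟨hmem.1, (hmem.2.lt_of_ne hne).trans_le hs.2⟩
  have hnonpos : ∀ k : ℕ, 1 ≤ k → velocity ζ t k ≤ 0 := fun k hk => h.deriv_nonpos hk hmem'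
  exact ⟨nu_nonneg hnonpos (ht hmem'), hasSum_nu ((ht hmem').summable hnonpos)⟩

theorem intervalIntegrable_nu (h : DescendingPath x₁ x₂ a b ζ) (hs : s ∈ Icc a b)
    (hv : ∀ᵐ t, t ∈ Ioo a b → SubVelocity (velocity ζ t)) (k : ℕ) :
    IntervalIntegrable (fun t => nu (velocity ζ t) k) volume a s := by
  refine (intervalIntegrable_const (c := (1 : ℝ))).mono_fun
    (measurable_nu_velocity ζ k).aestronglyMeasurable ?_
  rw [Filter.EventuallyLE, ae_restrict_iff' measurableSet_uIoc]
  filter_upwards [h.ae_hasSum_nu hs hv] with t ht hmem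
  rw [Real.norm_of_nonneg ((ht hmem).1 k), norm_one]
  exact le_hasSum (ht hmem).2 k fun j _ => (ht hmem).1 j

theorem hasSum_integral_nu_mul (h : DescendingPath x₁ x₂ a b ζ) (hs : s ∈ Icc a b)
    (hv : ∀ᵐ t, t ∈ Ioo a b → SubVelocity (velocity ζ t)) {g : ℝ → ℝ}
    (hg : IntervalIntegrable g volume a s) :
    HasSum (fun k => ∫ t in a..s, nu (velocity ζ t) k * g t) (∫ t in a..s, g t) :=
  hasSum_integral_mul_of_hasSum_one (fun k => (measurable_nu_velocity ζ k).aestronglyMeasurable)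
    (h.ae_hasSum_nu hs hv) hg

end DescendingPath

namespace DescendingPath

variable {x₁ x₂ : ℕ → ℝ} {a b s : ℝ} {ζ : ℝ → ℕ → ℝ} {k : ℕ}

theorem nu_eq_neg_deriv (ζ : ℝ → ℕ → ℝ) (hk : 1 ≤ k) (t : ℝ) :
    nu (velocity ζ t) k = -deriv (fun u => ζ u k) t := by
  rw [nu, if_neg (by lia), velocity]

theorem hasSum_integral_decrease_mul (h : DescendingPath x₁ x₂ a b ζ)
    (hx₁ : Summable fun k : ℕ => (k : ℝ) * x₁ k) (hs : s ∈ Icc a b) {g : ℝ → ℝ}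
    (hg : IntervalIntegrable g volume a s) :
    HasSum (fun k : ℕ => ∫ t in a..s, (k : ℝ) * (x₁ k - ζ t k) * g t)
      (∫ t in a..s, (ζ t 0 - x₁ 0 + 2 * (t - a)) * g t) := by
  have hsub : uIoc a s ⊆ Icc a b := by
    rw [uIoc_of_le hs.1]
    exact Ioc_subset_Icc_self.trans (Icc_subset_Icc_right hs.2)
  refine intervalIntegral.hasSum_integral_of_dominated_convergence
    (fun k t => (k : ℝ) * x₁ k * ‖g t‖) (fun k => ?_)
    (fun k => .of_forall fun t ht => ?_) (.of_forall fun t _ => hx₁.mul_right _) ?_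
    (.of_forall fun t ht => (h.hasSum_decrease hx₁ (hsub ht)).mul_right _)
  · have hcont := (h.continuousOn hx₁ (hs.1.trans hs.2) k).mono hsub
    exact ((continuousOn_const.mul (continuousOn_const.sub hcont)).aestronglyMeasurable
      measurableSet_uIoc).mul (intervalIntegrable_iff.1 hg).aestronglyMeasurable
  · rcases Nat.eq_zero_or_pos k with rfl | hk
    · simp
    · have hle := h.le_left hk (hsub ht)
      have hnonneg := h.nonneg k hk t (hsub ht)
      rw [norm_mul, Real.norm_of_nonneg (mul_nonneg k.cast_nonneg (sub_nonneg.2 hle))]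
      gcongr
      linarith
  · simp_rw [tsum_mul_right]
    exact hg.norm.const_mul _

theorem intervalIntegrable_nu_mul (h : DescendingPath x₁ x₂ a b ζ)
    (hv : ∀ᵐ t, t ∈ Ioo a b → SubVelocity (velocity ζ t)) (hs : s ∈ Icc a b) (k : ℕ) {g : ℝ → ℝ}
    (hg : ContinuousOn g (Icc a s)) :
    IntervalIntegrable (fun t => nu (velocity ζ t) k * g t) volume a s := by
  refine (h.intervalIntegrable_nu hs hv k).mul_continuousOn ?_
  rwa [uIcc_of_le hs.1]

theorem ae_nu_rk_nonneg (h : DescendingPath x₁ x₂ a b ζ)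
    (hv : ∀ᵐ t, t ∈ Ioo a b → SubVelocity (velocity ζ t)) (hs : s ≤ b) (k : ℕ) :
    ∀ᵐ t, t ∈ Ioo a s → 0 ≤ nu (velocity ζ t) k ∧ 0 ≤ rk (ζ t) k := by
  filter_upwards [hv] with t hsub ht
  have ht' : t ∈ Ioo a b := ⟨ht.1, ht.2.trans_le hs⟩
  exact ⟨nu_nonneg (fun j hj => h.deriv_nonpos hj ht') (hsub ht') k,
    rk_nonneg (fun j hj => h.nonneg j hj t (Ioo_subset_Icc_self ht')) k⟩

theorem integral_nu_mul_log_div (h : DescendingPath x₁ x₂ a b ζ) {c ε : ℝ} (hk : 1 ≤ k)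
    (hc : c ≠ 0) (hs : s ∈ Icc a b) (hpos : ∀ t ∈ Icc a s, 0 < ζ t k + ε) :
    ∫ t in a..s, nu (velocity ζ t) k * Real.log (c / (ζ t k + ε)) =
      ellPersp c (ζ s k + ε) - ellPersp c (x₁ k + ε) := by
  have hac := absCont_mono_right (h.ac k hk) hs
  have hint : ∫ t in a..s, nu (velocity ζ t) k * Real.log (c / (ζ t k + ε)) =
      ∫ t in a..s, (deriv (fun u => ζ u k) t * Real.log (ζ t k + ε) -
        deriv (fun u => ζ u k) t * Real.log c) := by
    refine intervalIntegral.integral_congr fun t ht => ?_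
    rw [uIcc_of_le hs.1] at ht
    simp only [nu_eq_neg_deriv ζ hk, Real.log_div hc (hpos t ht).ne']
    ring
  have hlog : ContinuousOn (fun t => Real.log (ζ t k + ε)) (uIcc a s) := by
    rw [uIcc_of_le hs.1]
    have hcont := hac.continuousOn
    rw [uIcc_of_le hs.1] at hcont
    exact (hcont.add continuousOn_const).log fun t ht => (hpos t ht).ne'
  rw [hint, intervalIntegral.integral_sub (hac.intervalIntegrable_deriv.mul_continuousOn hlog)
    (hac.intervalIntegrable_deriv.mul_const _), intervalIntegral.integral_mul_const,
    integral_deriv_mul_log hs.1 hac hpos, hac.integral_deriv_eq_sub, h.left,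
    ellPersp_eq_ell_sub hc, ellPersp_eq_ell_sub hc]
  ring

end DescendingPath

/-! ### The action of a path -/

/-- `-½ (log w)'(t) = 1 / (2 ς̃ w(t))`, for the remaining time fraction `w`. -/
def decayRate (t₁ : ℝ) (x₁ x₂ : ℕ → ℝ) (β t : ℝ) : ℝ :=
  (2 * sigmaTilde x₁ x₂ β * timeLeft t₁ x₁ x₂ β t)⁻¹

/-- `κ(t) = r(ζ(t)) / (2 ς̃ w(t))`, the same for all paths between `x₁` and `x₂`. -/
def kappa (t₁ : ℝ) (x₁ x₂ : ℕ → ℝ) (β t : ℝ) : ℝ :=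
  (r x₁ - 2 * (t - t₁)) * decayRate t₁ x₁ x₂ β t

/-- The factor `κ(t) w(t)^{k/2}` of the slope `ν(k) / μ(k)` of the explicit path; the remaining
factor is `1` for `k = 0` and `z̃_k / ζ̃_k(t)` for `k ≥ 1`. -/
def baseSlope (t₁ : ℝ) (x₁ x₂ : ℕ → ℝ) (β t : ℝ) (k : ℕ) : ℝ :=
  kappa t₁ x₁ x₂ β t * timeLeft t₁ x₁ x₂ β t ^ ((k : ℝ) / 2)

/-- The part of the action of a path up to time `s` that involves only deterministic slopes. Its
sum over the coordinates depends on the path only through the zeroth coordinate. -/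
def bulk (t₁ : ℝ) (x₁ x₂ : ℕ → ℝ) (β : ℝ) (ζ : ℝ → ℕ → ℝ) (s : ℝ) (k : ℕ) : ℝ :=
  (∫ t in t₁..s, nu (velocity ζ t) k * Real.log (baseSlope t₁ x₁ x₂ β t k)) +
    ∫ t in t₁..s, rk (ζ t) k

/-- The product of the tangent slope at the path `ζ` and the rate `r_k(ζ(t))`. -/
def tangentFlux (t₁ : ℝ) (x₁ x₂ : ℕ → ℝ) (β : ℝ) (ζ : ℝ → ℕ → ℝ) (t : ℝ) (k : ℕ) : ℝ :=
  if k = 0 then ζ t 0 * decayRate t₁ x₁ x₂ β t else optRate t₁ x₁ x₂ β t k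

/-- The tangent lower bound for the cost of the `k`-th coordinate up to time `s`. -/
def action (t₁ : ℝ) (x₁ x₂ : ℕ → ℝ) (β : ℝ) (ζ : ℝ → ℕ → ℝ) (s : ℝ) (k : ℕ) : ℝ :=
  bulk t₁ x₁ x₂ β ζ s k +
    (ellPersp (zTilde x₁ x₂ β k) (ζ s k) - ellPersp (zTilde x₁ x₂ β k) (x₁ k)) -
    ∫ t in t₁..s, tangentFlux t₁ x₁ x₂ β ζ t k

theorem tangentFlux_optPath (t₁ : ℝ) (x₁ x₂ : ℕ → ℝ) (β t : ℝ) (k : ℕ) :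
    tangentFlux t₁ x₁ x₂ β (optPath t₁ x₁ x₂ β) t k = optRate t₁ x₁ x₂ β t k := by
  by_cases hk : k = 0
  · rw [tangentFlux, if_pos hk, hk, optRate, if_pos rfl, decayRate, div_eq_mul_inv]
  · rw [tangentFlux, if_neg hk]

namespace Endpoints

variable {x₁ x₂ : ℕ → ℝ} {β : ℝ} (h : Endpoints x₁ x₂ β) {t₁ s t : ℝ}
include h

theorem mass_pos (ht : t ∈ Ico t₁ (t₁ + varsig x₁ x₂)) : 0 < r x₁ - 2 * (t - t₁) := by
  rw [← h.r_optPath (Ico_subset_Icc_self ht)]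
  exact h.descendingPath_optPath.r_pos ht

theorem decayRate_pos (ht : t < t₁ + varsig x₁ x₂) : 0 < decayRate t₁ x₁ x₂ β t :=
  inv_pos.2 (mul_pos (mul_pos two_pos h.sigmaTilde_pos) (h.timeLeft_pos ht))

theorem kappa_pos (ht : t ∈ Ico t₁ (t₁ + varsig x₁ x₂)) : 0 < kappa t₁ x₁ x₂ β t :=
  mul_pos (h.mass_pos ht) (h.decayRate_pos ht.2)

theorem baseSlope_pos (ht : t ∈ Ico t₁ (t₁ + varsig x₁ x₂)) (k : ℕ) :
    0 < baseSlope t₁ x₁ x₂ β t k :=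
  mul_pos (h.kappa_pos ht) (Real.rpow_pos_of_pos (h.timeLeft_pos ht.2) _)

theorem log_baseSlope (ht : t ∈ Ico t₁ (t₁ + varsig x₁ x₂)) (k : ℕ) :
    Real.log (baseSlope t₁ x₁ x₂ β t k) =
      Real.log (kappa t₁ x₁ x₂ β t) + (k : ℝ) / 2 * Real.log (timeLeft t₁ x₁ x₂ β t) := by
  have hw := h.timeLeft_pos ht.2
  rw [baseSlope, Real.log_mul (h.kappa_pos ht).ne' (Real.rpow_pos_of_pos hw _).ne',
    Real.log_rpow hw]

theorem continuousOn_log_timeLeft (hs : s < t₁ + varsig x₁ x₂) :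
    ContinuousOn (fun t => Real.log (timeLeft t₁ x₁ x₂ β t)) (Icc t₁ s) :=
  ContinuousOn.log (by unfold timeLeft; fun_prop) fun _ ht =>
    (h.timeLeft_pos (ht.2.trans_lt hs)).ne'

theorem continuousOn_decayRate (hs : s < t₁ + varsig x₁ x₂) :
    ContinuousOn (decayRate t₁ x₁ x₂ β) (Icc t₁ s) :=
  ContinuousOn.inv₀ (by unfold timeLeft; fun_prop) fun _ ht =>
    (inv_pos.1 (h.decayRate_pos (ht.2.trans_lt hs))).ne'

theorem continuousOn_log_kappa (hs : s < t₁ + varsig x₁ x₂) :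
    ContinuousOn (fun t => Real.log (kappa t₁ x₁ x₂ β t)) (Icc t₁ s) :=
  (ContinuousOn.mul (by fun_prop) (h.continuousOn_decayRate hs)).log fun _ ht =>
    (h.kappa_pos ⟨ht.1, ht.2.trans_lt hs⟩).ne'

theorem hasDerivAt_log_timeLeft (ht : t < t₁ + varsig x₁ x₂) :
    HasDerivAt (fun u => Real.log (timeLeft t₁ x₁ x₂ β u)) (-(2 * decayRate t₁ x₁ x₂ β t)) t := by
  have hw := (h.timeLeft_pos ht).ne'
  have hσ := h.sigmaTilde_pos.ne'
  convert! (hasDerivAt_timeLeft t₁ x₁ x₂ β t).log hw using 1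
  rw [decayRate]
  field_simp

theorem absCont_log_timeLeft (hs : s ∈ Ico t₁ (t₁ + varsig x₁ x₂)) :
    AbsolutelyContinuousOnInterval (fun u => Real.log (timeLeft t₁ x₁ x₂ β u)) t₁ s := by
  refine ContDiffOn.absolutelyContinuousOnInterval ?_
  rw [uIcc_of_le hs.1]
  have hsmooth : ContDiff ℝ 1 (timeLeft t₁ x₁ x₂ β) := by
    unfold timeLeft
    fun_prop
  exact hsmooth.contDiffOn.log fun t ht => (h.timeLeft_pos (ht.2.trans_lt hs.2)).ne'

variable {ζ : ℝ → ℕ → ℝ} (hζ : DescendingPath x₁ x₂ t₁ (t₁ + varsig x₁ x₂) ζ)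
include hζ

theorem integral_nu_mul_log_timeLeft (hs : s ∈ Ico t₁ (t₁ + varsig x₁ x₂)) (k : ℕ) :
    (k : ℝ) / 2 * (∫ t in t₁..s, nu (velocity ζ t) k * Real.log (timeLeft t₁ x₁ x₂ β t)) =
      (k : ℝ) * (x₁ k - ζ s k) * (Real.log (timeLeft t₁ x₁ x₂ β s) / 2) +
        ∫ t in t₁..s, (k : ℝ) * (x₁ k - ζ t k) * decayRate t₁ x₁ x₂ β t := by
  rcases Nat.eq_zero_or_pos k with rfl | hk
  · simp
  have hdecrease : AbsolutelyContinuousOnInterval (fun t => x₁ k - ζ t k) t₁ s :=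
    (absCont_const (x₁ k) t₁ s).sub (absCont_mono_right (hζ.ac k hk) (Ico_subset_Icc_self hs))
  have hparts := (h.absCont_log_timeLeft hs).integral_mul_deriv_eq_deriv_mul hdecrease
  have hnu : ∫ t in t₁..s, nu (velocity ζ t) k * Real.log (timeLeft t₁ x₁ x₂ β t) =
      ∫ t in t₁..s, Real.log (timeLeft t₁ x₁ x₂ β t) * deriv (fun t => x₁ k - ζ t k) t := by
    refine intervalIntegral.integral_congr fun t _ => ?_
    simp only [DescendingPath.nu_eq_neg_deriv ζ hk, deriv_const_sub, mul_comm]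
  have hlog : ∫ t in t₁..s,
      deriv (fun u => Real.log (timeLeft t₁ x₁ x₂ β u)) t * (x₁ k - ζ t k) =
      -2 * ∫ t in t₁..s, (x₁ k - ζ t k) * decayRate t₁ x₁ x₂ β t := by
    rw [← intervalIntegral.integral_const_mul]
    refine intervalIntegral.integral_congr fun t ht => ?_
    rw [uIcc_of_le hs.1] at ht
    rw [(h.hasDerivAt_log_timeLeft (ht.2.trans_lt hs.2)).deriv]
    ring
  simp only [mul_assoc (k : ℝ), intervalIntegral.integral_const_mul]
  rw [hnu, hparts, hlog, timeLeft_left, Real.log_one]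
  ring

theorem hasSum_integral_nu_mul_log_timeLeft (hs : s ∈ Ico t₁ (t₁ + varsig x₁ x₂)) :
    HasSum (fun k : ℕ => (k : ℝ) / 2 *
        (∫ t in t₁..s, nu (velocity ζ t) k * Real.log (timeLeft t₁ x₁ x₂ β t)))
      ((ζ s 0 - x₁ 0 + 2 * (s - t₁)) * (Real.log (timeLeft t₁ x₁ x₂ β s) / 2) +
        ∫ t in t₁..s, (ζ t 0 - x₁ 0 + 2 * (t - t₁)) * decayRate t₁ x₁ x₂ β t) := by
  have hs' := Ico_subset_Icc_self hs
  have hdecay := (h.continuousOn_decayRate hs.2).intervalIntegrable_of_Icc (μ := volume) hs.1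
  exact (((hζ.hasSum_decrease h.summable₁ hs').mul_right _).add
    (hζ.hasSum_integral_decrease_mul h.summable₁ hs' hdecay)).congr_fun
      (h.integral_nu_mul_log_timeLeft hζ hs)

variable (hv : ∀ᵐ t, t ∈ Ioo t₁ (t₁ + varsig x₁ x₂) → SubVelocity (velocity ζ t))
include hv

theorem hasSum_bulk (hs : s ∈ Ico t₁ (t₁ + varsig x₁ x₂)) :
    HasSum (bulk t₁ x₁ x₂ β ζ s)
      ((∫ t in t₁..s, Real.log (kappa t₁ x₁ x₂ β t)) +
        ((ζ s 0 - x₁ 0 + 2 * (s - t₁)) * (Real.log (timeLeft t₁ x₁ x₂ β s) / 2) +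
          ∫ t in t₁..s, (ζ t 0 - x₁ 0 + 2 * (t - t₁)) * decayRate t₁ x₁ x₂ β t) +
        (s - t₁)) := by
  have hs' := Ico_subset_Icc_self hs
  have hlogκ := h.continuousOn_log_kappa hs.2
  have hlog (k : ℕ) : ∫ t in t₁..s, nu (velocity ζ t) k * Real.log (baseSlope t₁ x₁ x₂ β t k) =
      (∫ t in t₁..s, nu (velocity ζ t) k * Real.log (kappa t₁ x₁ x₂ β t)) +
        (k : ℝ) / 2 *
          ∫ t in t₁..s, nu (velocity ζ t) k * Real.log (timeLeft t₁ x₁ x₂ β t) := by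
    rw [← intervalIntegral.integral_const_mul, ← intervalIntegral.integral_add
      (hζ.intervalIntegrable_nu_mul hv hs' k hlogκ)
      ((hζ.intervalIntegrable_nu_mul hv hs' k (h.continuousOn_log_timeLeft hs.2)).const_mul _)]
    refine intervalIntegral.integral_congr fun t ht => ?_
    rw [uIcc_of_le hs.1] at ht
    simp only [h.log_baseSlope ⟨ht.1, ht.2.trans_lt hs.2⟩]
    ring
  refine (((hζ.hasSum_integral_nu_mul hs' hv (hlogκ.intervalIntegrable_of_Icc hs.1)).add
    (h.hasSum_integral_nu_mul_log_timeLeft hζ hs)).add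
      (hζ.hasSum_integral_rk h.summable₁ hs)).congr_fun fun k => ?_
  rw [bulk, hlog]

end Endpoints

theorem optRate_eq_mul_decayRate (t₁ : ℝ) (x₁ x₂ : ℕ → ℝ) (β : ℝ) {k : ℕ} (hk : 1 ≤ k) (t : ℝ) :
    optRate t₁ x₁ x₂ β t k =
      k * zTilde x₁ x₂ β k * timeLeft t₁ x₁ x₂ β t ^ ((k : ℝ) / 2) * decayRate t₁ x₁ x₂ β t := by
  rw [optRate, if_neg (by lia), decayRate, div_eq_mul_inv]

namespace Endpoints

variable {x₁ x₂ : ℕ → ℝ} {β : ℝ} (h : Endpoints x₁ x₂ β) {t₁ s t ε : ℝ} {k : ℕ}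
include h

theorem continuousOn_log_baseSlope (hs : s < t₁ + varsig x₁ x₂) (k : ℕ) :
    ContinuousOn (fun t => Real.log (baseSlope t₁ x₁ x₂ β t k)) (Icc t₁ s) :=
  ((h.continuousOn_log_kappa hs).add
    (continuousOn_const.mul (h.continuousOn_log_timeLeft hs))).congr fun _ ht =>
      h.log_baseSlope ⟨ht.1, ht.2.trans_lt hs⟩ k

variable {ζ : ℝ → ℕ → ℝ} (hζ : DescendingPath x₁ x₂ t₁ (t₁ + varsig x₁ x₂) ζ)
include hζ

theorem continuousOn_tangentFlux (hs : s ∈ Ico t₁ (t₁ + varsig x₁ x₂)) (k : ℕ) :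
    ContinuousOn (fun t => tangentFlux t₁ x₁ x₂ β ζ t k) (Icc t₁ s) := by
  have hdecay := h.continuousOn_decayRate hs.2
  rcases Nat.eq_zero_or_pos k with rfl | hk
  · have hcont := (hζ.continuousOn h.summable₁ (hs.1.trans hs.2.le) 0).mono
      (Icc_subset_Icc_right hs.2.le)
    simp only [tangentFlux, if_true]
    exact hcont.mul hdecay
  · simp only [tangentFlux, if_neg (Nat.ne_of_gt hk), optRate_eq_mul_decayRate _ _ _ _ hk]
    refine (continuousOn_const.mul (ContinuousOn.rpow_const ?_ fun t _ => .inr ?_)).mul hdecay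
    · unfold timeLeft
      fun_prop
    · positivity

theorem baseSlope_mul_rk (ht : t ∈ Ico t₁ (t₁ + varsig x₁ x₂)) (k : ℕ) :
    baseSlope t₁ x₁ x₂ β t k * rk (ζ t) k =
      (if k = 0 then ζ t 0 else k * ζ t k) * timeLeft t₁ x₁ x₂ β t ^ ((k : ℝ) / 2) *
        decayRate t₁ x₁ x₂ β t := by
  have hmass := (h.mass_pos ht).ne'
  rw [hζ.rk_eq h.summable₁ ht, baseSlope, kappa]
  field_simp

theorem baseSlope_mul_rk_zero (ht : t ∈ Ico t₁ (t₁ + varsig x₁ x₂)) :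
    baseSlope t₁ x₁ x₂ β t 0 * rk (ζ t) 0 = tangentFlux t₁ x₁ x₂ β ζ t 0 := by
  simp [h.baseSlope_mul_rk hζ ht, tangentFlux]

theorem baseSlope_mul_div_mul_rk (hk : 1 ≤ k) (ht : t ∈ Ico t₁ (t₁ + varsig x₁ x₂)) (ε : ℝ) :
    baseSlope t₁ x₁ x₂ β t k * (zTilde x₁ x₂ β k / (ζ t k + ε)) * rk (ζ t) k =
      tangentFlux t₁ x₁ x₂ β ζ t k * (ζ t k / (ζ t k + ε)) := by
  have hk0 := Nat.ne_of_gt hk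
  rw [mul_right_comm, h.baseSlope_mul_rk hζ ht, tangentFlux, if_neg hk0, if_neg hk0,
    optRate_eq_mul_decayRate _ _ _ _ hk]
  ring

section Tangent

variable (hv : ∀ᵐ t, t ∈ Ioo t₁ (t₁ + varsig x₁ x₂) → SubVelocity (velocity ζ t))
  (hs : s ∈ Ico t₁ (t₁ + varsig x₁ x₂)) {q : ℝ → ℝ} (hq : ContinuousOn q (Icc t₁ s))
  (hq_pos : ∀ t ∈ Icc t₁ s, 0 < q t)
include hv hs hq hq_pos

theorem intervalIntegrable_tangent (k : ℕ) :
    IntervalIntegrable (fun t => nu (velocity ζ t) k *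
      Real.log (baseSlope t₁ x₁ x₂ β t k * q t) - tangentFlux t₁ x₁ x₂ β ζ t k + rk (ζ t) k)
      volume t₁ s := by
  have hlog : ContinuousOn (fun t => Real.log (baseSlope t₁ x₁ x₂ β t k * q t)) (Icc t₁ s) :=
    ((h.continuousOn_log_baseSlope hs.2 k).add (hq.log fun t ht => (hq_pos t ht).ne')).congr
      fun t ht => Real.log_mul (h.baseSlope_pos ⟨ht.1, ht.2.trans_lt hs.2⟩ k).ne'
        (hq_pos t ht).ne'
  exact ((hζ.intervalIntegrable_nu_mul hv (Ico_subset_Icc_self hs) k hlog).sub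
    ((h.continuousOn_tangentFlux hζ hs k).intervalIntegrable_of_Icc hs.1)).add
    ((hζ.continuousOn_rk h.summable₁ hs k).intervalIntegrable_of_Icc hs.1)

theorem integral_tangent (k : ℕ) :
    ∫ t in t₁..s, (nu (velocity ζ t) k * Real.log (baseSlope t₁ x₁ x₂ β t k * q t) -
        tangentFlux t₁ x₁ x₂ β ζ t k + rk (ζ t) k) =
      bulk t₁ x₁ x₂ β ζ s k + (∫ t in t₁..s, nu (velocity ζ t) k * Real.log (q t)) -
        ∫ t in t₁..s, tangentFlux t₁ x₁ x₂ β ζ t k := by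
  have hs' := Ico_subset_Icc_self hs
  have hbase := hζ.intervalIntegrable_nu_mul hv hs' k (h.continuousOn_log_baseSlope hs.2 k)
  have hfactor := hζ.intervalIntegrable_nu_mul hv hs' k (hq.log fun t ht => (hq_pos t ht).ne')
  have hflux := (h.continuousOn_tangentFlux hζ hs k).intervalIntegrable_of_Icc (μ := volume) hs.1
  have hrk := (hζ.continuousOn_rk h.summable₁ hs k).intervalIntegrable_of_Icc (μ := volume) hs.1
  have hsplit : ∫ t in t₁..s, (nu (velocity ζ t) k * Real.log (baseSlope t₁ x₁ x₂ β t k * q t) -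
        tangentFlux t₁ x₁ x₂ β ζ t k + rk (ζ t) k) =
      ∫ t in t₁..s, (nu (velocity ζ t) k * Real.log (baseSlope t₁ x₁ x₂ β t k) +
        nu (velocity ζ t) k * Real.log (q t) - tangentFlux t₁ x₁ x₂ β ζ t k + rk (ζ t) k) := by
    refine intervalIntegral.integral_congr fun t ht => ?_
    rw [uIcc_of_le hs.1] at ht
    simp only [Real.log_mul (h.baseSlope_pos ⟨ht.1, ht.2.trans_lt hs.2⟩ k).ne'
      (hq_pos t ht).ne', mul_add]
  rw [hsplit, intervalIntegral.integral_add ((hbase.add hfactor).sub hflux) hrk,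
    intervalIntegral.integral_sub (hbase.add hfactor) hflux,
    intervalIntegral.integral_add hbase hfactor, bulk]
  ring

theorem ofReal_tangent_le_lintegral_klTerm
    (hflux : ∀ t ∈ Ioo t₁ s,
      baseSlope t₁ x₁ x₂ β t k * q t * rk (ζ t) k ≤ tangentFlux t₁ x₁ x₂ β ζ t k) :
    ENNReal.ofReal (bulk t₁ x₁ x₂ β ζ s k +
        (∫ t in t₁..s, nu (velocity ζ t) k * Real.log (q t)) -
        ∫ t in t₁..s, tangentFlux t₁ x₁ x₂ β ζ t k) ≤
      ∫⁻ t in Ioo t₁ s, klTerm (nu (velocity ζ t) k) (rk (ζ t) k) := by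
  rw [← h.integral_tangent hζ hv hs hq hq_pos k]
  refine ofReal_integral_le_setLIntegral hs.1 (h.intervalIntegrable_tangent hζ hv hs hq hq_pos k) ?_
  filter_upwards [hζ.ae_nu_rk_nonneg hv hs.2.le k] with t hnonneg ht
  have hslope := mul_pos (h.baseSlope_pos ⟨ht.1.le, ht.2.trans hs.2⟩ k)
    (hq_pos t (Ioo_subset_Icc_self ht))
  refine le_trans (ENNReal.ofReal_le_ofReal ?_)
    (ofReal_tangent_le_klTerm (hnonneg ht).1 (hnonneg ht).2 hslope)
  linarith [hflux t ht]

end Tangent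

theorem nu_eq_zero (hk : 1 ≤ k) (hz : zTilde x₁ x₂ β k = 0)
    (ht : t ∈ Ioo t₁ (t₁ + varsig x₁ x₂)) : nu (velocity ζ t) k = 0 := by
  have hx : x₁ k = x₂ k := by
    have hmul := h.zTilde_mul hk
    rw [hz, zero_mul] at hmul
    linarith
  have hconst : (fun u => ζ u k) =ᶠ[nhds t] fun _ => x₁ k := by
    filter_upwards [Icc_mem_nhds ht.1 ht.2] with u hu
    exact le_antisymm (hζ.le_left hk hu) (hx ▸ hζ.right_le hk hu)
  rw [DescendingPath.nu_eq_neg_deriv ζ hk, hconst.deriv_eq, deriv_const, neg_zero]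

theorem action_of_zTilde_eq_zero (hk : 1 ≤ k) (hz : zTilde x₁ x₂ β k = 0)
    (hs : s ∈ Ico t₁ (t₁ + varsig x₁ x₂)) :
    action t₁ x₁ x₂ β ζ s k = ∫ t in t₁..s, rk (ζ t) k := by
  have hlog : ∫ t in t₁..s, nu (velocity ζ t) k * Real.log (baseSlope t₁ x₁ x₂ β t k) = 0 := by
    rw [intervalIntegral.integral_of_le hs.1, integral_Ioc_eq_integral_Ioo]
    refine setIntegral_eq_zero_of_forall_eq_zero fun t ht => ?_
    rw [h.nu_eq_zero hζ hk hz ⟨ht.1, ht.2.trans hs.2⟩, zero_mul]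
  have hflux (t : ℝ) : tangentFlux t₁ x₁ x₂ β ζ t k = 0 := by
    rw [tangentFlux, if_neg (by lia), optRate_eq_mul_decayRate _ _ _ _ hk, hz]
    ring
  simp only [action, bulk, hlog, hz, ellPersp_zero_left, hflux, intervalIntegral.integral_zero]
  ring

section LowerBound

variable (hv : ∀ᵐ t, t ∈ Ioo t₁ (t₁ + varsig x₁ x₂) → SubVelocity (velocity ζ t))
  (hs : s ∈ Ico t₁ (t₁ + varsig x₁ x₂))
include hv hs

-- The shift by `ε` keeps the slope finite when the path reaches `0` before time `s`.
theorem ofReal_shifted_action_le (hk : 1 ≤ k) (hz : 0 < zTilde x₁ x₂ β k) (hε : 0 < ε) :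
    ENNReal.ofReal (bulk t₁ x₁ x₂ β ζ s k +
        (ellPersp (zTilde x₁ x₂ β k) (ζ s k + ε) - ellPersp (zTilde x₁ x₂ β k) (x₁ k + ε)) -
        ∫ t in t₁..s, tangentFlux t₁ x₁ x₂ β ζ t k) ≤
      ∫⁻ t in Ioo t₁ s, klTerm (nu (velocity ζ t) k) (rk (ζ t) k) := by
  have hs' := Ico_subset_Icc_self hs
  have hnonneg : ∀ t ∈ Icc t₁ s, 0 ≤ ζ t k := fun t ht =>
    hζ.nonneg k hk t ⟨ht.1, ht.2.trans hs'.2⟩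
  have hpos : ∀ t ∈ Icc t₁ s, 0 < ζ t k + ε := fun t ht => by linarith [hnonneg t ht]
  have hcont := (hζ.continuousOn h.summable₁ (hs.1.trans hs.2.le) k).mono
    (Icc_subset_Icc_right hs.2.le)
  rw [← hζ.integral_nu_mul_log_div hk hz.ne' hs' hpos]
  refine h.ofReal_tangent_le_lintegral_klTerm hζ hv hs (continuousOn_const.div
    (hcont.add continuousOn_const) fun t ht => (hpos t ht).ne')
    (fun t ht => div_pos hz (hpos t ht)) fun t ht => ?_
  have ht' : t ∈ Ico t₁ (t₁ + varsig x₁ x₂) := ⟨ht.1.le, ht.2.trans hs.2⟩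
  rw [h.baseSlope_mul_div_mul_rk hζ hk ht', tangentFlux, if_neg (by lia)]
  refine mul_le_of_le_one_right (h.optRate_nonneg ht' k) ?_
  rw [div_le_one (hpos t (Ioo_subset_Icc_self ht))]
  linarith

theorem ofReal_action_le (k : ℕ) :
    ENNReal.ofReal (action t₁ x₁ x₂ β ζ s k) ≤
      ∫⁻ t in Ioo t₁ s, klTerm (nu (velocity ζ t) k) (rk (ζ t) k) := by
  rcases Nat.eq_zero_or_pos k with rfl | hk
  · have hle := h.ofReal_tangent_le_lintegral_klTerm hζ hv hs (k := 0) continuousOn_const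
      (fun _ _ => one_pos) fun t ht => by
        rw [mul_one, h.baseSlope_mul_rk_zero hζ ⟨ht.1.le, ht.2.trans hs.2⟩]
    simpa only [action, zTilde_zero, ellPersp_zero_left, sub_self, Real.log_one, mul_zero,
      intervalIntegral.integral_zero] using hle
  rcases (h.zTilde_nonneg k).eq_or_lt' with hz | hz
  · rw [h.action_of_zTilde_eq_zero hζ hk hz hs]
    refine ofReal_integral_le_setLIntegral hs.1
      ((hζ.continuousOn_rk h.summable₁ hs k).intervalIntegrable_of_Icc hs.1)
      (.of_forall fun t ht => ?_)
    rw [h.nu_eq_zero hζ hk hz ⟨ht.1, ht.2.trans hs.2⟩, klTerm_zero_left]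
  · have hcont : Continuous fun ε : ℝ => ENNReal.ofReal (bulk t₁ x₁ x₂ β ζ s k +
        (ellPersp (zTilde x₁ x₂ β k) (ζ s k + ε) - ellPersp (zTilde x₁ x₂ β k) (x₁ k + ε)) -
        ∫ t in t₁..s, tangentFlux t₁ x₁ x₂ β ζ t k) := by
      have hpersp := continuous_ellPersp (zTilde x₁ x₂ β k)
      exact ENNReal.continuous_ofReal.comp (by fun_prop)
    have hlim := (hcont.tendsto 0).mono_left (nhdsWithin_le_nhds (s := Ioi 0))
    simp only [add_zero] at hlim
    exact le_of_tendsto hlim (eventually_nhdsWithin_of_forall fun ε hε =>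
      h.ofReal_shifted_action_le hζ hv hs hk hz hε)

end LowerBound

end Endpoints

namespace Endpoints

variable {x₁ x₂ : ℕ → ℝ} {β : ℝ} (h : Endpoints x₁ x₂ β) {t₁ s : ℝ} {k : ℕ}
  (hs : s ∈ Ico t₁ (t₁ + varsig x₁ x₂))
include h hs

theorem lintegral_klTerm_optPath_of_slope {q : ℝ → ℝ} (hq : ContinuousOn q (Icc t₁ s))
    (hq_pos : ∀ t ∈ Icc t₁ s, 0 < q t)
    (hslope : ∀ t ∈ Ioo t₁ s, baseSlope t₁ x₁ x₂ β t k * q t * rk (optPath t₁ x₁ x₂ β t) k =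
      optRate t₁ x₁ x₂ β t k)
    (hlog : ∫ t in t₁..s, nu (velocity (optPath t₁ x₁ x₂ β) t) k * Real.log (q t) =
      ellPersp (zTilde x₁ x₂ β k) (optPath t₁ x₁ x₂ β s k) -
        ellPersp (zTilde x₁ x₂ β k) (x₁ k)) :
    ∫⁻ t in Ioo t₁ s, klTerm (optRate t₁ x₁ x₂ β t k) (rk (optPath t₁ x₁ x₂ β t) k) =
      ENNReal.ofReal (action t₁ x₁ x₂ β (optPath t₁ x₁ x₂ β) s k) ∧
    0 ≤ action t₁ x₁ x₂ β (optPath t₁ x₁ x₂ β) s k := by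
  have hpath := h.descendingPath_optPath (t₁ := t₁)
  have hv : ∀ᵐ t, t ∈ Ioo t₁ (t₁ + varsig x₁ x₂) →
      SubVelocity (velocity (optPath t₁ x₁ x₂ β) t) :=
    .of_forall fun t ht => h.subVelocity_optPath (Ioo_subset_Ico_self ht)
  have hintegrand (t : ℝ) (ht : t ∈ Ioo t₁ s) :
      nu (velocity (optPath t₁ x₁ x₂ β) t) k * Real.log (baseSlope t₁ x₁ x₂ β t k * q t) -
        tangentFlux t₁ x₁ x₂ β (optPath t₁ x₁ x₂ β) t k + rk (optPath t₁ x₁ x₂ β t) k =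
      rk (optPath t₁ x₁ x₂ β t) k * ell (baseSlope t₁ x₁ x₂ β t k * q t) := by
    rw [tangentFlux_optPath, h.nu_velocity_optPath ⟨ht.1.le, ht.2.trans hs.2⟩, ← hslope t ht, ell]
    ring
  have hnonneg (t : ℝ) (ht : t ∈ Ioo t₁ s) :
      0 ≤ rk (optPath t₁ x₁ x₂ β t) k * ell (baseSlope t₁ x₁ x₂ β t k * q t) :=
    mul_nonneg (rk_nonneg (fun j hj => h.optPath_nonneg hj ⟨ht.1.le, ht.2.le.trans hs.2.le⟩) k)
      (ell_nonneg (mul_pos (h.baseSlope_pos ⟨ht.1.le, ht.2.trans hs.2⟩ k)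
        (hq_pos t (Ioo_subset_Icc_self ht))).le)
  rw [action, ← hlog, ← h.integral_tangent hpath hv hs hq hq_pos k]
  refine ⟨setLIntegral_eq_ofReal_integral hs.1
    (h.intervalIntegrable_tangent hpath hv hs hq hq_pos k)
    (fun t ht => (hintegrand t ht).symm ▸ hnonneg t ht) fun t ht => ?_, ?_⟩
  · rw [hintegrand t ht, ← hslope t ht, klTerm_mul_left, ell]
    congr 1
    ring
  · rw [intervalIntegral.integral_of_le hs.1, integral_Ioc_eq_integral_Ioo]
    exact setIntegral_nonneg measurableSet_Ioo fun t ht => (hintegrand t ht).symm ▸ hnonneg t ht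

theorem lintegral_klTerm_optPath (k : ℕ) :
    ∫⁻ t in Ioo t₁ s, klTerm (optRate t₁ x₁ x₂ β t k) (rk (optPath t₁ x₁ x₂ β t) k) =
      ENNReal.ofReal (action t₁ x₁ x₂ β (optPath t₁ x₁ x₂ β) s k) ∧
    0 ≤ action t₁ x₁ x₂ β (optPath t₁ x₁ x₂ β) s k := by
  have hpath := h.descendingPath_optPath (t₁ := t₁)
  have hIco (t : ℝ) (ht : t ∈ Ioo t₁ s) : t ∈ Ico t₁ (t₁ + varsig x₁ x₂) :=
    ⟨ht.1.le, ht.2.trans hs.2⟩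
  rcases Nat.eq_zero_or_pos k with rfl | hk
  · refine h.lintegral_klTerm_optPath_of_slope hs (q := fun _ => 1) continuousOn_const
      (fun _ _ => one_pos) (fun t ht => ?_) ?_
    · rw [mul_one, h.baseSlope_mul_rk_zero hpath (hIco t ht), tangentFlux_optPath]
    · simp [zTilde_zero, ellPersp_zero_left]
  rcases (h.zTilde_nonneg k).eq_or_lt' with hz | hz
  · have hrk (t : ℝ) (ht : t ∈ Ioo t₁ s) : 0 ≤ rk (optPath t₁ x₁ x₂ β t) k :=
      rk_nonneg (fun j hj => h.optPath_nonneg hj (Ico_subset_Icc_self (hIco t ht))) k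
    rw [h.action_of_zTilde_eq_zero hpath hk hz hs]
    refine ⟨setLIntegral_eq_ofReal_integral hs.1
      ((hpath.continuousOn_rk h.summable₁ hs k).intervalIntegrable_of_Icc hs.1) hrk
      fun t _ => ?_, ?_⟩
    · rw [optRate_eq_mul_decayRate _ _ _ _ hk, hz, mul_zero, zero_mul, zero_mul, klTerm_zero_left]
    · rw [intervalIntegral.integral_of_le hs.1, integral_Ioc_eq_integral_Ioo]
      exact setIntegral_nonneg measurableSet_Ioo hrk
  · have hpos (t : ℝ) (ht : t ∈ Icc t₁ s) : 0 < optPath t₁ x₁ x₂ β t k :=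
      h.optPath_pos hk hz (ht.2.trans_lt hs.2)
    have hcont := (hpath.continuousOn h.summable₁ (hs.1.trans hs.2.le) k).mono
      (Icc_subset_Icc_right hs.2.le)
    refine h.lintegral_klTerm_optPath_of_slope hs
      (q := fun t => zTilde x₁ x₂ β k / optPath t₁ x₁ x₂ β t k)
      (continuousOn_const.div hcont fun t ht => (hpos t ht).ne')
      (fun t ht => div_pos hz (hpos t ht)) (fun t ht => ?_) ?_
    · have hslope := h.baseSlope_mul_div_mul_rk hpath hk (hIco t ht) 0
      rwa [add_zero, div_self (hpos t (Ioo_subset_Icc_self ht)).ne', mul_one,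
        tangentFlux_optPath] at hslope
    · simpa only [add_zero] using hpath.integral_nu_mul_log_div (ε := 0) hk hz.ne'
        (Ico_subset_Icc_self hs) (by simpa only [add_zero] using hpos)

end Endpoints

/-! ### Optimality of the explicit path -/

theorem tsum_ofReal_le_add {ι : Type*} {a b : ι → ℝ} {d : ℝ} (ha : ∀ i, 0 ≤ a i)
    (h : HasSum (fun i => a i - b i) d) :
    ∑' i, ENNReal.ofReal (a i) ≤ ∑' i, ENNReal.ofReal (b i) + ENNReal.ofReal d := by
  by_cases hb : ∑' i, ENNReal.ofReal (b i) = ⊤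
  · rw [hb, top_add]
    exact le_top
  have hb_sum : Summable fun i => (ENNReal.ofReal (b i)).toReal := ENNReal.summable_toReal hb
  have hle (i : ι) : a i ≤ (ENNReal.ofReal (b i)).toReal + (a i - b i) := by
    have : b i ≤ (ENNReal.ofReal (b i)).toReal := by
      rw [ENNReal.toReal_ofReal']
      exact le_max_left _ _
    linarith
  have hsum := hb_sum.hasSum.add h
  have ha_sum : Summable a := hsum.summable.of_nonneg_of_le ha hle
  calc ∑' i, ENNReal.ofReal (a i) = ENNReal.ofReal (∑' i, a i) :=
        (ENNReal.ofReal_tsum_of_nonneg ha ha_sum).symm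
    _ ≤ ENNReal.ofReal ((∑' i, (ENNReal.ofReal (b i)).toReal) + d) :=
        ENNReal.ofReal_le_ofReal (hasSum_le hle ha_sum.hasSum hsum)
    _ ≤ ENNReal.ofReal (∑' i, (ENNReal.ofReal (b i)).toReal) + ENNReal.ofReal d :=
        ENNReal.ofReal_add_le
    _ = ∑' i, ENNReal.ofReal (b i) + ENNReal.ofReal d := by
        rw [← ENNReal.tsum_toReal_eq fun i => ENNReal.ofReal_ne_top, ENNReal.ofReal_toReal hb]

theorem setLIntegral_Ioo_le_of_forall_lt {μ : Measure ℝ} {a b : ℝ} {f : ℝ → ℝ≥0∞} {c : ℝ≥0∞}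
    (h : ∀ s < b, ∫⁻ t in Ioo a s, f t ∂μ ≤ c) : ∫⁻ t in Ioo a b, f t ∂μ ≤ c := by
  obtain ⟨u, hu_mono, hu_lt, hu_tendsto⟩ := exists_seq_strictMono_tendsto b
  have hunion : Ioo a b = ⋃ n, Ioo a (u n) := by
    ext t
    simp only [mem_iUnion, mem_Ioo]
    refine ⟨fun ht => ?_, fun ⟨n, hat, htn⟩ => ⟨hat, htn.trans (hu_lt n)⟩⟩
    obtain ⟨n, hn⟩ := (hu_tendsto.eventually_const_lt ht.2).exists
    exact ⟨n, ht.1, hn⟩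
  have hdir : Directed (· ⊆ ·) fun n => Ioo a (u n) :=
    Monotone.directed_le fun _ _ hmn => Ioo_subset_Ioo_right (hu_mono.monotone hmn)
  rw [hunion, setLIntegral_iUnion_of_directed _ hdir]
  exact iSup_le fun n => h _ (hu_lt n)

theorem lintegral_L_eq_top_of_not_ae_subVelocity {a b : ℝ} {ζ : ℝ → ℕ → ℝ}
    (hv : ¬∀ᵐ t, t ∈ Ioo a b → SubVelocity (velocity ζ t)) :
    ∫⁻ t in Ioo a b, (L (ζ t) (velocity ζ t)).toENNReal = ⊤ := by
  have hmeas : MeasurableSet {t | ¬SubVelocity (velocity ζ t)} :=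
    (measurableSet_subVelocity ζ).compl
  have hne : volume.restrict (Ioo a b) {t | ¬SubVelocity (velocity ζ t)} ≠ 0 := by
    rwa [← ae_restrict_iff' measurableSet_Ioo, ae_iff] at hv
  refine top_unique ?_
  calc (⊤ : ℝ≥0∞) = ∫⁻ _ in {t | ¬SubVelocity (velocity ζ t)}, ⊤ ∂volume.restrict (Ioo a b) := by
        rw [setLIntegral_const, ENNReal.top_mul hne]
    _ = ∫⁻ t in {t | ¬SubVelocity (velocity ζ t)}, (L (ζ t) (velocity ζ t)).toENNReal
          ∂volume.restrict (Ioo a b) :=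
        setLIntegral_congr_fun hmeas fun t ht => by rw [L_eq_top ht, EReal.toENNReal_top]
    _ ≤ _ := setLIntegral_le_lintegral _ _

theorem DescendingPath.aemeasurable_klTerm {x₁ x₂ : ℕ → ℝ} {a b s : ℝ} {ζ : ℝ → ℕ → ℝ}
    (h : DescendingPath x₁ x₂ a b ζ) (hx₁ : Summable fun k : ℕ => (k : ℝ) * x₁ k)
    (hs : s ∈ Ico a b) (k : ℕ) :
    AEMeasurable (fun t => klTerm (nu (velocity ζ t) k) (rk (ζ t) k))
      (volume.restrict (Ioo a s)) :=
  measurable_klTerm.comp_aemeasurable ((measurable_nu_velocity ζ k).aemeasurable.prodMk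
    (((h.continuousOn_rk hx₁ hs k).mono Ioo_subset_Icc_self).aemeasurable measurableSet_Ioo))

theorem DescendingPath.tendsto_right {x₁ x₂ : ℕ → ℝ} {a b : ℝ} {ζ : ℝ → ℕ → ℝ}
    (h : DescendingPath x₁ x₂ a b ζ) (hx₁ : Summable fun k : ℕ => (k : ℝ) * x₁ k) (hab : a ≤ b)
    (k : ℕ) :
    Filter.Tendsto (fun s => ζ s k) (nhdsWithin b (Ioo a b)) (nhds (x₂ k)) := by
  have hcont := h.continuousOn hx₁ hab k b (right_mem_Icc.2 hab)
  rw [ContinuousWithinAt, h.right] at hcont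
  exact hcont.mono_left (nhdsWithin_mono _ Ioo_subset_Icc_self)

namespace Endpoints

variable {x₁ x₂ : ℕ → ℝ} {β : ℝ} (h : Endpoints x₁ x₂ β) {t₁ s t : ℝ}
include h

theorem sub_le_zTilde {k : ℕ} (hk : 1 ≤ k) : x₁ k - x₂ k ≤ zTilde x₁ x₂ β k := by
  rw [← h.zTilde_mul hk]
  exact mul_le_of_le_one_right (h.zTilde_nonneg k) (sub_le_self _ (pow_nonneg h.beta_nonneg k))

theorem zero₂_eq_zero (hβ : β = 0) : x₂ 0 = 0 := by
  rcases h.isBeta with ⟨hx, -, -⟩ | ⟨-, hβ', -⟩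
  · exact hx
  · exact absurd hβ hβ'.1.ne'

theorem tendsto_timeLeft (t₁ : ℝ) : Filter.Tendsto (timeLeft t₁ x₁ x₂ β)
    (nhdsWithin (t₁ + varsig x₁ x₂) (Ioo t₁ (t₁ + varsig x₁ x₂))) (nhds (β ^ 2)) := by
  have hcont : Continuous (timeLeft t₁ x₁ x₂ β) := by
    unfold timeLeft
    fun_prop
  rw [← h.timeLeft_right t₁]
  exact (hcont.tendsto _).mono_left nhdsWithin_le_nhds

theorem summable_ellPersp_bound :
    Summable fun k : ℕ => 2 * ((k : ℝ) * zTilde x₁ x₂ β k + (k : ℝ) * x₁ k) :=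
  (h.summable_zTilde.add h.summable₁).mul_left 2

variable {ζ : ℝ → ℕ → ℝ} (hζ : DescendingPath x₁ x₂ t₁ (t₁ + varsig x₁ x₂) ζ)
include hζ

theorem abs_ellPersp_sub_path_le (ht : t ∈ Icc t₁ (t₁ + varsig x₁ x₂)) (k : ℕ) :
    |ellPersp (zTilde x₁ x₂ β k) (x₁ k) - ellPersp (zTilde x₁ x₂ β k) (ζ t k)| ≤
      k * zTilde x₁ x₂ β k + k * x₁ k := by
  rcases Nat.eq_zero_or_pos k with rfl | hk
  · simp [zTilde_zero, ellPersp_zero_left]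
  · have hz := h.zTilde_nonneg k
    have hx := (h.nonneg₂ k hk).trans (h.le₂₁ k hk)
    have hk1 : (1 : ℝ) ≤ k := mod_cast hk
    have hdecr : x₁ k - ζ t k ≤ zTilde x₁ x₂ β k :=
      (sub_le_sub_left (hζ.right_le hk ht) _).trans (h.sub_le_zTilde hk)
    exact (abs_ellPersp_sub_le hz (hζ.nonneg k hk t ht) (hζ.le_left hk ht) hdecr).trans
      (add_le_add (le_mul_of_one_le_left hz hk1) (le_mul_of_one_le_left hx hk1))

theorem abs_ellPersp_optPath_sub_le (ht : t ∈ Icc t₁ (t₁ + varsig x₁ x₂)) (k : ℕ) :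
    |ellPersp (zTilde x₁ x₂ β k) (optPath t₁ x₁ x₂ β t k) -
        ellPersp (zTilde x₁ x₂ β k) (ζ t k)| ≤
      2 * (k * zTilde x₁ x₂ β k + k * x₁ k) := by
  refine (abs_sub_le _ (ellPersp (zTilde x₁ x₂ β k) (x₁ k)) _).trans ?_
  rw [abs_sub_comm, two_mul]
  exact add_le_add (h.abs_ellPersp_sub_path_le h.descendingPath_optPath ht k)
    (h.abs_ellPersp_sub_path_le hζ ht k)

theorem hasSum_integral_tangentFlux_sub (hs : s ∈ Ico t₁ (t₁ + varsig x₁ x₂)) :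
    HasSum (fun k => (∫ t in t₁..s, tangentFlux t₁ x₁ x₂ β (optPath t₁ x₁ x₂ β) t k) -
        ∫ t in t₁..s, tangentFlux t₁ x₁ x₂ β ζ t k)
      ((∫ t in t₁..s, (optPath t₁ x₁ x₂ β t 0 - x₁ 0 + 2 * (t - t₁)) *
          decayRate t₁ x₁ x₂ β t) -
        ∫ t in t₁..s, (ζ t 0 - x₁ 0 + 2 * (t - t₁)) * decayRate t₁ x₁ x₂ β t) := by
  have hcommon : IntervalIntegrable
      (fun t => (2 * (t - t₁) - x₁ 0) * decayRate t₁ x₁ x₂ β t) volume t₁ s :=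
    (ContinuousOn.mul (by fun_prop) (h.continuousOn_decayRate hs.2)).intervalIntegrable_of_Icc hs.1
  have hzero {ξ : ℝ → ℕ → ℝ} (hξ : DescendingPath x₁ x₂ t₁ (t₁ + varsig x₁ x₂) ξ) :
      ∫ t in t₁..s, (ξ t 0 - x₁ 0 + 2 * (t - t₁)) * decayRate t₁ x₁ x₂ β t =
        (∫ t in t₁..s, tangentFlux t₁ x₁ x₂ β ξ t 0) +
          ∫ t in t₁..s, (2 * (t - t₁) - x₁ 0) * decayRate t₁ x₁ x₂ β t := by
    rw [← intervalIntegral.integral_add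
      ((h.continuousOn_tangentFlux hξ hs 0).intervalIntegrable_of_Icc hs.1) hcommon]
    refine intervalIntegral.integral_congr fun t _ => ?_
    simp only [tangentFlux, if_true]
    ring
  rw [hzero hζ, hzero h.descendingPath_optPath, add_sub_add_right_eq_sub]
  refine hasSum_single 0 fun k hk => ?_
  simp only [tangentFlux, if_neg hk, sub_self]

theorem hasSum_action_sub (hs : s ∈ Ico t₁ (t₁ + varsig x₁ x₂))
    (hv : ∀ᵐ t, t ∈ Ioo t₁ (t₁ + varsig x₁ x₂) → SubVelocity (velocity ζ t)) :
    HasSum (fun k => action t₁ x₁ x₂ β (optPath t₁ x₁ x₂ β) s k - action t₁ x₁ x₂ β ζ s k)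
      ((optPath t₁ x₁ x₂ β s 0 - ζ s 0) * (Real.log (timeLeft t₁ x₁ x₂ β s) / 2) +
        ∑' k, (ellPersp (zTilde x₁ x₂ β k) (optPath t₁ x₁ x₂ β s k) -
          ellPersp (zTilde x₁ x₂ β k) (ζ s k))) := by
  have hv_opt : ∀ᵐ t, t ∈ Ioo t₁ (t₁ + varsig x₁ x₂) →
      SubVelocity (velocity (optPath t₁ x₁ x₂ β) t) :=
    .of_forall fun t ht => h.subVelocity_optPath (Ioo_subset_Ico_self ht)
  have hbulk := (h.hasSum_bulk h.descendingPath_optPath hv_opt hs).sub (h.hasSum_bulk hζ hv hs)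
  have hpersp : Summable fun k => ellPersp (zTilde x₁ x₂ β k) (optPath t₁ x₁ x₂ β s k) -
      ellPersp (zTilde x₁ x₂ β k) (ζ s k) :=
    h.summable_ellPersp_bound.of_norm_bounded
      (h.abs_ellPersp_optPath_sub_le hζ (Ico_subset_Icc_self hs))
  have hsum := ((hbulk.add hpersp.hasSum).sub (h.hasSum_integral_tangentFlux_sub hζ hs)).congr_fun
    (g := fun k => action t₁ x₁ x₂ β (optPath t₁ x₁ x₂ β) s k - action t₁ x₁ x₂ β ζ s k)
    fun k => by
      unfold action
      ring
  convert! hsum using 1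
  ring

theorem tendsto_tsum_ellPersp_sub :
    Filter.Tendsto (fun s => ∑' k, (ellPersp (zTilde x₁ x₂ β k) (optPath t₁ x₁ x₂ β s k) -
        ellPersp (zTilde x₁ x₂ β k) (ζ s k)))
      (nhdsWithin (t₁ + varsig x₁ x₂) (Ioo t₁ (t₁ + varsig x₁ x₂))) (nhds 0) := by
  have hlim {ξ : ℝ → ℕ → ℝ} (hξ : DescendingPath x₁ x₂ t₁ (t₁ + varsig x₁ x₂) ξ) (k : ℕ) :=
    ((continuous_ellPersp (zTilde x₁ x₂ β k)).tendsto _).comp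
      (hξ.tendsto_right h.summable₁ (h.le_add_varsig t₁) k)
  rw [← tsum_zero (α := ℝ) (β := ℕ)]
  refine tendsto_tsum_of_dominated_convergence h.summable_ellPersp_bound (fun k => ?_) ?_
  · rw [← sub_self (ellPersp (zTilde x₁ x₂ β k) (x₂ k))]
    exact (hlim h.descendingPath_optPath k).sub (hlim hζ k)
  · filter_upwards [self_mem_nhdsWithin] with s hs
    exact h.abs_ellPersp_optPath_sub_le hζ (Ioo_subset_Icc_self hs)

-- After time `t` the zeroth coordinate falls by at most `2 (t₁ + ς - t)`, and for `β = 0` it ends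
-- at `0`.
theorem zero_le_of_beta_eq_zero (hβ : β = 0) (ht : t ∈ Icc t₁ (t₁ + varsig x₁ x₂)) :
    ζ t 0 ≤ 2 * (sigmaTilde x₁ x₂ β * timeLeft t₁ x₁ x₂ β t) := by
  have hright : t₁ + varsig x₁ x₂ ∈ Icc t₁ (t₁ + varsig x₁ x₂) :=
    right_mem_Icc.2 (h.le_add_varsig t₁)
  have hterm (k : ℕ) : (k : ℝ) * (x₁ k - ζ t k) ≤ k * (x₁ k - ζ (t₁ + varsig x₁ x₂) k) := by
    rcases Nat.eq_zero_or_pos k with rfl | hk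
    · simp
    · have := hζ.anti k hk ht hright ht.2
      dsimp only at this
      gcongr
  have hle := hasSum_le hterm (hζ.hasSum_decrease h.summable₁ ht)
    (hζ.hasSum_decrease h.summable₁ hright)
  rw [hζ.right, h.zero₂_eq_zero hβ] at hle
  have hσ : sigmaTilde x₁ x₂ β = varsig x₁ x₂ := by simpa [hβ] using h.sigmaTilde_mul
  have helapsed := h.sigmaTilde_mul_one_sub_timeLeft (t₁ := t₁) (t := t)
  linarith

theorem tendsto_zero_sub_mul_log_of_beta_eq_zero (hβ : β = 0) :
    Filter.Tendsto (fun s => (optPath t₁ x₁ x₂ β s 0 - ζ s 0) *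
        (Real.log (timeLeft t₁ x₁ x₂ β s) / 2))
      (nhdsWithin (t₁ + varsig x₁ x₂) (Ioo t₁ (t₁ + varsig x₁ x₂))) (nhds 0) := by
  have hbound : Filter.Tendsto (fun s => sigmaTilde x₁ x₂ β *
        |timeLeft t₁ x₁ x₂ β s * Real.log (timeLeft t₁ x₁ x₂ β s)|)
      (nhdsWithin (t₁ + varsig x₁ x₂) (Ioo t₁ (t₁ + varsig x₁ x₂))) (nhds 0) := by
    have hlim := ((Real.continuous_mul_log.tendsto (β ^ 2)).comp
      (h.tendsto_timeLeft t₁)).abs.const_mul (sigmaTilde x₁ x₂ β)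
    have hzero : sigmaTilde x₁ x₂ β * |β ^ 2 * Real.log (β ^ 2)| = 0 := by simp [hβ]
    rwa [hzero] at hlim
  refine squeeze_zero_norm' ?_ hbound
  filter_upwards [self_mem_nhdsWithin] with s hs
  have hs' := Ioo_subset_Icc_self hs
  have hdist : |optPath t₁ x₁ x₂ β s 0 - ζ s 0| ≤
      2 * (sigmaTilde x₁ x₂ β * timeLeft t₁ x₁ x₂ β s) :=
    abs_sub_le_of_nonneg_of_le (h.optPath_zero_nonneg hs')
      (h.zero_le_of_beta_eq_zero h.descendingPath_optPath hβ hs')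
      (hζ.zero_nonneg s hs') (h.zero_le_of_beta_eq_zero hζ hβ hs')
  calc ‖(optPath t₁ x₁ x₂ β s 0 - ζ s 0) * (Real.log (timeLeft t₁ x₁ x₂ β s) / 2)‖
      = |optPath t₁ x₁ x₂ β s 0 - ζ s 0| * (|Real.log (timeLeft t₁ x₁ x₂ β s)| / 2) := by
        rw [Real.norm_eq_abs, abs_mul, abs_div, abs_two]
    _ ≤ 2 * (sigmaTilde x₁ x₂ β * timeLeft t₁ x₁ x₂ β s) *
          (|Real.log (timeLeft t₁ x₁ x₂ β s)| / 2) := by gcongr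
    _ = _ := by
        rw [abs_mul, abs_of_pos (h.timeLeft_pos hs.2)]
        ring

theorem tendsto_zero_sub_mul_log :
    Filter.Tendsto (fun s => (optPath t₁ x₁ x₂ β s 0 - ζ s 0) *
        (Real.log (timeLeft t₁ x₁ x₂ β s) / 2))
      (nhdsWithin (t₁ + varsig x₁ x₂) (Ioo t₁ (t₁ + varsig x₁ x₂))) (nhds 0) := by
  rcases h.beta_nonneg.eq_or_lt with hβ | hβ
  · exact h.tendsto_zero_sub_mul_log_of_beta_eq_zero hζ hβ.symm
  · have hle := h.le_add_varsig t₁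
    have hsub := (h.descendingPath_optPath.tendsto_right h.summable₁ hle 0).sub
      (hζ.tendsto_right h.summable₁ hle 0)
    have hlog := ((h.tendsto_timeLeft t₁).log (pow_pos hβ 2).ne').div_const 2
    simpa only [sub_self, zero_mul] using hsub.mul hlog

variable (hv : ∀ᵐ t, t ∈ Ioo t₁ (t₁ + varsig x₁ x₂) → SubVelocity (velocity ζ t))
include hv

theorem lintegral_optPath_le_add (hs : s ∈ Ico t₁ (t₁ + varsig x₁ x₂)) :
    ∫⁻ t in Ioo t₁ s, ∑' k, klTerm (optRate t₁ x₁ x₂ β t k) (rk (optPath t₁ x₁ x₂ β t) k) ≤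
      (∫⁻ t in Ioo t₁ s, ∑' k, klTerm (nu (velocity ζ t) k) (rk (ζ t) k)) +
      ENNReal.ofReal
        ((optPath t₁ x₁ x₂ β s 0 - ζ s 0) * (Real.log (timeLeft t₁ x₁ x₂ β s) / 2) +
          ∑' k, (ellPersp (zTilde x₁ x₂ β k) (optPath t₁ x₁ x₂ β s k) -
            ellPersp (zTilde x₁ x₂ β k) (ζ s k))) := by
  have hmeas (k : ℕ) : AEMeasurable (fun t => klTerm (optRate t₁ x₁ x₂ β t k)
      (rk (optPath t₁ x₁ x₂ β t) k)) (volume.restrict (Ioo t₁ s)) := by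
    refine (h.descendingPath_optPath.aemeasurable_klTerm h.summable₁ hs k).congr ?_
    filter_upwards [ae_restrict_mem measurableSet_Ioo] with t ht
    rw [h.nu_velocity_optPath ⟨ht.1.le, ht.2.trans hs.2⟩]
  rw [lintegral_tsum hmeas, lintegral_tsum fun k => hζ.aemeasurable_klTerm h.summable₁ hs k]
  simp only [(h.lintegral_klTerm_optPath hs _).1]
  refine (tsum_ofReal_le_add (fun k => (h.lintegral_klTerm_optPath hs k).2)
    (h.hasSum_action_sub hζ hs hv)).trans ?_
  gcongr with k
  exact h.ofReal_action_le hζ hv hs k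

theorem lintegral_optPath_le :
    ∫⁻ t in Ioo t₁ (t₁ + varsig x₁ x₂),
        ∑' k, klTerm (optRate t₁ x₁ x₂ β t k) (rk (optPath t₁ x₁ x₂ β t) k) ≤
      ∫⁻ t in Ioo t₁ (t₁ + varsig x₁ x₂), ∑' k, klTerm (nu (velocity ζ t) k) (rk (ζ t) k) := by
  have : (nhdsWithin (t₁ + varsig x₁ x₂) (Ioo t₁ (t₁ + varsig x₁ x₂))).NeBot :=
    right_nhdsWithin_Ioo_neBot (lt_add_of_pos_right t₁ h.varsig_pos)
  refine setLIntegral_Ioo_le_of_forall_lt fun s hs => ?_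
  have hlim := (ENNReal.tendsto_ofReal ((h.tendsto_zero_sub_mul_log hζ).add
    (h.tendsto_tsum_ellPersp_sub hζ))).const_add
      (∫⁻ t in Ioo t₁ (t₁ + varsig x₁ x₂), ∑' k, klTerm (nu (velocity ζ t) k) (rk (ζ t) k))
  rw [add_zero, ENNReal.ofReal_zero, add_zero] at hlim
  refine ge_of_tendsto hlim ?_
  filter_upwards [self_mem_nhdsWithin, mem_nhdsWithin_of_mem_nhds (Ioi_mem_nhds hs)] with u hu hsu
  refine (lintegral_mono_set (Ioo_subset_Ioo_right hsu.le)).trans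
    ((h.lintegral_optPath_le_add hζ hv (Ioo_subset_Ico_self hu)).trans ?_)
  gcongr
  exact hu.2.le

omit hv in
theorem LCost_optPath_le :
    LCost t₁ (t₁ + varsig x₁ x₂) (optPath t₁ x₁ x₂ β) ≤ LCost t₁ (t₁ + varsig x₁ x₂) ζ := by
  rw [h.LCost_optPath, hζ.LCost_eq h.summable₁, EReal.coe_ennreal_le_coe_ennreal_iff]
  by_cases hv : ∀ᵐ t, t ∈ Ioo t₁ (t₁ + varsig x₁ x₂) → SubVelocity (velocity ζ t)
  · refine (h.lintegral_optPath_le hζ hv).trans_eq (setLIntegral_congr_fun_ae measurableSet_Ioo ?_)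
    filter_upwards [hv] with t hsub ht
    rw [hζ.L_eq h.summable₁ ht (hsub ht), EReal.toENNReal_coe]
  · rw [lintegral_L_eq_top_of_not_ae_subVelocity hv]
    exact le_top

end Endpoints

namespace Endpoints

variable {p x₁ x₂ : ℕ → ℝ} {β t₁ : ℝ} {ζs : ℝ → ℕ → ℝ} {ψs : ℝ → ℝ} (h : Endpoints x₁ x₂ β)
  (hp : Summable fun k : ℕ => (k : ℝ) * p k) (ht₁ : 0 ≤ t₁) (hs : (ζs, ψs) ∈ J0 p 0 t₁ p x₁)
include h hp ht₁ hs

theorem iInf_LCost_eq_tilde :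
    (⨅ w ∈ J2 p t₁ (t₁ + varsig x₁ x₂) x₁ x₂, LCost t₁ (t₁ + varsig x₁ x₂) w.1) =
      LCost t₁ (t₁ + varsig x₁ x₂) (tildeζ t₁ x₁ x₂ β ζs) := by
  refine le_antisymm (iInf₂_le _ (h.tilde_mem_J2 ht₁ hs)) (le_iInf₂ fun w hw => ?_)
  rw [h.LCost_tilde hp ht₁ hs]
  exact h.LCost_optPath_le
    (descendingPath_of_mem_J2 hp ht₁ (lt_add_of_pos_right t₁ h.varsig_pos) hw)

theorem I2_eq_LCost_tilde (hcontrol : ∃ φ, IsControl p t₁ ζs ψs φ) :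
    (I2 p t₁ (t₁ + varsig x₁ x₂) x₁ x₂ : EReal) =
      LCost t₁ (t₁ + varsig x₁ x₂) (tildeζ t₁ x₁ x₂ β ζs) := by
  have hlt := lt_add_of_pos_right t₁ h.varsig_pos
  rw [h.LCost_tilde hp ht₁ hs]
  apply le_antisymm
  · refine le_trans ?_ (h.pathCost_tilde_le hp ht₁ hs.1 hs.2.2 hcontrol)
    exact EReal.coe_ennreal_le_coe_ennreal_iff.2 (iInf₂_le _ (h.tilde_mem_J2 ht₁ hs))
  · rw [h.LCost_optPath, EReal.coe_ennreal_le_coe_ennreal_iff]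
    refine le_iInf₂ fun w hw => ?_
    rw [← EReal.coe_ennreal_le_coe_ennreal_iff, ← h.LCost_optPath]
    exact (h.LCost_optPath_le (descendingPath_of_mem_J2 hp ht₁ hlt hw)).trans
      (LCost_le_pathCost hp ht₁ hlt hw)

end Endpoints

theorem summable_mul_of_moment {p : ℕ → ℝ} (hp : ∀ k, 0 ≤ p k) {ε : ℝ} (hε : 0 ≤ ε)
    (hs : Summable fun k : ℕ => p k * (k : ℝ) ^ (1 + ε)) :
    Summable fun k : ℕ => (k : ℝ) * p k := by
  refine hs.of_nonneg_of_le (fun k => mul_nonneg k.cast_nonneg (hp k)) fun k => ?_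
  rw [mul_comm]
  refine mul_le_mul_of_nonneg_left ?_ (hp k)
  rcases Nat.eq_zero_or_pos k with rfl | hk
  · simpa only [Nat.cast_zero] using Real.rpow_nonneg le_rfl (1 + ε)
  · exact Real.self_le_rpow_of_one_le (Nat.one_le_cast.2 hk) (le_add_of_nonneg_right hε)

theorem summable_succ_mul_sub {x y : ℕ → ℝ} (hx : Summable fun k : ℕ => (k : ℝ) * x k)
    (hy : Summable fun k : ℕ => (k : ℝ) * y k) :
    Summable fun k : ℕ => ((k : ℝ) + 1) * (x (k + 1) - y (k + 1)) := by
  simpa only [← mul_sub, Nat.cast_add_one] using (summable_nat_add_iff 1).2 (hx.sub hy)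

theorem exists_isControl_of_pathCost_lt_top {p : ℕ → ℝ} {t₁ t₂ : ℝ} {ζ : ℝ → ℕ → ℝ} {ψ : ℝ → ℝ}
    (h : pathCost p t₁ t₂ ζ ψ < ⊤) : ∃ φ, IsControl p t₂ ζ ψ φ := by
  obtain ⟨φ, hφ⟩ := iInf_lt_iff.1 h
  exact ⟨φ, (iInf_lt_iff.1 hφ).choose⟩

end ConfigModel

end

theorem mainTheorem8_general
    (p : ℕ → ℝ) (hp : Summable fun k : ℕ => (k : ℝ) * p k)
    (x₁ x₂ : ℕ → ℝ) (hx₂_zero : 0 ≤ x₂ 0)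
    (hx₂ : ∀ k : ℕ, 1 ≤ k → 0 ≤ x₂ k) (hx₂₁ : ∀ k : ℕ, 1 ≤ k → x₂ k ≤ x₁ k)
    (hz : 2 * ∑' k : ℕ, (x₁ (k + 1) - x₂ (k + 1)) <
      (∑' k : ℕ, ((k : ℝ) + 1) * (x₁ (k + 1) - x₂ (k + 1))) + (x₁ 0 - x₂ 0))
    (t₁ : ℝ) (ht₁ : 0 ≤ t₁)
    (ζs : ℝ → ℕ → ℝ) (ψs : ℝ → ℝ) (hs : (ζs, ψs) ∈ J0 p 0 t₁ p x₁)
    (hcontrol : ∃ φ, IsControl p t₁ ζs ψs φ) :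
    (∃! β : ℝ, IsBeta x₁ x₂ β) ∧
    ∀ β : ℝ, IsBeta x₁ x₂ β →
      (tildeζ t₁ x₁ x₂ β ζs, tildeψ t₁ x₁ x₂ β ψs) ∈ J2 p t₁ (t₁ + varsig x₁ x₂) x₁ x₂ ∧
      (I2 p t₁ (t₁ + varsig x₁ x₂) x₁ x₂ : EReal) =
        (⨅ w ∈ J2 p t₁ (t₁ + varsig x₁ x₂) x₁ x₂, LCost t₁ (t₁ + varsig x₁ x₂) w.1) ∧
      (⨅ w ∈ J2 p t₁ (t₁ + varsig x₁ x₂) x₁ x₂, LCost t₁ (t₁ + varsig x₁ x₂) w.1) =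
        LCost t₁ (t₁ + varsig x₁ x₂) (tildeζ t₁ x₁ x₂ β ζs) := by
  obtain ⟨hadm, -, hx₁⟩ := id hs
  have hmem : t₁ ∈ Icc 0 t₁ := right_mem_Icc.2 ht₁
  have hx₁_zero : 0 ≤ x₁ 0 := hx₁ ▸ hadm.zero_nonneg hmem
  have hx₁_sum : Summable fun k : ℕ => (k : ℝ) * x₁ k := hx₁ ▸ hadm.summable hp hmem
  have hx₂_sum := summable_mul_of_le hx₁_sum hx₂ hx₂₁
  refine ⟨existsUnique_isBeta hx₁_zero hx₂_zero hx₂₁ (summable_succ_mul_sub hx₁_sum hx₂_sum) hz,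
    fun β hβ => ?_⟩
  have h : Endpoints x₁ x₂ β := ⟨hx₁_sum, hx₁_zero, hx₂_zero, hx₂, hx₂₁, hz, hβ⟩
  have hinf := h.iInf_LCost_eq_tilde hp ht₁ hs
  exact ⟨h.tilde_mem_J2 ht₁ hs, (h.I2_eq_LCost_tilde hp ht₁ hs hcontrol).trans hinf.symm, hinf⟩

theorem mainTheorem8
    -- the limiting degree distribution `p` on `{1, 2, …}` (extended by `p 0 = 0`)
    (p : ℕ → ℝ) (hp_nonneg : ∀ k, 0 ≤ p k) (hp_zero : p 0 = 0) (hp_sum : HasSum p 1)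
    (hp_moment : ∃ ε : ℝ, 0 < ε ∧ Summable (fun k : ℕ => p k * (k : ℝ) ^ (1 + ε)))
    -- the two endpoints, `0 ≤ p⁽²⁾ ≤ p⁽¹⁾ ≤ p`
    (x₁ x₂ : ℕ → ℝ) (hx₁_zero : 0 ≤ x₁ 0) (hx₂_zero : 0 ≤ x₂ 0)
    (hx₂ : ∀ k : ℕ, 1 ≤ k → 0 ≤ x₂ k) (hx₂₁ : ∀ k : ℕ, 1 ≤ k → x₂ k ≤ x₁ k)
    (hx₁p : ∀ k : ℕ, 1 ≤ k → x₁ k ≤ p k)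
    (hς : 0 ≤ varsig x₁ x₂)
    (hz : 2 * ∑' k : ℕ, (x₁ (k + 1) - x₂ (k + 1)) <
      (∑' k : ℕ, ((k : ℝ) + 1) * (x₁ (k + 1) - x₂ (k + 1))) + (x₁ 0 - x₂ 0))
    (t₁ : ℝ) (ht₁ : 0 ≤ t₁)
    -- a path of finite cost from `(0, p)` at time `0` to `x₁` at time `t₁`
    (ζs : ℝ → ℕ → ℝ) (ψs : ℝ → ℝ) (hs : (ζs, ψs) ∈ J0 p 0 t₁ p x₁)
    (hs_cost : pathCost p 0 t₁ ζs ψs < ⊤) :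
    (∃! β : ℝ, IsBeta x₁ x₂ β) ∧
    ∀ β : ℝ, IsBeta x₁ x₂ β →
      (tildeζ t₁ x₁ x₂ β ζs, tildeψ t₁ x₁ x₂ β ψs) ∈ J2 p t₁ (t₁ + varsig x₁ x₂) x₁ x₂ ∧
      (I2 p t₁ (t₁ + varsig x₁ x₂) x₁ x₂ : EReal) =
        (⨅ w ∈ J2 p t₁ (t₁ + varsig x₁ x₂) x₁ x₂, LCost t₁ (t₁ + varsig x₁ x₂) w.1) ∧
      (⨅ w ∈ J2 p t₁ (t₁ + varsig x₁ x₂) x₁ x₂, LCost t₁ (t₁ + varsig x₁ x₂) w.1) =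
        LCost t₁ (t₁ + varsig x₁ x₂) (tildeζ t₁ x₁ x₂ β ζs) := by
  obtain ⟨ε, hε, hmom⟩ := hp_moment
  exact mainTheorem8_general p (summable_mul_of_moment hp_nonneg hε.le hmom) x₁ x₂ hx₂_zero hx₂ hx₂₁
    hz t₁ ht₁ ζs ψs hs (exists_isControl_of_pathCost_lt_top hs_cost)
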